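/- Let $(\mathcal A,\varphi,\varphi_2)$ be a second order probability space: $\mathcal A$ is a unital $*$-algebra over $\mathbb C$, $\varphi:\mathcal A\to\mathbb C$ is a linear tracial functional with $\varphi(1)=1$, and $\varphi_2:\mathcal A\times\mathcal A\to\mathbb C$ is bilinear, symmetric, tracial in each variable, with $\varphi_2(1,a)=\varphi_2(a,1)=0$ for all $a$. **Permutations.** For a permutation $\pi$ of $n$ points let $\#(\pi)$ be the number of its cycles and $|\pi|=n-\#(\pi)$. Let $NC(n)$ be the set of non-crossing partitions of $[n]=\{1,\dots,n\}$, each regarded as the permutation whose cycles are the blocks in increasing order. For $m,n\ge 1$ let $\gamma_{m,n}=(1,\dots,m)(m+1,\dots,m+n)$; its two cycles are called circles. Let $S_{NC}(m,n)$ be the set of permutations $\pi$ of $[m+n]$ having at least one cycle that meets both circles and satisfying $|\gamma_{m,n}|+2=|\pi|+|\pi^{-1}\gamma_{m,n}|$. Let $PS_{NC}(m,n)'$ be the set of pairs $(\mathcal U,\pi)$ where $\pi=\pi_1\times\pi_2\in NC(m)\times NC(n)$ and $\mathcal U$ is the partition obtained from the cycle partition of $\pi$ by joining one cycle of $\pi_1$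 with one cycle of $\pi_2$. Let $PS_{NC}(m,n)=S_{NC}(m,n)\cup PS_{NC}(m,n)'$, where $\pi\in S_{NC}(m,n)$ is identified with $(0_\pi,\pi)$, $0_\pi$ being the partition of $[m+n]$ into the cycles of $\pi$. **Multiplicative extension.** Given functions $f_n$ of $n$ arguments and $g_{r,s}$ of $r+s$ arguments, put $f_\pi(a_1,\dots,a_n)=\prod f_l(a_{i_1},\dots,a_{i_l})$, the product over the cycles $(i_1,\dots,i_l)$ of $\pi$. For a pair $(\mathcal U,\pi)\in PS_{NC}(m,n)$ take the product over the blocks of $\mathcal U$: a block which is a single cycle of $\pi$ contributes $f_l$ as above, and a block which is the union of a cycle $(i_1,\dots,i_r)$ in the first circle and a cycle $(j_1,\dots,j_s)$ in the second contributes $g_{r,s}(a_{i_1},\dots,a_{i_r},a_{j_1},\dots,a_{j_s})$. Each cycle is written starting from its least element. For sequences of numbers $(\beta_n)$, $(\beta_{p,q})$ the extension $\beta_{(\mathcal V,\pi)}$ is defined in the same way, without arguments. **Cumulants.** The free cumulants $\kappa_n$ and the second order free cumulants $\kappa_{m,n}$ ($m,n\ge1$) are determined recursively by the moment-cumulant formulas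 $$\varphi(a_1\cdots a_n)=\sum_{\pi\in NC(n)}\kappa_\pi(a_1,\dots,a_n),$$ $$\varphi_2(a_1\cdots a_m,\;a_{m+1}\cdots a_{m+n})=\sum_{\pi\in S_{NC}(m,n)}\kappa_\pi(a_1,\dots,a_{m+n})+\sum_{(\mathcal U,\pi)\in PS_{NC}(m,n)'}\kappa_{(\mathcal U,\pi)}(a_1,\dots,a_{m+n}).$$ **Theorem.** Let $x\in\mathcal A$ be second order even, i.e. $x=x^*$, $\varphi(x^{2n+1})=0$ for all $n\ge0$, and $\varphi_2(x^p,x^q)=0$ unless $p$ and $q$ are both even. Define its determining sequences by $\beta_n=\kappa_{2n}(x,\dots,x)$ and $$\beta_{p,q}=\kappa_{2p,2q}(x,\dots,x)+\sum_{\pi\in S_{NC}^{+,\mathrm{all}}(2p,2q)}\kappa_\pi(x,\dots,x),$$ where $S_{NC}^{+,\mathrm{all}}(2p,2q)$ is the set of $\pi\in S_{NC}(2p,2q)$ all of whose cycles have an even number of elements and meet both circles, and such that $k$ and $\pi(k)$ have the same parity whenever they lie on different circles. Then for all $p,q\ge1$ $$\kappa_{p,q}(x^2,\dots,x^2)=\sum_{(\mathcal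 V,\pi)\in PS_{NC}(p,q)}\beta_{(\mathcal V,\pi)}.$$ -/

import Mathlib

namespace SecondOrder

open Finset Equiv

/-! ### Permutations and their cycles -/

section Cycles

variable {ι : Type*} [Fintype ι] [LinearOrder ι]

open Classical in
/-- The least elements of the cycles of `π`: exactly one representative for each cycle
(fixed points are cycles of length one). -/
noncomputable def cycleMins (π : Perm ι) : Finset ι :=
  univ.filter fun x => ∀ y, π.SameCycle x y → x ≤ y

/-- The number `#(π)` of cycles of `π`. -/
noncomputable def numCycles (π : Perm ι) : ℕ := #(cycleMins π)

/-- The length `|π| = n - #(π)` of a permutation of `n` points. -/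
noncomputable def permLength (π : Perm ι) : ℕ := Fintype.card ι - numCycles π

/-- The number of elements of the cycle of `π` through `x`. -/
noncomputable def cycleLen (π : Perm ι) (x : ι) : ℕ := Function.minimalPeriod π x

/-- The entries of `a` along the cycle `(x, π x, π² x, …)` of `π`, starting at `x`. -/
def cycleEntries {M : Type*} (π : Perm ι) (a : ι → M) (x : ι) : Fin (cycleLen π x) → M :=
  fun k => a ((π ^ (k : ℕ)) x)

open Classical in
/-- The partition `0_π` of the index set whose blocks are the cycles of `π`. -/
noncomputable def cyclePartition (π : Perm ι) : Finpartition (univ : Finset ι) :=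
  Finpartition.ofSetoid (Perm.SameCycle.setoid π)

/-- A permutation is even if all its cycles have an even number of elements. -/
def IsEvenPerm (π : Perm ι) : Prop := ∀ x, Even (cycleLen π x)

/-- The multiplicative extension `f_π` of a sequence of functions `f_n` of `n` arguments:
the product over the cycles `(i₁, …, i_l)` of `π` of `f_l(a_{i₁}, …, a_{i_l})`. -/
noncomputable def permExt {M : Type*} (f : (n : ℕ) → (Fin n → M) → ℂ) (π : Perm ι)
    (a : ι → M) : ℂ :=
  ∏ x ∈ cycleMins π, f (cycleLen π x) (cycleEntries π a x)

/-- The factor contributed by a block `B` of the partition of a partitioned permutation: `f_r` if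
`B` is a single cycle with `r` elements, and `g_{r,s}` if `B` is the union of two cycles with `r`
and `s` elements, the cycle with the smaller least element coming first. -/
noncomputable def blockFactor {M : Type*} (f : (n : ℕ) → (Fin n → M) → ℂ)
    (g : (r s : ℕ) → (Fin r → M) → (Fin s → M) → ℂ) (π : Perm ι) (a : ι → M)
    (B : Finset ι) : ℂ :=
  match (cycleMins π ∩ B).sort with
  | [x] => f (cycleLen π x) (cycleEntries π a x)
  | [x, y] => g (cycleLen π x) (cycleLen π y) (cycleEntries π a x) (cycleEntries π a y)
  | _ => 0

/-- The multiplicative extension `(f, g)_{(V, π)}` to a partitioned permutation `(V, π)` all of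
whose blocks contain one or two cycles. -/
noncomputable def partitionedExt {M : Type*} (f : (n : ℕ) → (Fin n → M) → ℂ)
    (g : (r s : ℕ) → (Fin r → M) → (Fin s → M) → ℂ)
    (V : Finpartition (univ : Finset ι)) (π : Perm ι) (a : ι → M) : ℂ :=
  ∏ B ∈ V.parts, blockFactor f g π a B

end Cycles

/-! ### Non-crossing partitions, non-crossing annular permutations, partitioned permutations -/

open Classical in
/-- The non-crossing partitions of `n` points, each regarded as the permutation whose cycles are
the blocks written in increasing order. -/
noncomputable def NC (n : ℕ) : Finset (Perm (Fin n)) :=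
  univ.filter fun π =>
    (∀ x ∈ cycleMins π, StrictMono fun k : Fin (cycleLen π x) => (π ^ (k : ℕ)) x) ∧
    ∀ i j k l : Fin n, i < j → j < k → k < l →
      π.SameCycle i k → π.SameCycle j l → π.SameCycle i j

/-- The permutation `π₁ × π₂` of `m + n` points acting as `π₁` on the first `m` points and as
(the shift of) `π₂` on the last `n` points. -/
def prodPerm {m n : ℕ} (π₁ : Perm (Fin m)) (π₂ : Perm (Fin n)) : Perm (Fin (m + n)) :=
  finSumFinEquiv.permCongr (Perm.sumCongr π₁ π₂)

/-- The permutation `γ_{m,n} = (1, …, m)(m + 1, …, m + n)`. -/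
def gammaPerm (m n : ℕ) : Perm (Fin (m + n)) := prodPerm (finRotate m) (finRotate n)

/-- The point `k` lies on the first circle, i.e. in `{1, …, m}` (numbered from `0` here). -/
def OnFirst (m : ℕ) {n : ℕ} (k : Fin (m + n)) : Prop := (k : ℕ) < m

open Classical in
/-- The non-crossing annular permutations `S_NC(m,n)`: some cycle meets both circles and
`|γ_{m,n}| + 2 = |π| + |π⁻¹ γ_{m,n}|`. -/
noncomputable def SNC (m n : ℕ) : Finset (Perm (Fin (m + n))) :=
  univ.filter fun π =>
    (∃ x y, OnFirst m x ∧ ¬ OnFirst m y ∧ π.SameCycle x y) ∧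
    permLength (gammaPerm m n) + 2 = permLength π + permLength (π⁻¹ * gammaPerm m n)

open Classical in
/-- `PS_NC(m,n)'`: the pairs `(U, π)` with `π = π₁ × π₂ ∈ NC(m) × NC(n)` and `U` obtained from the
cycle partition of `π` by joining a cycle `C` of `π₁` with a cycle `D` of `π₂`. -/
noncomputable def PSNC' (m n : ℕ) :
    Finset (Finpartition (univ : Finset (Fin (m + n))) × Perm (Fin (m + n))) :=
  univ.filter fun P =>
    (∃ π₁ ∈ NC m, ∃ π₂ ∈ NC n, P.2 = prodPerm π₁ π₂) ∧
    ∃ C ∈ (cyclePartition P.2).parts, ∃ D ∈ (cyclePartition P.2).parts,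
      (∀ k ∈ C, OnFirst m k) ∧ (∀ k ∈ D, ¬ OnFirst m k) ∧
      P.1.parts = insert (C ∪ D) ((cyclePartition P.2).parts \ {C, D})

open Classical in
/-- `PS_NC(m,n) = S_NC(m,n) ∪ PS_NC(m,n)'`, where `π ∈ S_NC(m,n)` stands for `(0_π, π)`. -/
noncomputable def PSNC (m n : ℕ) :
    Finset (Finpartition (univ : Finset (Fin (m + n))) × Perm (Fin (m + n))) :=
  (SNC m n).image (fun π => (cyclePartition π, π)) ∪ PSNC' m n

open Classical in
/-- `S_NC^{+,all}(m,n)`: the even non-crossing annular permutations all of whose cycles meet both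
circles and such that `k` and `π k` have the same parity whenever they are on different circles. -/
noncomputable def SNCPlusAll (m n : ℕ) : Finset (Perm (Fin (m + n))) :=
  (SNC m n).filter fun π =>
    IsEvenPerm π ∧
    (∀ k, (∃ x, OnFirst m x ∧ π.SameCycle k x) ∧ ∃ y, ¬ OnFirst m y ∧ π.SameCycle k y) ∧
    ∀ k, ¬ (OnFirst m k ↔ OnFirst m (π k)) → (k : ℕ) % 2 = (π k : ℕ) % 2

/-! ### Second order probability spaces and their free cumulants -/

/-- A second order non-commutative `*`-probability space `(A, φ, φ₂)`. -/
structure ProbabilitySpace (A : Type*) [Ring A] [StarRing A] [Algebra ℂ A] [StarModule ℂ A] where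
  φ : A →ₗ[ℂ] ℂ
  φ₂ : A →ₗ[ℂ] A →ₗ[ℂ] ℂ
  map_one : φ 1 = 1
  tracial : ∀ a b, φ (a * b) = φ (b * a)
  symm₂ : ∀ a b, φ₂ a b = φ₂ b a
  tracial₂ : ∀ a b c, φ₂ (a * b) c = φ₂ (b * a) c
  one₂ : ∀ a, φ₂ 1 a = 0

variable {A : Type*} [Ring A] [StarRing A] [Algebra ℂ A] [StarModule ℂ A]

open Classical in
/-- The free cumulants `κ_n`, obtained by solving the moment-cumulant formula
`φ(a₁ ⋯ a_n) = ∑_{π ∈ NC(n)} κ_π(a₁, …, a_n)` for the term of the partition with one block.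
All other terms involve only `κ_l` with `l < n`; see `moment_cumulant`. -/
noncomputable def cumulant (P : ProbabilitySpace A) (n : ℕ) (a : Fin n → A) : ℂ :=
  P.φ (List.ofFn a).prod -
    ∑ π ∈ (NC n).filter (· ≠ finRotate n),
      permExt (fun l b => if _h : l < n then cumulant P l b else 0) π a
termination_by n

open Classical in
/-- The second order free cumulants `κ_{m,n}`, obtained by solving the second order
moment-cumulant formula
`φ₂(a₁ ⋯ a_m, b₁ ⋯ b_n) = ∑_{π ∈ S_NC(m,n)} κ_π + ∑_{(U,π) ∈ PS_NC(m,n)'} κ_{(U,π)}`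
for the term `(U, π) = (1, γ_{m,n})`. All other terms involve only `κ_l` and `κ_{r,s}` with
`r + s < m + n`; see `moment_cumulant₂`. -/
noncomputable def cumulant₂ (P : ProbabilitySpace A) (m n : ℕ) (a : Fin m → A) (b : Fin n → A) :
    ℂ :=
  P.φ₂ (List.ofFn a).prod (List.ofFn b).prod -
    ∑ π ∈ SNC m n, permExt (cumulant P) π (Fin.append a b) -
    ∑ Q ∈ (PSNC' m n).filter (·.2 ≠ gammaPerm m n),
      partitionedExt (cumulant P)
        (fun r s c d => if _h : r + s < m + n then cumulant₂ P r s c d else 0)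
        Q.1 Q.2 (Fin.append a b)
termination_by m + n

/-! ### Second order even elements and their determining sequences -/

/-- `x` is second order even: `x = x*` and its odd moments vanish. -/
def IsEven (P : ProbabilitySpace A) (x : A) : Prop :=
  star x = x ∧ (∀ p q : ℕ, ¬ (Even p ∧ Even q) → P.φ₂ (x ^ p) (x ^ q) = 0) ∧
    ∀ n : ℕ, P.φ (x ^ (2 * n + 1)) = 0

/-- The first determining sequence `β_n = κ_{2n}(x, …, x)`. -/
noncomputable def beta (P : ProbabilitySpace A) (x : A) (n : ℕ) : ℂ :=
  cumulant P (2 * n) fun _ => x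

/-- The second determining sequence
`β_{p,q} = κ_{2p,2q}(x, …, x) + ∑_{π ∈ S_NC^{+,all}(2p,2q)} κ_π(x, …, x)`. -/
noncomputable def beta₂ (P : ProbabilitySpace A) (x : A) (p q : ℕ) : ℂ :=
  cumulant₂ P (2 * p) (2 * q) (fun _ => x) (fun _ => x) +
    ∑ π ∈ SNCPlusAll (2 * p) (2 * q), permExt (cumulant P) π fun _ => x

/-- `β_{(V,π)}`, the multiplicative extension of the determining sequences of `x`: the product of
`β_r` over the blocks of `V` that are cycles of `π` with `r` elements and of `β_{r,s}` over the
blocks that are the union of two cycles with `r` and `s` elements. -/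
noncomputable def betaExt (P : ProbabilitySpace A) (x : A) {n : ℕ}
    (V : Finpartition (univ : Finset (Fin n))) (π : Perm (Fin n)) : ℂ :=
  partitionedExt (fun r _ => beta P x r) (fun r s _ _ => beta₂ P x r s) V π fun _ => x

/-! ### The recursively defined cumulants satisfy the moment-cumulant formulas -/

theorem mem_cycleMins {ι : Type*} [Fintype ι] [LinearOrder ι] {π : Perm ι} {x : ι} :
    x ∈ cycleMins π ↔ ∀ y, π.SameCycle x y → x ≤ y := by simp [cycleMins]

theorem cycleLen_injOn {ι : Type*} (π : Perm ι) (x : ι) :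
    Function.Injective fun k : Fin (Function.minimalPeriod π x) => (π ^ (k : ℕ)) x := by
  intro k l h
  have := Function.iterate_injOn_Iio_minimalPeriod (f := π) (x := x) k.2 l.2
    (by simpa [Perm.iterate_eq_pow] using h)
  exact Fin.ext this

theorem cycleLen_le {n : ℕ} (π : Perm (Fin n)) (x : Fin n) : cycleLen π x ≤ n := by
  simpa [cycleLen] using Fintype.card_le_of_injective _ (cycleLen_injOn π x)

theorem cycleLen_add_le {n : ℕ} {π : Perm (Fin n)} {x y : Fin n} (h : ¬ π.SameCycle x y) :
    cycleLen π x + cycleLen π y ≤ n := by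
  have := Fintype.card_le_of_injective
    (Sum.elim (fun k : Fin (Function.minimalPeriod π x) => (π ^ (k : ℕ)) x)
      (fun k : Fin (Function.minimalPeriod π y) => (π ^ (k : ℕ)) y))
    ((cycleLen_injOn π x).sumElim (cycleLen_injOn π y) (by
      intro k l e
      exact h ((Perm.sameCycle_pow_left (n := k)).1
        ((Perm.sameCycle_pow_right (n := l)).1 (e ▸ Perm.SameCycle.refl _ _)))))
  simpa [cycleLen] using this

theorem finRotate_pow_zero {n : ℕ} (k : ℕ) (hk : k < n + 1) :
    ((finRotate (n + 1)) ^ k) 0 = ⟨k, hk⟩ := by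
  induction k with
  | zero => rfl
  | succ k ih =>
    rw [pow_succ', Perm.mul_apply, ih (by omega)]
    exact finRotate_of_lt (by omega)

theorem cycleLen_finRotate (n : ℕ) : cycleLen (finRotate (n + 1)) 0 = n + 1 := by
  refine le_antisymm (cycleLen_le _ _) ?_
  by_contra hlt
  push Not at hlt
  have h := Function.isPeriodicPt_minimalPeriod (finRotate (n + 1)) 0
  have hpos : 0 < Function.minimalPeriod (finRotate (n + 1)) 0 :=
    Function.minimalPeriod_pos_of_mem_periodicPts
      ((finRotate (n+1)).injective.mem_periodicPts 0)
  unfold cycleLen at hlt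
  rw [Function.IsPeriodicPt, Function.IsFixedPt, Perm.iterate_eq_pow,
    finRotate_pow_zero _ hlt, Fin.ext_iff] at h
  simp at h
  omega

theorem sameCycle_finRotate {n : ℕ} (x : Fin (n + 1)) : (finRotate (n + 1)).SameCycle 0 x :=
  ⟨(x : ℕ), by rw [zpow_natCast]; exact finRotate_pow_zero _ x.2⟩

theorem cycleMins_finRotate (n : ℕ) : cycleMins (finRotate (n + 1)) = {0} := by
  ext x
  rw [mem_cycleMins, mem_singleton]
  constructor
  · intro h
    exact le_antisymm (h 0 (sameCycle_finRotate x).symm) (Fin.zero_le _)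
  · rintro rfl y _
    exact Fin.zero_le _

theorem eq_finRotate_of_full {n : ℕ} {π : Perm (Fin n)} (hπ : π ∈ NC n) {x : Fin n}
    (hx : x ∈ cycleMins π) (hl : cycleLen π x = n) : π = finRotate n := by
  simp only [NC, mem_filter, mem_univ, true_and] at hπ
  have hm := hπ.1 x hx
  have key : ∀ k (hk : k < n), (π ^ k) x = ⟨k, hk⟩ := by
    intro k hk
    have hm' : StrictMono fun k : Fin n => (π ^ (k : ℕ)) x := fun i j hij =>
      hm (a := ⟨i, by omega⟩) (b := ⟨j, by omega⟩) hij
    have h1 := hm'.le_apply (x := ⟨k, hk⟩)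
    have hid : (fun k : Fin n => (π ^ (k : ℕ)) x) = id := by
      have := Subsingleton.elim
        (hm'.orderIsoOfSurjective _ (Finite.surjective_of_injective hm'.injective))
        (OrderIso.refl (Fin n))
      funext k
      exact congrArg (fun e : Fin n ≃o Fin n => e k) this
    exact congrFun hid ⟨k, hk⟩
  obtain _ | n := n
  · exact Subsingleton.elim _ _
  have hper : (π ^ (n + 1)) x = x := by
    have := Function.isPeriodicPt_minimalPeriod π x
    rw [Function.IsPeriodicPt, Function.IsFixedPt, Perm.iterate_eq_pow] at this
    unfold cycleLen at hl
    rwa [hl] at this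
  ext k : 1
  have hk := key k k.2
  rw [Fin.eta] at hk
  conv_lhs => rw [← hk]
  rw [← Perm.mul_apply, ← pow_succ']
  by_cases h : (k : ℕ) < n
  · rw [key _ (by omega)]
    exact (finRotate_of_lt h).symm
  · have hkn : (k : ℕ) = n := by omega
    have h0 : x = 0 := by simpa using key 0 (by omega)
    have hlast : k = Fin.last n := Fin.ext hkn
    rw [hlast, finRotate_last, Fin.val_last, hper, h0]

theorem finRotate_mem_NC (n : ℕ) : finRotate (n + 1) ∈ NC (n + 1) := by
  simp only [NC, mem_filter, mem_univ, true_and]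
  refine ⟨?_, fun i j _ _ _ _ _ _ _ => (sameCycle_finRotate i).symm.trans (sameCycle_finRotate j)⟩
  intro x hx i j hij
  rw [cycleMins_finRotate, mem_singleton] at hx
  subst hx
  have hi : (i : ℕ) < n + 1 := i.2.trans_eq (cycleLen_finRotate n)
  have hj : (j : ℕ) < n + 1 := j.2.trans_eq (cycleLen_finRotate n)
  simp only [finRotate_pow_zero _ hi, finRotate_pow_zero _ hj]
  exact hij

theorem apply_entries {M : Type*} (f : (n : ℕ) → (Fin n → M) → ℂ) {l n : ℕ} (h : l = n)
    (b : Fin l → M) (a : Fin n → M) (hab : ∀ k (hk : k < l), b ⟨k, hk⟩ = a ⟨k, h ▸ hk⟩) :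
    f l b = f n a := by
  subst h
  congr 1
  funext k
  exact hab k k.2

/-- The moment-cumulant formula. -/
theorem moment_cumulant (P : ProbabilitySpace A) (n : ℕ) (hn : 1 ≤ n) (a : Fin n → A) :
    P.φ (List.ofFn a).prod = ∑ π ∈ NC n, permExt (cumulant P) π a := by
  classical
  obtain ⟨n, rfl⟩ := Nat.exists_eq_add_of_le' hn
  rw [← sum_filter_add_sum_filter_not (NC (n + 1)) (· ≠ finRotate (n + 1))]
  have h1 : (NC (n + 1)).filter (fun π => ¬ π ≠ finRotate (n + 1)) = {finRotate (n + 1)} := by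
    ext π
    simp only [ne_eq, not_not, mem_filter, mem_singleton, and_iff_right_iff_imp]
    rintro rfl
    exact finRotate_mem_NC n
  have h2 : permExt (cumulant P) (finRotate (n + 1)) a = cumulant P (n + 1) a := by
    rw [permExt, cycleMins_finRotate, prod_singleton]
    refine apply_entries _ (cycleLen_finRotate n) _ _ fun k hk => ?_
    rw [cycleLen_finRotate] at hk
    simp only [cycleEntries, finRotate_pow_zero k hk]
  rw [h1, sum_singleton, h2, cumulant]
  have h3 : ∀ π ∈ (NC (n + 1)).filter (· ≠ finRotate (n + 1)),
      permExt (fun l b => if _h : l < n + 1 then cumulant P l b else 0) π a =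
        permExt (cumulant P) π a := by
    intro π hπ
    rw [mem_filter] at hπ
    refine prod_congr rfl fun x hx => ?_
    exact dif_pos <| lt_of_le_of_ne (cycleLen_le _ _) fun h => hπ.2 (eq_finRotate_of_full hπ.1 hx h)
  rw [sum_congr rfl h3]
  ring

section Prod
variable {m n : ℕ} (π₁ : Perm (Fin m)) (π₂ : Perm (Fin n))

theorem prodPerm_pow_castAdd (k : ℕ) (i : Fin m) :
    (prodPerm π₁ π₂ ^ k) (Fin.castAdd n i) = Fin.castAdd n ((π₁ ^ k) i) := by
  induction k with
  | zero => rfl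
  | succ k ih => rw [pow_succ', Perm.mul_apply, ih, pow_succ', Perm.mul_apply]; simp [prodPerm]

theorem prodPerm_pow_natAdd (k : ℕ) (i : Fin n) :
    (prodPerm π₁ π₂ ^ k) (Fin.natAdd m i) = Fin.natAdd m ((π₂ ^ k) i) := by
  induction k with
  | zero => rfl
  | succ k ih => rw [pow_succ', Perm.mul_apply, ih, pow_succ', Perm.mul_apply]; simp [prodPerm]

theorem cycleLen_castAdd (i : Fin m) :
    cycleLen (prodPerm π₁ π₂) (Fin.castAdd n i) = cycleLen π₁ i := by
  refine Function.minimalPeriod_eq_minimalPeriod_iff.2 fun k => ?_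
  rw [Function.IsPeriodicPt, Function.IsFixedPt, Function.IsPeriodicPt, Function.IsFixedPt,
    Perm.iterate_eq_pow, Perm.iterate_eq_pow, prodPerm_pow_castAdd, Fin.castAdd_inj]

theorem cycleLen_natAdd (i : Fin n) :
    cycleLen (prodPerm π₁ π₂) (Fin.natAdd m i) = cycleLen π₂ i := by
  refine Function.minimalPeriod_eq_minimalPeriod_iff.2 fun k => ?_
  rw [Function.IsPeriodicPt, Function.IsFixedPt, Function.IsPeriodicPt, Function.IsFixedPt,
    Perm.iterate_eq_pow, Perm.iterate_eq_pow, prodPerm_pow_natAdd, Fin.natAdd_inj]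

theorem sameCycle_castAdd {i : Fin m} {y : Fin (m + n)} :
    (prodPerm π₁ π₂).SameCycle (Fin.castAdd n i) y ↔
      ∃ j, π₁.SameCycle i j ∧ y = Fin.castAdd n j := by
  constructor
  · intro h
    obtain ⟨k, hk⟩ := h.exists_nat_pow_eq
    rw [prodPerm_pow_castAdd] at hk
    exact ⟨_, ⟨k, rfl⟩, hk.symm⟩
  · rintro ⟨j, h, rfl⟩
    obtain ⟨k, rfl⟩ := h.exists_nat_pow_eq
    exact ⟨k, by rw [zpow_natCast, prodPerm_pow_castAdd]⟩

theorem sameCycle_natAdd {i : Fin n} {y : Fin (m + n)} :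
    (prodPerm π₁ π₂).SameCycle (Fin.natAdd m i) y ↔
      ∃ j, π₂.SameCycle i j ∧ y = Fin.natAdd m j := by
  constructor
  · intro h
    obtain ⟨k, hk⟩ := h.exists_nat_pow_eq
    rw [prodPerm_pow_natAdd] at hk
    exact ⟨_, ⟨k, rfl⟩, hk.symm⟩
  · rintro ⟨j, h, rfl⟩
    obtain ⟨k, rfl⟩ := h.exists_nat_pow_eq
    exact ⟨k, by rw [zpow_natCast, prodPerm_pow_natAdd]⟩

theorem castAdd_mem_cycleMins {i : Fin m} :
    Fin.castAdd n i ∈ cycleMins (prodPerm π₁ π₂) ↔ i ∈ cycleMins π₁ := by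
  simp only [mem_cycleMins, sameCycle_castAdd]
  constructor
  · intro h j hj
    exact h _ ⟨j, hj, rfl⟩
  · rintro h _ ⟨j, hj, rfl⟩
    exact h j hj

theorem natAdd_mem_cycleMins {i : Fin n} :
    Fin.natAdd m i ∈ cycleMins (prodPerm π₁ π₂) ↔ i ∈ cycleMins π₂ := by
  simp only [mem_cycleMins, sameCycle_natAdd]
  constructor
  · intro h j hj
    simpa using h _ ⟨j, hj, rfl⟩
  · rintro h _ ⟨j, hj, rfl⟩
    simpa using h j hj

end Prod

theorem cycleLen_add_lt {m n : ℕ} (hm : 1 ≤ m) (hn : 1 ≤ n) {π₁ : Perm (Fin m)}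
    {π₂ : Perm (Fin n)} (h₁ : π₁ ∈ NC m) (h₂ : π₂ ∈ NC n)
    (hne : prodPerm π₁ π₂ ≠ gammaPerm m n) {x y : Fin (m + n)}
    (hx : x ∈ cycleMins (prodPerm π₁ π₂)) (hy : y ∈ cycleMins (prodPerm π₁ π₂)) (hxy : x ≠ y) :
    cycleLen (prodPerm π₁ π₂) x + cycleLen (prodPerm π₁ π₂) y < m + n := by
  have hsc : ¬ (prodPerm π₁ π₂).SameCycle x y := fun h =>
    hxy (le_antisymm (mem_cycleMins.1 hx _ h) (mem_cycleMins.1 hy _ h.symm))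
  have key : ∀ (i : Fin m) (j : Fin n), i ∈ cycleMins π₁ → j ∈ cycleMins π₂ →
      cycleLen π₁ i + cycleLen π₂ j < m + n := by
    intro i j hi hj
    by_contra hlt
    have := cycleLen_le π₁ i
    have := cycleLen_le π₂ j
    apply hne
    rw [eq_finRotate_of_full h₁ hi (by omega), eq_finRotate_of_full h₂ hj (by omega)]
    rfl
  induction x using Fin.addCases with
  | left i =>
    induction y using Fin.addCases with
    | left j =>
      rw [sameCycle_castAdd] at hsc
      rw [cycleLen_castAdd, cycleLen_castAdd]
      have := cycleLen_add_le (π := π₁) (x := i) (y := j) fun h => hsc ⟨j, h, rfl⟩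
      omega
    | right j =>
      rw [castAdd_mem_cycleMins] at hx
      rw [natAdd_mem_cycleMins] at hy
      rw [cycleLen_castAdd, cycleLen_natAdd]
      exact key i j hx hy
  | right i =>
    induction y using Fin.addCases with
    | left j =>
      rw [natAdd_mem_cycleMins] at hx
      rw [castAdd_mem_cycleMins] at hy
      rw [cycleLen_castAdd, cycleLen_natAdd, add_comm]
      exact key j i hy hx
    | right j =>
      rw [sameCycle_natAdd] at hsc
      rw [cycleLen_natAdd, cycleLen_natAdd]
      have := cycleLen_add_le (π := π₂) (x := i) (y := j) fun h => hsc ⟨j, h, rfl⟩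
      omega

theorem cycleMins_gamma (m n : ℕ) :
    cycleMins (gammaPerm (m + 1) (n + 1)) = {Fin.castAdd (n + 1) 0, Fin.natAdd (m + 1) 0} := by
  ext x
  rw [gammaPerm, mem_insert, mem_singleton]
  induction x using Fin.addCases with
  | left i =>
    rw [castAdd_mem_cycleMins, cycleMins_finRotate, mem_singleton]
    constructor
    · rintro rfl; exact Or.inl rfl
    · rintro (h | h)
      · exact (Fin.castAdd_inj).1 h
      · have := congrArg Fin.val h
        simp at this
        omega
  | right i =>
    rw [natAdd_mem_cycleMins, cycleMins_finRotate, mem_singleton]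
    constructor
    · rintro rfl; exact Or.inr rfl
    · rintro (h | h)
      · have := congrArg Fin.val h
        simp at this
      · exact (Fin.natAdd_inj _).1 h

theorem cyclePartition_part {ι : Type*} [Fintype ι] [LinearOrder ι] (π : Perm ι)
    {C : Finset ι} (hC : C ∈ (cyclePartition π).parts) {x y : ι} (hx : x ∈ C) :
    y ∈ C ↔ π.SameCycle x y := by
  classical
  have h1 := Finpartition.mem_part_ofSetoid_iff_rel (s := Perm.SameCycle.setoid π) (a := x) (b := y)
  rw [← Finpartition.part_eq_of_mem (cyclePartition π) hC hx]
  exact h1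

/-- If `π = γ_{m,n}` then the only partition obtained by joining cycles is that with one block. -/
theorem PSNC'_gamma (m n : ℕ) :
    ∃ V : Finpartition (univ : Finset (Fin (m + 1 + (n + 1)))), V.parts = {univ} ∧
      ∀ Q, (Q ∈ PSNC' (m + 1) (n + 1) ∧ Q.2 = gammaPerm (m + 1) (n + 1)) ↔
        Q = (V, gammaPerm (m + 1) (n + 1)) := by
  classical
  have hu : ∀ C ∈ (cyclePartition (gammaPerm (m + 1) (n + 1))).parts,
      (∀ k ∈ C, OnFirst (m + 1) k) → ∀ i, i ∈ C ↔ OnFirst (m + 1) i := by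
    intro C hC h i
    refine ⟨h i, fun hi => ?_⟩
    obtain ⟨x, hx⟩ := (cyclePartition _).nonempty_of_mem_parts hC
    rw [cyclePartition_part _ hC hx]
    have hx' := h x hx
    induction x using Fin.addCases with
    | left x =>
      induction i using Fin.addCases with
      | left i =>
        exact (sameCycle_castAdd _ _).2
          ⟨i, (sameCycle_finRotate x).symm.trans (sameCycle_finRotate i), rfl⟩
      | right i => simp [OnFirst] at hi; omega
    | right x => simp [OnFirst] at hx'; omega
  have hv : ∀ C ∈ (cyclePartition (gammaPerm (m + 1) (n + 1))).parts,
      (∀ k ∈ C, ¬ OnFirst (m + 1) k) → ∀ i, i ∈ C ↔ ¬ OnFirst (m + 1) i := by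
    intro C hC h i
    refine ⟨h i, fun hi => ?_⟩
    obtain ⟨x, hx⟩ := (cyclePartition _).nonempty_of_mem_parts hC
    rw [cyclePartition_part _ hC hx]
    have hx' := h x hx
    induction x using Fin.addCases with
    | left x => simp [OnFirst] at hx'; omega
    | right x =>
      induction i using Fin.addCases with
      | left i => simp [OnFirst] at hi; omega
      | right i =>
        exact (sameCycle_natAdd _ _).2
          ⟨i, (sameCycle_finRotate x).symm.trans (sameCycle_finRotate i), rfl⟩
  have hpart : ∀ V : Finpartition (univ : Finset (Fin (m + 1 + (n + 1)))),
      univ ∈ V.parts → V.parts = {univ} := by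
    intro V hV
    ext B
    rw [mem_singleton]
    refine ⟨fun hB => ?_, fun hB => hB ▸ hV⟩
    obtain ⟨x, hx⟩ := V.nonempty_of_mem_parts hB
    exact V.eq_of_mem_parts hB hV hx (mem_univ x)
  let V : Finpartition (univ : Finset (Fin (m + 1 + (n + 1)))) :=
    Finpartition.indiscrete (by simpa using (univ_nonempty (α := Fin (m + 1 + (n + 1)))).ne_empty)
  have hVp : V.parts = {univ} := rfl
  refine ⟨V, hVp, ?_⟩
  rintro ⟨U, π⟩
  constructor
  · rintro ⟨hQ, rfl : π = _⟩
    simp only [PSNC', mem_filter, mem_univ, true_and] at hQ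
    obtain ⟨-, C, hC, D, hD, hC1, hD1, hU⟩ := hQ
    have : C ∪ D = univ := by
      ext i
      rw [mem_union, hu C hC hC1, hv D hD hD1]
      simp only [mem_univ, iff_true]
      exact em _
    have hUV : U = V := Finpartition.ext (by
      rw [hVp, hpart U (by rw [hU, this]; exact mem_insert_self _ _)])
    rw [hUV]
  · intro h
    obtain ⟨rfl, rfl⟩ := Prod.mk.inj h
    refine ⟨?_, rfl⟩
    simp only [PSNC', mem_filter, mem_univ, true_and]
    refine ⟨⟨_, finRotate_mem_NC m, _, finRotate_mem_NC n, rfl⟩, ?_⟩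
    let W := cyclePartition (gammaPerm (m + 1) (n + 1))
    have hCm := W.part_mem.2 (mem_univ (Fin.castAdd (n + 1) (0 : Fin (m + 1))))
    have hDm := W.part_mem.2 (mem_univ (Fin.natAdd (m + 1) (0 : Fin (n + 1))))
    have hC0 := W.mem_part (mem_univ (Fin.castAdd (n + 1) (0 : Fin (m + 1))))
    have hD0 := W.mem_part (mem_univ (Fin.natAdd (m + 1) (0 : Fin (n + 1))))
    have hC1 : ∀ k ∈ W.part (Fin.castAdd (n + 1) (0 : Fin (m + 1))), OnFirst (m + 1) k := by
      intro k hk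
      obtain ⟨j, -, rfl⟩ := (sameCycle_castAdd _ _).1 ((cyclePartition_part _ hCm hC0).1 hk)
      simp [OnFirst]; omega
    have hD1 : ∀ k ∈ W.part (Fin.natAdd (m + 1) (0 : Fin (n + 1))), ¬ OnFirst (m + 1) k := by
      intro k hk
      obtain ⟨j, -, rfl⟩ := (sameCycle_natAdd _ _).1 ((cyclePartition_part _ hDm hD0).1 hk)
      simp [OnFirst]; omega
    refine ⟨_, hCm, _, hDm, hC1, hD1, ?_⟩
    have hun : W.part (Fin.castAdd (n + 1) (0 : Fin (m + 1))) ∪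
        W.part (Fin.natAdd (m + 1) (0 : Fin (n + 1))) = univ := by
      ext i
      rw [mem_union, hu _ hCm hC1, hv _ hDm hD1]
      simp only [mem_univ, iff_true]
      exact em _
    rw [hVp, hun]
    have : W.parts \ {W.part (Fin.castAdd (n + 1) (0 : Fin (m + 1))),
        W.part (Fin.natAdd (m + 1) (0 : Fin (n + 1)))} = ∅ := by
      rw [sdiff_eq_empty_iff_subset]
      intro B hB
      obtain ⟨x, hx⟩ := W.nonempty_of_mem_parts hB
      rw [mem_insert, mem_singleton]
      have hx2 : x ∈ W.part (Fin.castAdd (n + 1) (0 : Fin (m + 1))) ∪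
        W.part (Fin.natAdd (m + 1) (0 : Fin (n + 1))) := by rw [hun]; exact mem_univ x
      rcases mem_union.1 hx2 with h | h
      · exact Or.inl (W.eq_of_mem_parts hB hCm hx h)
      · exact Or.inr (W.eq_of_mem_parts hB hDm hx h)
    change _ = insert _ (W.parts \ _)
    rw [this]
    rfl

/-- The second order moment-cumulant formula. -/
theorem moment_cumulant₂ (P : ProbabilitySpace A) (m n : ℕ) (hm : 1 ≤ m) (hn : 1 ≤ n)
    (a : Fin m → A) (b : Fin n → A) :
    P.φ₂ (List.ofFn a).prod (List.ofFn b).prod =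
      ∑ π ∈ SNC m n, permExt (cumulant P) π (Fin.append a b) +
        ∑ Q ∈ PSNC' m n,
          partitionedExt (cumulant P) (cumulant₂ P) Q.1 Q.2 (Fin.append a b) := by
  classical
  obtain ⟨m, rfl⟩ := Nat.exists_eq_add_of_le' hm
  obtain ⟨n, rfl⟩ := Nat.exists_eq_add_of_le' hn
  obtain ⟨V, hV, hVQ⟩ := PSNC'_gamma m n
  rw [← sum_filter_add_sum_filter_not (PSNC' (m + 1) (n + 1)) (·.2 ≠ gammaPerm (m + 1) (n + 1))]
  have h1 : (PSNC' (m + 1) (n + 1)).filter (fun Q => ¬ Q.2 ≠ gammaPerm (m + 1) (n + 1)) =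
      {(V, gammaPerm (m + 1) (n + 1))} := by
    ext Q
    simp only [ne_eq, not_not, mem_filter, mem_singleton, hVQ]
  have h2 : partitionedExt (cumulant P) (cumulant₂ P) V (gammaPerm (m + 1) (n + 1))
      (Fin.append a b) = cumulant₂ P (m + 1) (n + 1) a b := by
    have hs : (cycleMins (gammaPerm (m + 1) (n + 1)) ∩ univ).sort =
        [Fin.castAdd (n + 1) 0, Fin.natAdd (m + 1) 0] := by
      rw [inter_univ, cycleMins_gamma, sort_insert, sort_singleton]
      · intro y hy
        rw [mem_singleton] at hy
        subst hy
        exact Fin.zero_le _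
      · rw [mem_singleton]
        intro h
        have := congrArg Fin.val h
        simp at this
    rw [partitionedExt, hV, prod_singleton, blockFactor, hs]
    have e1 := cycleLen_castAdd (finRotate (m + 1)) (finRotate (n + 1)) 0
    have e2 := cycleLen_natAdd (finRotate (m + 1)) (finRotate (n + 1)) 0
    rw [cycleLen_finRotate] at e1 e2
    refine (apply_entries (fun r c => cumulant₂ P r _ c _) e1 _ a ?_).trans
      (apply_entries (fun s d => cumulant₂ P _ s a d) e2 _ b ?_)
    · intro k hk
      have hk := hk.trans_eq e1
      simp only [cycleEntries]
      rw [gammaPerm, prodPerm_pow_castAdd, Fin.append_left, finRotate_pow_zero k hk]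
    · intro k hk
      have hk := hk.trans_eq e2
      simp only [cycleEntries]
      rw [gammaPerm, prodPerm_pow_natAdd, Fin.append_right, finRotate_pow_zero k hk]
  rw [h1, sum_singleton, h2, cumulant₂]
  have h3 : ∀ Q ∈ (PSNC' (m + 1) (n + 1)).filter (·.2 ≠ gammaPerm (m + 1) (n + 1)),
      partitionedExt (cumulant P)
        (fun r s c d => if _h : r + s < m + 1 + (n + 1) then cumulant₂ P r s c d else 0)
        Q.1 Q.2 (Fin.append a b) =
      partitionedExt (cumulant P) (cumulant₂ P) Q.1 Q.2 (Fin.append a b) := by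
    rintro ⟨U, π⟩ hQ
    rw [mem_filter] at hQ
    obtain ⟨hQ, hne⟩ := hQ
    simp only [PSNC', mem_filter, mem_univ, true_and] at hQ
    obtain ⟨⟨π₁, h₁, π₂, h₂, rfl⟩, -⟩ := hQ
    refine prod_congr rfl fun B _ => ?_
    have hnd := sort_nodup (cycleMins (prodPerm π₁ π₂) ∩ B) (· ≤ ·)
    have hmem : ∀ z, z ∈ (cycleMins (prodPerm π₁ π₂) ∩ B).sort ↔ _ := fun z => mem_sort (· ≤ ·)
    simp only [blockFactor]
    generalize (cycleMins (prodPerm π₁ π₂) ∩ B).sort = L at hnd hmem ⊢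
    match L, hnd, hmem with
    | [], _, _ => rfl
    | [_], _, _ => rfl
    | [x, y], hnd, hmem =>
      dsimp only
      rw [dif_pos]
      refine cycleLen_add_lt hm hn h₁ h₂ hne
        (mem_inter.1 ((hmem x).1 (by simp))).1 (mem_inter.1 ((hmem y).1 (by simp))).1 ?_
      rintro rfl
      simp at hnd
    | _ :: _ :: _ :: _, _, _ => rfl
  rw [sum_congr rfl h3]
  ring

end SecondOrder

namespace SecondOrder

open Finset Equiv

set_option linter.unusedSectionVars false

attribute [local simp] Perm.SameCycle.refl

section CycleMins
variable {ι ι' : Type*} [Fintype ι] [LinearOrder ι] [Fintype ι'] [LinearOrder ι']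

theorem exists_cycleMin (π : Perm ι) (x : ι) : ∃ y ∈ cycleMins π, π.SameCycle x y := by
  classical
  have hne : (univ.filter fun y => π.SameCycle x y).Nonempty := ⟨x, by simp⟩
  have h := min'_mem _ hne
  refine ⟨_, mem_cycleMins.2 fun z hz => min'_le _ _ ?_, (mem_filter.1 h).2⟩
  exact mem_filter.2 ⟨mem_univ _, (mem_filter.1 h).2.trans hz⟩

theorem eq_of_mem_cycleMins {π : Perm ι} {x y : ι} (hx : x ∈ cycleMins π)
    (hy : y ∈ cycleMins π) (h : π.SameCycle x y) : x = y :=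
  le_antisymm (mem_cycleMins.1 hx _ h) (mem_cycleMins.1 hy _ h.symm)

@[to_additive]
theorem prod_cycleMins_congr {M : Type*} [CommMonoid M] {π : Perm ι} {π' : Perm ι'} (e : ι → ι')
    (he : Function.Surjective e) (h : ∀ x y, π.SameCycle x y ↔ π'.SameCycle (e x) (e y))
    {f : ι → M} {f' : ι' → M} (hf : ∀ x y, π'.SameCycle (e x) y → f x = f' y) :
    ∏ x ∈ cycleMins π, f x = ∏ x ∈ cycleMins π', f' x := by
  choose m hm hm' using exists_cycleMin π'
  refine prod_bij (fun x _ => m (e x)) (fun x _ => hm _) ?_ ?_ fun x _ => hf _ _ (hm' _)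
  · intro x hx y hy hxy
    refine eq_of_mem_cycleMins hx hy ((h x y).2 ((hm' (e x)).trans ?_))
    rw [hxy]
    exact (hm' (e y)).symm
  · intro b hb
    obtain ⟨x, rfl⟩ := he b
    obtain ⟨y, hy, hxy⟩ := exists_cycleMin π x
    exact ⟨y, hy, eq_of_mem_cycleMins (hm _) hb ((hm' _).symm.trans ((h _ _).1 hxy.symm))⟩

theorem numCycles_congr {π : Perm ι} {π' : Perm ι'} (e : ι → ι')
    (he : Function.Surjective e) (h : ∀ x y, π.SameCycle x y ↔ π'.SameCycle (e x) (e y)) :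
    numCycles π = numCycles π' := by
  have := sum_cycleMins_congr e he h (f := fun _ => (1 : ℕ)) (f' := fun _ => 1) fun _ _ _ => rfl
  simpa [numCycles] using this

open Classical in
/-- The set of points of the cycle of `π` through `x`. -/
noncomputable def cycleSet (π : Perm ι) (x : ι) : Finset ι := univ.filter fun y => π.SameCycle x y

theorem mem_cycleSet {π : Perm ι} {x y : ι} : y ∈ cycleSet π x ↔ π.SameCycle x y := by
  simp [cycleSet]

theorem cycleSet_eq_of_sameCycle {π : Perm ι} {x y : ι} (h : π.SameCycle x y) :
    cycleSet π x = cycleSet π y := by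
  ext z
  simp only [mem_cycleSet]
  exact ⟨fun h' => h.symm.trans h', fun h' => h.trans h'⟩

theorem exists_pow_lt_cycleLen {π : Perm ι} {x y : ι} (h : π.SameCycle x y) :
    ∃ k < cycleLen π x, (π ^ k) x = y := by
  obtain ⟨k, rfl⟩ := h.exists_nat_pow_eq
  refine ⟨k % cycleLen π x, Nat.mod_lt _ (Function.minimalPeriod_pos_of_mem_periodicPts
    (π.injective.mem_periodicPts x)), ?_⟩
  rw [← Perm.iterate_eq_pow, ← Perm.iterate_eq_pow]
  exact Function.iterate_mod_minimalPeriod_eq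

theorem pow_cycleLen (π : Perm ι) (x : ι) : (π ^ cycleLen π x) x = x := by
  have := Function.isPeriodicPt_minimalPeriod π x
  rwa [Function.IsPeriodicPt, Function.IsFixedPt, Perm.iterate_eq_pow] at this

theorem card_cycleSet (π : Perm ι) (x : ι) : #(cycleSet π x) = cycleLen π x := by
  classical
  have : cycleSet π x = univ.image fun k : Fin (cycleLen π x) => (π ^ (k : ℕ)) x := by
    ext y
    simp only [mem_cycleSet, mem_image, mem_univ, true_and]
    constructor
    · intro h
      obtain ⟨k, hk, h⟩ := exists_pow_lt_cycleLen h
      exact ⟨⟨k, hk⟩, h⟩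
    · rintro ⟨k, rfl⟩
      exact ⟨k, by simp⟩
  have hinj : Function.Injective fun k : Fin (cycleLen π x) => (π ^ (k : ℕ)) x :=
    cycleLen_injOn π x
  rw [this, card_image_of_injective _ hinj, card_univ, Fintype.card_fin]

theorem cycleLen_pos (π : Perm ι) (x : ι) : 0 < cycleLen π x := by
  rw [← card_cycleSet]
  exact card_pos.2 ⟨x, mem_cycleSet.2 (Perm.SameCycle.refl _ _)⟩

theorem cycleLen_eq_of_sameCycle {π : Perm ι} {x y : ι} (h : π.SameCycle x y) :
    cycleLen π x = cycleLen π y := by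
  rw [← card_cycleSet, ← card_cycleSet, cycleSet_eq_of_sameCycle h]

theorem cycleLen_congr {π : Perm ι} {π' : Perm ι'} (e : ι ≃ ι')
    (h : ∀ x y, π.SameCycle x y ↔ π'.SameCycle (e x) (e y)) (x : ι) :
    cycleLen π x = cycleLen π' (e x) := by
  rw [← card_cycleSet, ← card_cycleSet]
  refine card_bij (fun y _ => e y) (fun y hy => ?_) (fun y _ z _ => e.injective.eq_iff.1) ?_
  · exact mem_cycleSet.2 ((h _ _).1 (mem_cycleSet.1 hy))
  · intro z hz
    obtain ⟨y, rfl⟩ := e.surjective z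
    exact ⟨y, mem_cycleSet.2 ((h _ _).2 (mem_cycleSet.1 hz)), rfl⟩

theorem numCycles_le (π : Perm ι) : numCycles π ≤ Fintype.card ι := card_le_univ _

theorem numCycles_conj (ρ π : Perm ι) : numCycles (ρ * π * ρ⁻¹) = numCycles π :=
  (numCycles_congr ρ ρ.surjective fun x y => by simp [Perm.sameCycle_conj]).symm

/-- Multiplying by a transposition that involves a fixed point `l` inserts `l` into a cycle. -/
theorem sameCycle_swap_mul {σ : Perm ι} {l b : ι} (hl : σ l = l) (hb : b ≠ l) (x y : ι) :
    (swap b l * σ).SameCycle x y ↔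
      σ.SameCycle (if x = l then b else x) (if y = l then b else y) := by
  set r : ι → ι := fun x => if x = l then b else x with hr
  set τ := swap b l * σ with hτ
  have h1 : ∀ x, σ.SameCycle (r x) (r (τ x)) := by
    intro x
    by_cases hx : x = l
    · have : τ x = b := by simp [hτ, hx, hl]
      rw [this]
      simp [hr, hx]
    · have hσx : σ x ≠ l := fun h => hx (σ.injective (h.trans hl.symm))
      have hrx : r x = x := if_neg hx
      have : r (τ x) = σ x := by
        by_cases hxb : σ x = b
        · simp [hτ, hr, hxb]
        · rw [hτ, Perm.mul_apply, swap_apply_of_ne_of_ne hxb hσx]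
          simp [hr, hσx]
      rw [this, hrx]
      exact (Perm.sameCycle_apply_right).2 (Perm.SameCycle.refl _ _)
  have h2 : ∀ x, τ.SameCycle x (r x) := by
    intro x
    by_cases hx : x = l
    · have : τ x = b := by simp [hτ, hx, hl]
      have hrx : r x = τ x := by rw [this]; simp [hr, hx]
      rw [hrx]
      exact (Perm.sameCycle_apply_right).2 (Perm.SameCycle.refl _ _)
    · have hrx : r x = x := if_neg hx
      rw [hrx]
  have h3 : ∀ x, x ≠ l → τ.SameCycle x (σ x) := by
    intro x hx
    have hσx : σ x ≠ l := fun h => hx (σ.injective (h.trans hl.symm))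
    by_cases hxb : σ x = b
    · have e : τ x = l := by simp [hτ, hxb]
      have e2 : τ (τ x) = σ x := by rw [e]; simp [hτ, hl, hxb]
      rw [← e2]
      simp
    · have e : τ x = σ x := by
        rw [hτ, Perm.mul_apply, swap_apply_of_ne_of_ne hxb hσx]
      rw [← e]
      simp
  have h4 : ∀ x, r x ≠ l := by
    intro x
    by_cases hx : x = l
    · simpa [hr, hx] using hb
    · simp [hr, hx]
  constructor
  · intro h
    obtain ⟨k, rfl⟩ := h.exists_nat_pow_eq
    clear h
    induction k with
    | zero => exact Perm.SameCycle.refl _ _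
    | succ k ih => rw [pow_succ', Perm.mul_apply]; exact ih.trans (h1 _)
  · intro h
    refine (h2 x).trans (Perm.SameCycle.trans ?_ (h2 y).symm)
    change σ.SameCycle (r x) (r y) at h
    obtain ⟨k, hk⟩ := h.exists_nat_pow_eq
    rw [← hk]
    clear hk h
    have : ∀ k : ℕ, (σ ^ k) (r x) ≠ l ∧ τ.SameCycle (r x) ((σ ^ k) (r x)) := by
      intro k
      induction k with
      | zero => exact ⟨h4 x, Perm.SameCycle.refl _ _⟩
      | succ k ih =>
        rw [pow_succ', Perm.mul_apply]
        exact ⟨fun h => ih.1 (σ.injective (h.trans hl.symm)), ih.2.trans (h3 _ ih.1)⟩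
    exact (this k).2

theorem numCycles_swap_mul {σ : Perm ι} {l b : ι} (hl : σ l = l) (hb : b ≠ l)
    (htop : ∀ x, x ≤ l) : numCycles (swap b l * σ) + 1 = numCycles σ := by
  classical
  have hls : ∀ y, σ.SameCycle l y → y = l := by
    intro y h
    obtain ⟨k, rfl⟩ := h.exists_nat_pow_eq
    exact Perm.pow_apply_eq_self_of_apply_eq_self hl k
  have : cycleMins σ = insert l (cycleMins (swap b l * σ)) := by
    ext x
    rw [mem_insert, mem_cycleMins, mem_cycleMins]
    by_cases hx : x = l
    · subst hx
      simp only [true_or, iff_true]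
      intro y h
      rw [hls y h]
    · simp only [hx, false_or]
      constructor
      · intro h y hy
        rw [sameCycle_swap_mul hl hb, if_neg hx] at hy
        by_cases hyl : y = l
        · rw [hyl]; exact htop x
        · rw [if_neg hyl] at hy
          exact h y hy
      · intro h y hy
        by_cases hyl : y = l
        · rw [hyl]; exact htop x
        · refine h y ?_
          rw [sameCycle_swap_mul hl hb, if_neg hx, if_neg hyl]
          exact hy
  rw [numCycles, numCycles, this, card_insert_of_notMem]
  intro h
  have := mem_cycleMins.1 h b ((sameCycle_swap_mul hl hb l b).2 (by simp [hb]))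
  exact hb (le_antisymm (htop b) this)

end CycleMins

/-! ### Increasing cycles -/

section Increasing
variable {ι : Type*} [Fintype ι] [LinearOrder ι]

/-- Every cycle of `π`, written from its least element, is increasing. -/
def IncreasingCycles (π : Perm ι) : Prop := ∀ j, j ≤ π⁻¹ j → j ∈ cycleMins π

variable {π : Perm ι}

theorem IncreasingCycles.lt_succ (h : IncreasingCycles π) {x : ι} {k : ℕ}
    (hk : k + 1 < cycleLen π x) (hx : x ∈ cycleMins π) : (π ^ k) x < (π ^ (k + 1)) x := by
  by_contra hlt
  push Not at hlt
  have h1 : (π ^ (k + 1)) x ∈ cycleMins π := h _ (by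
    rw [pow_succ', Perm.mul_apply]; simpa [pow_succ'] using hlt)
  have h2 := eq_of_mem_cycleMins hx h1 ⟨(k + 1 : ℕ), by rw [zpow_natCast]⟩
  have h3 := @cycleLen_injOn _ π x ⟨0, cycleLen_pos π x⟩ ⟨k + 1, hk⟩ (by simpa using h2)
  simp [Fin.ext_iff] at h3

theorem IncreasingCycles.strictMono (h : IncreasingCycles π) {x : ι} (hx : x ∈ cycleMins π) :
    StrictMono fun k : Fin (cycleLen π x) => (π ^ (k : ℕ)) x := by
  have key : ∀ d k : ℕ, k + 1 + d < cycleLen π x → (π ^ k) x < (π ^ (k + 1 + d)) x := by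
    intro d
    induction d with
    | zero => intro k hk; exact h.lt_succ hk hx
    | succ d ih =>
      intro k hk
      exact (ih k (by omega)).trans (h.lt_succ (k := k + 1 + d) (by omega) hx)
  intro k l hkl
  obtain ⟨d, hd⟩ := Nat.exists_eq_add_of_le (Nat.succ_le_of_lt (Fin.lt_def.1 hkl))
  have := key d k (by have := l.2; simp only [Nat.succ_eq_add_one] at hd; omega)
  simp only [Nat.succ_eq_add_one] at hd
  simpa only [← hd] using this

theorem increasingCycles_of_strictMono
    (h : ∀ x ∈ cycleMins π, StrictMono fun k : Fin (cycleLen π x) => (π ^ (k : ℕ)) x) :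
    IncreasingCycles π := by
  intro j hj
  obtain ⟨x, hx, hjx⟩ := exists_cycleMin π j
  obtain ⟨k, hk, hkj⟩ := exists_pow_lt_cycleLen (π := π) (x := x) (y := π⁻¹ j)
    (hjx.symm.trans (by simp))
  have hj' : (π ^ (k + 1)) x = j := by rw [pow_succ', Perm.mul_apply, hkj]; simp
  by_cases hk' : k + 1 < cycleLen π x
  · have := h x hx (a := ⟨k, hk⟩) (b := ⟨k + 1, hk'⟩) (by simp [Fin.lt_def])
    simp only [hkj, hj'] at this
    exact absurd hj (not_le.2 this)
  · have : k + 1 = cycleLen π x := by omega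
    rw [this, pow_cycleLen] at hj'
    exact hj' ▸ hx

theorem IncreasingCycles.notMem_Ioo (h : IncreasingCycles π) {a y : ι} (ha : a < π a)
    (hy : π.SameCycle a y) : ¬ (a < y ∧ y < π a) := by
  rintro ⟨h1, h2⟩
  obtain ⟨x, hx, hax⟩ := exists_cycleMin π a
  obtain ⟨k, hk, rfl⟩ := exists_pow_lt_cycleLen hax.symm
  obtain ⟨l, hl, rfl⟩ := exists_pow_lt_cycleLen (hax.symm.trans hy)
  have hm := h.strictMono hx
  have hk1 : k + 1 < cycleLen π x := by
    by_contra hk1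
    have e : k + 1 = cycleLen π x := by omega
    have : π ((π ^ k) x) = x := by rw [← Perm.mul_apply, ← pow_succ', e, pow_cycleLen]
    rw [this] at ha
    exact absurd (mem_cycleMins.1 hx _ hax.symm) (not_le.2 ha)
  have h1' : k < l := hm.lt_iff_lt (a := ⟨k, hk⟩) (b := ⟨l, hl⟩) |>.1 h1
  rw [← Perm.mul_apply, ← pow_succ'] at h2
  have h2' : l < k + 1 := hm.lt_iff_lt (a := ⟨l, hl⟩) (b := ⟨k + 1, hk1⟩) |>.1 h2
  omega

theorem IncreasingCycles.min_of_le (h : IncreasingCycles π) {d y : ι} (hd : π d ≤ d)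
    (hy : π.SameCycle d y) : π d ≤ y :=
  mem_cycleMins.1 (h (π d) (by simpa using hd)) y (by simpa using hy)

theorem IncreasingCycles.max_of_le (h : IncreasingCycles π) {d y : ι} (hd : π d ≤ d)
    (hy : π.SameCycle d y) : y ≤ d := by
  by_contra hlt
  push Not at hlt
  obtain ⟨x, hx, hdx⟩ := exists_cycleMin π d
  obtain ⟨k, hk, rfl⟩ := exists_pow_lt_cycleLen hdx.symm
  obtain ⟨l, hl, rfl⟩ := exists_pow_lt_cycleLen (hdx.symm.trans hy)
  have hm := h.strictMono hx
  have h1' : k < l := hm.lt_iff_lt (a := ⟨k, hk⟩) (b := ⟨l, hl⟩) |>.1 hlt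
  have := h.lt_succ (k := k) (by omega) hx
  rw [pow_succ', Perm.mul_apply] at this
  exact absurd hd (not_le.2 this)

/-- No two cycles of `π` cross. -/
def NonCrossing (π : Perm ι) : Prop := ∀ i j k l, i < j → j < k → k < l →
  π.SameCycle i k → π.SameCycle j l → π.SameCycle i j

theorem mem_NC {n : ℕ} {π : Perm (Fin n)} : π ∈ NC n ↔ IncreasingCycles π ∧ NonCrossing π := by
  simp only [NC, mem_filter, mem_univ, true_and, NonCrossing]
  refine and_congr_left fun _ => ⟨increasingCycles_of_strictMono, fun h x hx => h.strictMono hx⟩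

/-- If the cycles of `π` are increasing and do not cross, the points strictly between two
consecutive elements of a cycle are permuted by `π`. -/
theorem IncreasingCycles.mapsTo_Ioo (h : IncreasingCycles π) (hn : NonCrossing π) {a y : ι}
    (hay : a < y) (hya : y < π a) : a < π y ∧ π y < π a := by
  have hne : ¬ π.SameCycle a y := fun h' => h.notMem_Ioo (hay.trans hya) h' ⟨hay, hya⟩
  have hyy : π.SameCycle y (π y) := by simp
  have haa : π.SameCycle a (π a) := by simp
  constructor
  · by_contra hlt
    push Not at hlt
    have h1 : π y < a := lt_of_le_of_ne hlt fun e => hne (e ▸ hyy.symm)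
    exact hne ((hn _ _ _ _ h1 hay hya hyy.symm haa).symm.trans hyy.symm)
  · by_contra hlt
    push Not at hlt
    have h1 : π a < π y := lt_of_le_of_ne hlt fun e => hay.ne (π.injective e)
    exact hne (hn _ _ _ _ hay hya h1 haa hyy)

theorem sameCycle_mem_Ioo (hI : ∀ a y, a < y → y < π a → a < π y ∧ π y < π a) {a y z : ι}
    (h1 : a < y) (h2 : y < π a) (hyz : π.SameCycle y z) : a < z ∧ z < π a := by
  obtain ⟨k, rfl⟩ := hyz.exists_nat_pow_eq
  clear hyz
  induction k with
  | zero => exact ⟨h1, h2⟩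
  | succ k ih => rw [pow_succ', Perm.mul_apply]; exact hI _ _ ih.1 ih.2

theorem nonCrossing_of_mapsTo_Ioo (h : IncreasingCycles π)
    (hI : ∀ a y, a < y → y < π a → a < π y ∧ π y < π a) : NonCrossing π := by
  classical
  intro i j k l hij hjk hkl hik hjl
  by_contra hne
  have hs : (univ.filter fun e => π.SameCycle i e ∧ e < j).Nonempty := ⟨i, by simp [hij]⟩
  obtain ⟨e, he, hmax⟩ := exists_max_image _ id hs
  simp only [mem_filter, mem_univ, true_and, id] at he hmax
  have h1 : e < π e := by
    by_contra hle
    push Not at hle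
    have := h.max_of_le hle (he.1.symm.trans hik)
    exact absurd (this.trans_lt he.2) (not_lt.2 hjk.le)
  have h2 : j < π e := by
    rcases lt_trichotomy j (π e) with hlt | heq | hgt
    · exact hlt
    · exact absurd (he.1.trans (by rw [heq]; simp)) hne
    · exact absurd (hmax (π e) ⟨by simpa using he.1, hgt⟩) (not_le.2 h1)
  have h3 := sameCycle_mem_Ioo hI he.2 h2 hjl
  exact h.notMem_Ioo h1 (he.1.symm.trans hik) ⟨he.2.trans hjk, hkl.trans h3.2⟩

end Increasing

/-! ### Non-crossing partitions are the permutations on a geodesic -/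

section Geodesic
variable {N : ℕ}

theorem finRotate_apply_of_ne_last {x : Fin (N + 1)} (h : x ≠ Fin.last N) :
    ((finRotate (N + 1) x : Fin (N + 1)) : ℕ) = x + 1 := coe_finRotate_of_ne_last h

theorem le_finRotate_inv_iff {j y : Fin (N + 1)} :
    j ≤ (finRotate (N + 1))⁻¹ y ↔ y = 0 ∨ j < y := by
  obtain ⟨z, rfl⟩ := (finRotate (N + 1)).surjective y
  rw [Perm.inv_def, symm_apply_apply]
  by_cases hz : z = Fin.last N
  · subst hz
    simp [Fin.le_last]
  · have h := finRotate_apply_of_ne_last hz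
    have h0 : finRotate (N + 1) z ≠ 0 := fun e => by rw [e] at h; simp at h
    rw [Fin.lt_def, h, Fin.le_def]
    simp only [h0, false_or]
    omega

theorem cycleMins_subset {ι : Type*} [Fintype ι] [LinearOrder ι] (π : Perm ι) :
    cycleMins π ⊆ univ.filter fun j => j ≤ π⁻¹ j := fun x hx =>
  mem_filter.2 ⟨mem_univ _, mem_cycleMins.1 hx _ (by simp)⟩

theorem card_weakDescents_add (π : Perm (Fin (N + 1))) :
    #(univ.filter fun j => j ≤ π⁻¹ j) +
      #(univ.filter fun j => j ≤ (π⁻¹ * finRotate (N + 1))⁻¹ j) = N + 2 := by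
  classical
  set V : Finset (Fin (N + 1)) := univ.filter fun i => π i ≤ i with hV
  have h1 : #(univ.filter fun j => j ≤ π⁻¹ j) = #V := by
    refine (card_bij (fun i _ => π i) ?_ (fun _ _ _ _ h => π.injective h) ?_).symm
    · intro i hi
      simpa [hV] using hi
    · intro j hj
      exact ⟨π⁻¹ j, by simpa [hV] using hj, by simp⟩
  have h2 : (univ.filter fun j => j ≤ (π⁻¹ * finRotate (N + 1))⁻¹ j) = insert (π⁻¹ 0) Vᶜ := by
    ext j
    have : (π⁻¹ * finRotate (N + 1))⁻¹ j = (finRotate (N + 1))⁻¹ (π j) := by simp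
    simp only [mem_filter, mem_univ, true_and, this, le_finRotate_inv_iff, mem_insert,
      mem_compl, hV, not_le]
    rw [Perm.eq_inv_iff_eq]
  have h3 : π⁻¹ 0 ∉ Vᶜ := by simp [hV]
  have h4 := card_le_univ V
  rw [h1, h2, card_insert_of_notMem h3, card_compl]
  simp only [Fintype.card_fin] at h4 ⊢
  omega

theorem increasingCycles_iff {ι : Type*} [Fintype ι] [LinearOrder ι] {π : Perm ι} :
    IncreasingCycles π ↔ numCycles π = #(univ.filter fun j => j ≤ π⁻¹ j) := by
  constructor
  · intro h
    rw [numCycles]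
    congr 1
    exact (cycleMins_subset π).antisymm fun j hj => h j (mem_filter.1 hj).2
  · intro h j hj
    rw [eq_of_subset_of_card_le (cycleMins_subset π) h.ge]
    exact mem_filter.2 ⟨mem_univ _, hj⟩

theorem numCycles_add_eq_iff (π : Perm (Fin (N + 1))) :
    numCycles π + numCycles (π⁻¹ * finRotate (N + 1)) = N + 2 ↔
      IncreasingCycles π ∧ IncreasingCycles (π⁻¹ * finRotate (N + 1)) := by
  rw [increasingCycles_iff, increasingCycles_iff]
  have h1 := card_le_card (cycleMins_subset π)
  have h2 := card_le_card (cycleMins_subset (π⁻¹ * finRotate (N + 1)))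
  have h3 := card_weakDescents_add π
  change numCycles _ ≤ _ at h1 h2
  omega

theorem mapsTo_Ioo_of_increasingCycles {π : Perm (Fin (N + 1))} (h : IncreasingCycles π)
    (hσ : IncreasingCycles (π⁻¹ * finRotate (N + 1))) (a y : Fin (N + 1)) (hay : a < y)
    (hya : y < π a) : a < π y ∧ π y < π a := by
  classical
  induction hL : (π a : ℕ) - a using Nat.strong_induction_on generalizing a y with
  | _ L ih =>
  set σ := π⁻¹ * finRotate (N + 1) with hσd
  have hπσ : ∀ x, π (σ x) = finRotate (N + 1) x := fun x => by simp [hσd]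
  obtain ⟨b, hb⟩ := (finRotate (N + 1)).surjective (π a)
  have hba : σ b = a := π.injective (by rw [hπσ, hb])
  have hbl : b ≠ Fin.last N := by
    rintro rfl
    rw [finRotate_last] at hb
    rw [← hb] at hya
    exact absurd hya (by simp)
  have hbv := finRotate_apply_of_ne_last hbl
  rw [hb] at hbv
  rw [Fin.lt_def] at hay hya
  have hab : σ b ≤ b := by rw [hba, Fin.le_def]; omega
  have hσb : σ.SameCycle b a := by rw [← hba]; simp
  have hs : (univ.filter fun e => σ.SameCycle a e ∧ e < y).Nonempty := ⟨a, by simpa using hay⟩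
  obtain ⟨c, hc, hcmax⟩ := exists_max_image _ id hs
  simp only [mem_filter, mem_univ, true_and, id] at hc hcmax
  have hac : a ≤ c := hba ▸ hσ.min_of_le hab (hσb.trans hc.1)
  have hcc : c < σ c := by
    by_contra hle
    push Not at hle
    have := hσ.max_of_le hle (hc.1.symm.trans hσb.symm)
    have h2 := hc.2
    rw [Fin.lt_def] at h2
    rw [Fin.le_def] at this
    omega
  have hyc : y ≤ σ c := by
    by_contra hlt
    push Not at hlt
    exact absurd (hcmax (σ c) ⟨by simpa using hc.1, hlt⟩) (not_le.2 hcc)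
  have hdb : σ c ≤ b := hσ.max_of_le hab (hσb.trans (by simpa using hc.1))
  have hcl : c ≠ Fin.last N := by
    rintro rfl
    exact absurd hcc (not_lt.2 (Fin.le_last _))
  have hcv := finRotate_apply_of_ne_last hcl
  rw [← hπσ] at hcv
  generalize hd : σ c = d at *
  have hc2 := hc.2
  rw [Fin.lt_def] at hc2 hcc
  rw [Fin.le_def] at hyc hdb hac
  have hdd : π d ≤ d := by rw [Fin.le_def]; omega
  have hs : (univ.filter fun e => π.SameCycle d e ∧ e ≤ y).Nonempty :=
    ⟨π d, mem_filter.2 ⟨mem_univ _, by simp, by rw [Fin.le_def]; omega⟩⟩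
  obtain ⟨e, he, hemax⟩ := exists_max_image _ id hs
  simp only [mem_filter, mem_univ, true_and, id] at he hemax
  have hde := h.min_of_le hdd he.1
  rcases he.2.eq_or_lt with rfl | hey
  · have h1 := h.min_of_le hdd (y := π e) (by simpa using he.1)
    have h2 := h.max_of_le hdd (y := π e) (by simpa using he.1)
    rw [Fin.le_def] at h1 h2
    simp only [Fin.lt_def]
    omega
  · have hee : e < π e := by
      by_contra hle
      push Not at hle
      have := h.max_of_le hle he.1.symm
      rw [Fin.lt_def] at hey
      rw [Fin.le_def] at this
      omega
    have hye : y < π e := by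
      by_contra hle
      push Not at hle
      exact absurd (hemax (π e) ⟨by simpa using he.1, hle⟩) (not_le.2 hee)
    have h2 := h.max_of_le hdd (y := π e) (by simpa using he.1)
    rw [Fin.le_def] at h2 hde
    rw [Fin.lt_def] at hee
    have := ih ((π e : ℕ) - e) (by omega) e y hey hye rfl
    simp only [Fin.lt_def] at this ⊢
    omega

theorem increasingCycles_complement {π : Perm (Fin (N + 1))} (h : IncreasingCycles π)
    (hn : NonCrossing π) : IncreasingCycles (π⁻¹ * finRotate (N + 1)) := by
  set σ := π⁻¹ * finRotate (N + 1) with hσd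
  have hπσ : ∀ x, π (σ x) = finRotate (N + 1) x := fun x => by simp [hσd]
  intro j hj
  obtain ⟨i, hi⟩ : ∃ i, σ i = j := ⟨σ⁻¹ j, by simp⟩
  have hji : j ≤ i := by rw [← hi] at hj ⊢; simpa using hj
  have hπj : π j = finRotate (N + 1) i := by rw [← hi, hπσ]
  have key : ∀ x, j ≤ x ∧ x ≤ i → j ≤ σ x ∧ σ x ≤ i := by
    rintro x ⟨hjx, hxi⟩
    rcases hxi.eq_or_lt with rfl | hxi
    · rw [hi]
      exact ⟨le_rfl, hji⟩
    have hxl : x ≠ Fin.last N := (hxi.trans_le (Fin.le_last i)).ne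
    have hxv := finRotate_apply_of_ne_last hxl
    rw [← hπσ] at hxv
    rw [Fin.lt_def] at hxi
    rw [Fin.le_def] at hjx
    have hsc : π.SameCycle (π (σ x)) (σ x) := by simp
    by_cases hil : i = Fin.last N
    · subst hil
      refine ⟨?_, Fin.le_last _⟩
      rw [finRotate_last] at hπj
      by_contra hlt
      push Not at hlt
      have hle : π j ≤ j := by rw [hπj]; exact Fin.zero_le _
      have h0 : ¬ π.SameCycle j (σ x) := by
        intro h'
        have := h.max_of_le hle (h'.trans hsc.symm)
        rw [Fin.le_def] at this
        omega
      have hj0 : π.SameCycle 0 j := by rw [← hπj]; simp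
      have hpos : 0 < σ x := by
        rw [Fin.pos_iff_ne_zero]
        intro h'
        exact h0 (h' ▸ hj0.symm)
      exact h0 (hj0.symm.trans (hn 0 (σ x) j (π (σ x)) hpos hlt
        (by rw [Fin.lt_def]; omega) hj0 hsc.symm))
    · have hiv := finRotate_apply_of_ne_last hil
      rw [← hπj] at hiv
      have := sameCycle_mem_Ioo (fun a y => h.mapsTo_Ioo hn) (a := j) (y := π (σ x))
        (by rw [Fin.lt_def]; omega) (by rw [Fin.lt_def]; omega) hsc
      simp only [Fin.lt_def, Fin.le_def] at this ⊢
      omega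
  refine mem_cycleMins.2 fun y hy => ?_
  obtain ⟨k, rfl⟩ := hy.exists_nat_pow_eq
  have : ∀ k : ℕ, j ≤ (σ ^ k) j ∧ (σ ^ k) j ≤ i := by
    intro k
    induction k with
    | zero => exact ⟨le_rfl, hji⟩
    | succ k ih => rw [pow_succ', Perm.mul_apply]; exact key _ ih
  exact (this k).1

theorem mem_NC_iff_numCycles {π : Perm (Fin (N + 1))} :
    π ∈ NC (N + 1) ↔ numCycles π + numCycles (π⁻¹ * finRotate (N + 1)) = N + 2 := by
  rw [numCycles_add_eq_iff, mem_NC]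
  exact ⟨fun h => ⟨h.1, increasingCycles_complement h.1 h.2⟩, fun h =>
    ⟨h.1, nonCrossing_of_mapsTo_Ioo h.1 (mapsTo_Ioo_of_increasingCycles h.1 h.2)⟩⟩

theorem conj_finRotate_mem_NC {n : ℕ} {π : Perm (Fin n)} (k : ℕ) :
    finRotate n ^ k * π * (finRotate n ^ k)⁻¹ ∈ NC n ↔ π ∈ NC n := by
  obtain _ | n := n
  · rw [Subsingleton.elim (finRotate 0 ^ k * π * (finRotate 0 ^ k)⁻¹) π]
  rw [mem_NC_iff_numCycles, mem_NC_iff_numCycles, numCycles_conj,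
    ← numCycles_conj (finRotate (n + 1) ^ k) (π⁻¹ * finRotate (n + 1))]
  have : (finRotate (n + 1) ^ k * π * (finRotate (n + 1) ^ k)⁻¹)⁻¹ * finRotate (n + 1) =
      finRotate (n + 1) ^ k * (π⁻¹ * finRotate (n + 1)) * (finRotate (n + 1) ^ k)⁻¹ := by
    have hc : (finRotate (n + 1) ^ k)⁻¹ * finRotate (n + 1) =
        finRotate (n + 1) * (finRotate (n + 1) ^ k)⁻¹ :=
      (((Commute.refl _).pow_left k).inv_left).eq
    rw [mul_inv_rev, mul_inv_rev, inv_inv]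
    simp only [mul_assoc]
    rw [hc]
  rw [this]

end Geodesic

/-! ### Sums over non-crossing partitions of products of weights of blocks -/

section ProdPerm
variable {m n : ℕ}

@[simp] theorem prodPerm_castAdd (π₁ : Perm (Fin m)) (π₂ : Perm (Fin n)) (i : Fin m) :
    prodPerm π₁ π₂ (Fin.castAdd n i) = Fin.castAdd n (π₁ i) := by simp [prodPerm]

@[simp] theorem prodPerm_natAdd (π₁ : Perm (Fin m)) (π₂ : Perm (Fin n)) (i : Fin n) :
    prodPerm π₁ π₂ (Fin.natAdd m i) = Fin.natAdd m (π₂ i) := by simp [prodPerm]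

theorem prodPerm_mul (π₁ σ₁ : Perm (Fin m)) (π₂ σ₂ : Perm (Fin n)) :
    prodPerm π₁ π₂ * prodPerm σ₁ σ₂ = prodPerm (π₁ * σ₁) (π₂ * σ₂) := by
  ext i : 1
  induction i using Fin.addCases <;> simp

theorem prodPerm_one : prodPerm (1 : Perm (Fin m)) (1 : Perm (Fin n)) = 1 := by
  ext i : 1
  induction i using Fin.addCases <;> simp

theorem prodPerm_inv (π₁ : Perm (Fin m)) (π₂ : Perm (Fin n)) :
    (prodPerm π₁ π₂)⁻¹ = prodPerm π₁⁻¹ π₂⁻¹ :=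
  inv_eq_of_mul_eq_one_left (by rw [prodPerm_mul]; simp [prodPerm_one])

theorem prodPerm_injective {π₁ σ₁ : Perm (Fin m)} {π₂ σ₂ : Perm (Fin n)}
    (h : prodPerm π₁ π₂ = prodPerm σ₁ σ₂) : π₁ = σ₁ ∧ π₂ = σ₂ := by
  constructor
  · ext i : 1
    have := congrArg (fun π => π (Fin.castAdd n i)) h
    simpa using this
  · ext i : 1
    have := congrArg (fun π => π (Fin.natAdd m i)) h
    simpa using this

theorem exists_eq_prodPerm {π : Perm (Fin (m + n))} (h : ∀ i : Fin m, (π (Fin.castAdd n i) : ℕ) < m) :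
    ∃ π₁ π₂, π = prodPerm π₁ π₂ := by
  have := Equiv.Perm.mem_sumCongrHom_range_of_perm_mapsTo_inl
    (σ := finSumFinEquiv.symm.permCongr π) (by
      rintro _ ⟨i, rfl⟩
      refine ⟨⟨_, h i⟩, ?_⟩
      apply finSumFinEquiv.injective
      simp [Equiv.permCongr_apply])
  obtain ⟨⟨π₁, π₂⟩, h'⟩ := this
  refine ⟨π₁, π₂, ?_⟩
  have h2 : Perm.sumCongr π₁ π₂ = finSumFinEquiv.symm.permCongr π := h'
  rw [prodPerm, h2]
  ext i
  simp [Equiv.permCongr_apply]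

theorem not_sameCycle_prodPerm (π₁ : Perm (Fin m)) (π₂ : Perm (Fin n)) (i : Fin m) (j : Fin n) :
    ¬ (prodPerm π₁ π₂).SameCycle (Fin.castAdd n i) (Fin.natAdd m j) := by
  rw [sameCycle_castAdd]
  rintro ⟨k, -, h⟩
  have := congrArg Fin.val h
  simp at this
  omega

theorem sameCycle_castAdd_castAdd (π₁ : Perm (Fin m)) (π₂ : Perm (Fin n)) {i j : Fin m} :
    (prodPerm π₁ π₂).SameCycle (Fin.castAdd n i) (Fin.castAdd n j) ↔ π₁.SameCycle i j := by
  rw [sameCycle_castAdd]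
  constructor
  · rintro ⟨k, h, e⟩
    rwa [(Fin.castAdd_inj).1 e]
  · intro h
    exact ⟨j, h, rfl⟩

theorem sameCycle_natAdd_natAdd (π₁ : Perm (Fin m)) (π₂ : Perm (Fin n)) {i j : Fin n} :
    (prodPerm π₁ π₂).SameCycle (Fin.natAdd m i) (Fin.natAdd m j) ↔ π₂.SameCycle i j := by
  rw [sameCycle_natAdd]
  constructor
  · rintro ⟨k, h, e⟩
    rwa [(Fin.natAdd_inj _).1 e]
  · intro h
    exact ⟨j, h, rfl⟩

theorem increasingCycles_prodPerm (π₁ : Perm (Fin m)) (π₂ : Perm (Fin n)) :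
    IncreasingCycles (prodPerm π₁ π₂) ↔ IncreasingCycles π₁ ∧ IncreasingCycles π₂ := by
  simp only [IncreasingCycles, Fin.forall_fin_add, prodPerm_inv, prodPerm_castAdd,
    prodPerm_natAdd, castAdd_mem_cycleMins, natAdd_mem_cycleMins, Fin.natAdd_le_natAdd_iff]
  rfl

theorem nonCrossing_prodPerm (π₁ : Perm (Fin m)) (π₂ : Perm (Fin n)) :
    NonCrossing (prodPerm π₁ π₂) ↔ NonCrossing π₁ ∧ NonCrossing π₂ := by
  constructor
  · intro h
    constructor
    · intro i j k l h1 h2 h3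
      have := h (Fin.castAdd n i) (Fin.castAdd n j) (Fin.castAdd n k) (Fin.castAdd n l) h1 h2 h3
      simpa only [sameCycle_castAdd_castAdd] using this
    · intro i j k l h1 h2 h3
      have := h (Fin.natAdd m i) (Fin.natAdd m j) (Fin.natAdd m k) (Fin.natAdd m l)
        (by simpa using h1) (by simpa using h2) (by simpa using h3)
      simpa only [sameCycle_natAdd_natAdd] using this
  · rintro ⟨hn₁, hn₂⟩ i j k l h1 h2 h3 hik hjl
    induction i using Fin.addCases with
    | left i =>
      obtain ⟨k, hik', rfl⟩ := (sameCycle_castAdd _ _).1 hik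
      induction j using Fin.addCases with
      | left j =>
        obtain ⟨l, hjl', rfl⟩ := (sameCycle_castAdd _ _).1 hjl
        exact (sameCycle_castAdd_castAdd _ _).2 (hn₁ i j k l h1 h2 h3 hik' hjl')
      | right j => simp [Fin.lt_def] at h2; omega
    | right i =>
      obtain ⟨k, hik', rfl⟩ := (sameCycle_natAdd _ _).1 hik
      induction j using Fin.addCases with
      | left j => simp [Fin.lt_def] at h1; omega
      | right j =>
        obtain ⟨l, hjl', rfl⟩ := (sameCycle_natAdd _ _).1 hjl
        exact (sameCycle_natAdd_natAdd _ _).2 (hn₂ i j k l (by simpa using h1) (by simpa using h2)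
          (by simpa using h3) hik' hjl')

theorem prodPerm_mem_NC {π₁ : Perm (Fin m)} {π₂ : Perm (Fin n)} :
    prodPerm π₁ π₂ ∈ NC (m + n) ↔ π₁ ∈ NC m ∧ π₂ ∈ NC n := by
  rw [mem_NC, mem_NC, mem_NC, increasingCycles_prodPerm, nonCrossing_prodPerm]
  tauto

@[to_additive sum_cycleMins_prodPerm]
theorem prod_cycleMins_prodPerm {M : Type*} [CommMonoid M] (π₁ : Perm (Fin m))
    (π₂ : Perm (Fin n)) (f : Fin (m + n) → M) :
    ∏ x ∈ cycleMins (prodPerm π₁ π₂), f x =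
      (∏ i ∈ cycleMins π₁, f (Fin.castAdd n i)) * ∏ j ∈ cycleMins π₂, f (Fin.natAdd m j) := by
  classical
  rw [← Fintype.prod_ite_mem _ f, ← Fintype.prod_ite_mem (cycleMins π₁),
    ← Fintype.prod_ite_mem (cycleMins π₂), Fin.prod_univ_add]
  simp only [castAdd_mem_cycleMins, natAdd_mem_cycleMins]

theorem numCycles_prodPerm (π₁ : Perm (Fin m)) (π₂ : Perm (Fin n)) :
    numCycles (prodPerm π₁ π₂) = numCycles π₁ + numCycles π₂ := by
  have := sum_cycleMins_prodPerm π₁ π₂ fun _ => (1 : ℕ)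
  simpa [numCycles] using this

end ProdPerm

section BlockWeight

/-- The block of `π` containing `x`, as a set of natural numbers. -/
noncomputable def block {n : ℕ} (π : Perm (Fin n)) (x : Fin n) : Finset ℕ :=
  (cycleSet π x).map Fin.valEmbedding

theorem mem_block {n : ℕ} {π : Perm (Fin n)} {x : Fin n} {k : ℕ} :
    k ∈ block π x ↔ ∃ y : Fin n, π.SameCycle x y ∧ (y : ℕ) = k := by
  simp [block, mem_cycleSet]

theorem card_block {n : ℕ} (π : Perm (Fin n)) (x : Fin n) : #(block π x) = cycleLen π x := by
  rw [block, card_map, card_cycleSet]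

theorem block_eq_of_sameCycle {n : ℕ} {π : Perm (Fin n)} {x y : Fin n} (h : π.SameCycle x y) :
    block π x = block π y := by
  rw [block, block, cycleSet_eq_of_sameCycle h]

/-- The product of the weights `F B` of the blocks of `π`. -/
noncomputable def blockWeight (F : Finset ℕ → ℂ) {n : ℕ} (π : Perm (Fin n)) : ℂ :=
  ∏ x ∈ cycleMins π, F (block π x)

/-- `π` maps the last point to `t`. -/
def LastTo (t : ℕ) {n : ℕ} (π : Perm (Fin n)) : Prop :=
  ∀ l : Fin n, (l : ℕ) + 1 = n → (π l : ℕ) = t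

/-- The sum of the block weights over all non-crossing partitions. -/
noncomputable def ncSum (F : Finset ℕ → ℂ) (n : ℕ) : ℂ := ∑ π ∈ NC n, blockWeight F π

open Classical in
/-- The sum of the block weights over the non-crossing partitions mapping the last point to `t`. -/
noncomputable def ncSumTo (F : Finset ℕ → ℂ) (n t : ℕ) : ℂ :=
  ∑ π ∈ (NC n).filter (LastTo t), blockWeight F π

/-- The translate of a set of natural numbers. -/
def shift (m : ℕ) (B : Finset ℕ) : Finset ℕ := B.map (addLeftEmbedding m)

theorem mem_shift {m k : ℕ} {B : Finset ℕ} : k ∈ shift m B ↔ ∃ b ∈ B, m + b = k := by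
  simp [shift]

theorem card_shift (m : ℕ) (B : Finset ℕ) : #(shift m B) = #B := card_map _

theorem block_castAdd {m n : ℕ} (π₁ : Perm (Fin m)) (π₂ : Perm (Fin n)) (i : Fin m) :
    block (prodPerm π₁ π₂) (Fin.castAdd n i) = block π₁ i := by
  ext k
  simp only [mem_block, sameCycle_castAdd]
  constructor
  · rintro ⟨_, ⟨j, h, rfl⟩, rfl⟩
    exact ⟨j, h, rfl⟩
  · rintro ⟨j, h, rfl⟩
    exact ⟨_, ⟨j, h, rfl⟩, rfl⟩

theorem block_natAdd {m n : ℕ} (π₁ : Perm (Fin m)) (π₂ : Perm (Fin n)) (i : Fin n) :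
    block (prodPerm π₁ π₂) (Fin.natAdd m i) = shift m (block π₂ i) := by
  ext k
  simp only [mem_shift, mem_block, sameCycle_natAdd]
  constructor
  · rintro ⟨_, ⟨j, h, rfl⟩, rfl⟩
    exact ⟨j, ⟨j, h, rfl⟩, by simp⟩
  · rintro ⟨_, ⟨j, h, rfl⟩, rfl⟩
    exact ⟨_, ⟨j, h, rfl⟩, by simp⟩

theorem blockWeight_prodPerm (F : Finset ℕ → ℂ) {m n : ℕ} (π₁ : Perm (Fin m))
    (π₂ : Perm (Fin n)) : blockWeight F (prodPerm π₁ π₂) =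
      blockWeight F π₁ * blockWeight (fun B => F (shift m B)) π₂ := by
  simp only [blockWeight, prod_cycleMins_prodPerm, block_castAdd, block_natAdd]

theorem lastTo_prodPerm {m n : ℕ} (hn : 0 < n) {π₁ : Perm (Fin m)} {π₂ : Perm (Fin n)} {t : ℕ} :
    LastTo (m + t) (prodPerm π₁ π₂) ↔ LastTo t π₂ := by
  constructor
  · intro h l hl
    have := h (Fin.natAdd m l) (by simp; omega)
    simpa using this
  · intro h l hl
    induction l using Fin.addCases with
    | left i => simp at hl; omega
    | right i => simpa using h i (by simp at hl; omega)

/-- A non-crossing partition mapping the last point to `m` restricts to the first `m` points. -/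
theorem ncSumTo_add (F : Finset ℕ → ℂ) (m : ℕ) {n : ℕ} (hn : 0 < n) :
    ncSumTo F (m + n) m = ncSum F m * ncSumTo (fun B => F (shift m B)) n 0 := by
  classical
  rw [ncSum, ncSumTo, ncSumTo, sum_mul_sum, ← sum_product']
  refine (sum_bij (fun P _ => prodPerm P.1 P.2) ?_ ?_ ?_ ?_).symm
  · rintro ⟨π₁, π₂⟩ h
    simp only [mem_product, mem_filter] at h ⊢
    exact ⟨prodPerm_mem_NC.2 ⟨h.1, h.2.1⟩, (lastTo_prodPerm (t := 0) hn).2 h.2.2⟩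
  · rintro ⟨π₁, π₂⟩ - ⟨σ₁, σ₂⟩ - h
    exact Prod.ext (prodPerm_injective h).1 (prodPerm_injective h).2
  · intro π hπ
    rw [mem_filter] at hπ
    obtain ⟨hπ, hl⟩ := hπ
    have hπ' := mem_NC.1 hπ
    let L : Fin (m + n) := ⟨m + n - 1, by omega⟩
    have hL : (π L : ℕ) = m := hl L (by simp [L]; omega)
    have hLle : ∀ x, x ≤ L := fun x => by rw [Fin.le_def]; simp only [L]; omega
    have hmin : ∀ y, π.SameCycle L y → π L ≤ y := fun y => hπ'.1.min_of_le (hLle _)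
    obtain ⟨π₁, π₂, rfl⟩ := exists_eq_prodPerm (π := π) (by
      intro i
      by_contra hge
      push Not at hge
      have hnot : ¬ π.SameCycle L (Fin.castAdd n i) := by
        intro h
        have := hmin _ h
        rw [Fin.le_def, hL] at this
        simp at this
        omega
      have hii : π.SameCycle (Fin.castAdd n i) (π (Fin.castAdd n i)) := by simp
      have h1 : π L < π (Fin.castAdd n i) := lt_of_le_of_ne (by rw [Fin.le_def]; omega)
        fun e => hnot (by rw [π.injective e])
      have h2 : π (Fin.castAdd n i) < L := lt_of_le_of_ne (hLle _)
        fun e => hnot (by rw [← e]; exact hii.symm)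
      have h3 := hπ'.2 (Fin.castAdd n i) (π L) _ L
        (by rw [Fin.lt_def, hL]; simp) h1 h2 hii (by simp)
      exact hnot (by simpa using h3.symm))
    exact ⟨(π₁, π₂), by
      simp only [mem_product, mem_filter]
      exact ⟨(prodPerm_mem_NC.1 hπ).1, (prodPerm_mem_NC.1 hπ).2,
        (lastTo_prodPerm (t := 0) hn).1 hl⟩, rfl⟩
  · rintro ⟨π₁, π₂⟩ -
    exact (blockWeight_prodPerm F π₁ π₂).symm

theorem ncSum_succ_eq_sum_ncSumTo (F : Finset ℕ → ℂ) (N : ℕ) :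
    ncSum F (N + 1) = ∑ t ∈ range (N + 1), ncSumTo F (N + 1) t := by
  classical
  have h : ∀ π : Perm (Fin (N + 1)), ∀ t, LastTo t π ↔ (π (Fin.last N) : ℕ) = t := by
    intro π t
    refine ⟨fun h => h _ (by simp), fun h l hl => ?_⟩
    rwa [show l = Fin.last N from Fin.ext (by simpa using hl)]
  simp only [ncSum, ncSumTo, h]
  refine (sum_fiberwise_of_maps_to (fun π _ => ?_) _).symm
  exact mem_range.2 (π (Fin.last N)).2

/-- Splitting a non-crossing partition along the image of the last point. -/
theorem ncSum_succ (F : Finset ℕ → ℂ) (N : ℕ) :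
    ncSum F (N + 1) = ∑ t ∈ range (N + 1),
      ncSum F t * ncSumTo (fun B => F (shift t B)) (N + 1 - t) 0 := by
  rw [ncSum_succ_eq_sum_ncSumTo]
  refine sum_congr rfl fun t ht => ?_
  rw [mem_range] at ht
  have := ncSumTo_add F t (n := N + 1 - t) (by omega)
  rwa [show t + (N + 1 - t) = N + 1 by omega] at this

end BlockWeight

section Contract
variable {N : ℕ}

/-- Inserting a new last point into the cycle of `0`, just before `0`. -/
def insertLast (π : Perm (Fin (N + 1))) : Perm (Fin (N + 1 + 1)) :=
  swap 0 (Fin.natAdd (N + 1) 0) * prodPerm π (1 : Perm (Fin 1))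

/-- Identifies the last point with `0`. -/
def collapseLast : Fin (N + 1 + 1) → Fin (N + 1) := Fin.addCases id fun _ => 0

theorem collapseLast_castAdd (i : Fin (N + 1)) : collapseLast (Fin.castAdd 1 i) = i := by
  simp [collapseLast]

theorem collapseLast_natAdd (i : Fin 1) : collapseLast (Fin.natAdd (N + 1) i) = 0 := by
  simp [collapseLast]

theorem zero_ne_natAdd : (0 : Fin (N + 1 + 1)) ≠ Fin.natAdd (N + 1) (0 : Fin 1) := by
  simp [Fin.ext_iff]

theorem sameCycle_insertLast (π : Perm (Fin (N + 1))) (x y : Fin (N + 1 + 1)) :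
    (insertLast π).SameCycle x y ↔ π.SameCycle (collapseLast x) (collapseLast y) := by
  have h0 : (0 : Fin (N + 1 + 1)) = Fin.castAdd 1 0 := rfl
  have h : ∀ x : Fin (N + 1 + 1), (if x = Fin.natAdd (N + 1) (0 : Fin 1) then 0 else x) =
      Fin.castAdd 1 (collapseLast x) := by
    intro x
    induction x using Fin.addCases with
    | left i =>
      rw [if_neg, collapseLast_castAdd]
      simp [Fin.ext_iff]
      omega
    | right i => rw [Subsingleton.elim i 0, if_pos rfl, collapseLast_natAdd, h0]
  rw [insertLast, sameCycle_swap_mul (by simp) zero_ne_natAdd, h, h, sameCycle_castAdd_castAdd]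

theorem collapseLast_surjective : Function.Surjective (collapseLast (N := N)) := fun i =>
  ⟨Fin.castAdd 1 i, collapseLast_castAdd i⟩

theorem block_insertLast (π : Perm (Fin (N + 1))) (x : Fin (N + 1 + 1)) :
    block (insertLast π) x = if 0 ∈ block π (collapseLast x)
      then insert (N + 1) (block π (collapseLast x)) else block π (collapseLast x) := by
  have h0 : 0 ∈ block π (collapseLast x) ↔ π.SameCycle (collapseLast x) 0 := by
    rw [mem_block]
    constructor
    · rintro ⟨y, h, hy⟩
      rwa [show y = 0 from Fin.ext hy] at h
    · intro h
      exact ⟨0, h, rfl⟩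
  have hb : ∀ k, k ∈ block (insertLast π) x ↔
      k ∈ block π (collapseLast x) ∨ (π.SameCycle (collapseLast x) 0 ∧ k = N + 1) := by
    intro k
    simp only [mem_block, sameCycle_insertLast]
    constructor
    · rintro ⟨y, h, rfl⟩
      induction y using Fin.addCases with
      | left i =>
        rw [collapseLast_castAdd] at h
        exact Or.inl ⟨i, h, rfl⟩
      | right i =>
        rw [collapseLast_natAdd] at h
        exact Or.inr ⟨h, by simp⟩
    · rintro (⟨y, h, rfl⟩ | ⟨h, rfl⟩)
      · exact ⟨Fin.castAdd 1 y, by rwa [collapseLast_castAdd], rfl⟩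
      · exact ⟨Fin.natAdd (N + 1) 0, by rwa [collapseLast_natAdd], by simp⟩
  ext k
  rw [hb]
  by_cases h : π.SameCycle (collapseLast x) 0
  · rw [if_pos (h0.2 h), mem_insert]
    simp only [h, true_and]
    exact or_comm
  · rw [if_neg (mt h0.1 h)]
    simp [h]

theorem blockWeight_insertLast (F : Finset ℕ → ℂ) (π : Perm (Fin (N + 1))) :
    blockWeight F (insertLast π) =
      blockWeight (fun B => if 0 ∈ B then F (insert (N + 1) B) else F B) π := by
  refine prod_cycleMins_congr collapseLast collapseLast_surjective (sameCycle_insertLast π) ?_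
  intro x y h
  rw [block_insertLast, block_eq_of_sameCycle h]
  split_ifs with h0
  · exact (if_pos h0).symm
  · exact (if_neg h0).symm

theorem swap_mul_finRotate : swap 0 (Fin.natAdd (N + 1) 0) * finRotate (N + 1 + 1) =
    prodPerm (finRotate (N + 1)) (1 : Perm (Fin 1)) := by
  have hl : Fin.natAdd (N + 1) (0 : Fin 1) = Fin.last (N + 1) := by simp [Fin.ext_iff]
  ext x : 1
  induction x using Fin.addCases with
  | left i =>
    have h1 : Fin.castAdd 1 i ≠ Fin.last (N + 1) := by simp [Fin.ext_iff]; omega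
    have h2 := finRotate_apply_of_ne_last h1
    rw [Perm.mul_apply, prodPerm_castAdd]
    by_cases hi : i = Fin.last N
    · subst hi
      have h3 : finRotate (N + 1 + 1) (Fin.castAdd 1 (Fin.last N)) = Fin.natAdd (N + 1) 0 := by
        apply Fin.ext; rw [h2]; simp
      rw [h3, swap_apply_right, finRotate_last]
      rfl
    · have h3 := finRotate_apply_of_ne_last hi
      have h4 : finRotate (N + 1 + 1) (Fin.castAdd 1 i) = Fin.castAdd 1 (finRotate (N + 1) i) :=
        Fin.ext (h2.trans h3.symm)
      have h5 := (finRotate (N + 1) i).2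
      rw [h4]
      refine swap_apply_of_ne_of_ne (fun h => ?_) (fun h => ?_)
      · have := (congrArg Fin.val h).symm.trans h3
        simp at this
      · have h := congrArg Fin.val h
        rw [Fin.val_castAdd] at h
        rw [h] at h5
        simp at h5
  | right i =>
    rw [Subsingleton.elim i 0, Perm.mul_apply, prodPerm_natAdd]
    have : finRotate (N + 1 + 1) (Fin.natAdd (N + 1) 0) = 0 := by
      rw [hl]; exact finRotate_last
    rw [this, swap_apply_left]
    rfl

theorem numCycles_one_fin_one : numCycles (1 : Perm (Fin 1)) = 1 := by
  refine card_eq_one.2 ⟨0, ?_⟩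
  ext x
  simp [mem_cycleMins, Subsingleton.elim x 0]

theorem insertLast_mem_NC {π : Perm (Fin (N + 1))} :
    insertLast π ∈ NC (N + 1 + 1) ↔ π ∈ NC (N + 1) := by
  rw [mem_NC_iff_numCycles, mem_NC_iff_numCycles,
    numCycles_congr collapseLast collapseLast_surjective (sameCycle_insertLast π)]
  have : (insertLast π)⁻¹ * finRotate (N + 1 + 1) =
      prodPerm (π⁻¹ * finRotate (N + 1)) (1 : Perm (Fin 1)) := by
    rw [insertLast, mul_inv_rev, swap_inv, mul_assoc, swap_mul_finRotate, prodPerm_inv,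
      prodPerm_mul]
    rfl
  rw [this, numCycles_prodPerm, numCycles_one_fin_one]
  omega

theorem lastTo_zero_iff {π : Perm (Fin (N + 1 + 1))} :
    LastTo 0 π ↔ π (Fin.natAdd (N + 1) 0) = 0 := by
  constructor
  · intro h
    exact Fin.ext (h _ (by simp))
  · intro h l hl
    rw [show l = Fin.natAdd (N + 1) 0 from Fin.ext (by simpa using hl), h]
    rfl

theorem insertLast_injective : Function.Injective (insertLast (N := N)) := fun _ _ h =>
  (prodPerm_injective (mul_left_cancel h)).1

theorem exists_eq_insertLast {π : Perm (Fin (N + 1 + 1))} (h : π (Fin.natAdd (N + 1) 0) = 0) :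
    ∃ π', π = insertLast π' := by
  set τ : Perm (Fin (N + 1 + 1)) := swap 0 (Fin.natAdd (N + 1) 0) * π with hτ
  obtain ⟨π₁, π₂, h'⟩ := exists_eq_prodPerm (m := N + 1) (n := 1) (π := τ) (by
      intro i
      by_contra hge
      have h1 : τ (Fin.castAdd 1 i) = τ (Fin.natAdd (N + 1) 0) := by
        have e : τ (Fin.natAdd (N + 1) 0) = Fin.natAdd (N + 1) 0 := by
          rw [hτ, Perm.mul_apply, h, swap_apply_left]
        rw [e]
        apply Fin.ext
        have := (τ (Fin.castAdd 1 i)).2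
        simp only [Fin.val_natAdd, Fin.val_zero, add_zero]
        omega
      have h2 := congrArg Fin.val (τ.injective h1)
      simp at h2
      omega)
  refine ⟨π₁, ?_⟩
  rw [insertLast, ← Subsingleton.elim π₂ 1, ← h', hτ, swap_mul_self_mul]

/-- Contracting the last point into `0`. -/
theorem ncSumTo_zero (F : Finset ℕ → ℂ) (N : ℕ) : ncSumTo F (N + 2) 0 =
    ncSum (fun B => if 0 ∈ B then F (insert (N + 1) B) else F B) (N + 1) := by
  classical
  refine (sum_bij (fun π _ => insertLast π) ?_ (fun _ _ _ _ h => insertLast_injective h) ?_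
    fun π _ => (blockWeight_insertLast F π).symm).symm
  · intro π hπ
    exact mem_filter.2 ⟨insertLast_mem_NC.2 hπ, lastTo_zero_iff.2 (by simp [insertLast])⟩
  · intro π hπ
    rw [mem_filter, lastTo_zero_iff] at hπ
    obtain ⟨π', rfl⟩ := exists_eq_insertLast hπ.2
    exact ⟨π', insertLast_mem_NC.1 hπ.1, rfl⟩

theorem blockWeight_congr {F G : Finset ℕ → ℂ} {n : ℕ}
    (h : ∀ B ⊆ range n, B.Nonempty → F B = G B) (π : Perm (Fin n)) :
    blockWeight F π = blockWeight G π := by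
  refine prod_congr rfl fun x _ => h _ (fun k hk => ?_) ⟨x, mem_block.2 ⟨x, by simp, rfl⟩⟩
  obtain ⟨y, -, rfl⟩ := mem_block.1 hk
  exact mem_range.2 y.2

theorem ncSum_congr {F G : Finset ℕ → ℂ} {n : ℕ}
    (h : ∀ B ⊆ range n, B.Nonempty → F B = G B) : ncSum F n = ncSum G n :=
  sum_congr rfl fun π _ => blockWeight_congr h π

theorem ncSumTo_congr {F G : Finset ℕ → ℂ} {n t : ℕ}
    (h : ∀ B ⊆ range n, B.Nonempty → F B = G B) : ncSumTo F n t = ncSumTo G n t :=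
  sum_congr rfl fun π _ => blockWeight_congr h π

theorem ncSum_zero (F : Finset ℕ → ℂ) : ncSum F 0 = 1 := by
  have : NC 0 = {1} := by
    ext π
    simp only [mem_singleton, Subsingleton.elim π 1, iff_true]
    exact mem_NC.2 ⟨fun j => j.elim0, fun j => j.elim0⟩
  rw [ncSum, this, sum_singleton, blockWeight, Subsingleton.elim (cycleMins _) ∅, prod_empty]

theorem ncSumTo_one (F : Finset ℕ → ℂ) : ncSumTo F 1 0 = F {0} := by
  classical
  have h1 : (NC 1).filter (LastTo 0) = {1} := by
    ext π
    simp only [mem_singleton, Subsingleton.elim π 1, iff_true, mem_filter]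
    refine ⟨mem_NC.2 ⟨fun j _ => ?_, fun i j k l h => ?_⟩, fun l _ => by simp⟩
    · rw [mem_cycleMins]
      intro y _
      rw [Subsingleton.elim j y]
    · rw [Subsingleton.elim i j] at h
      exact absurd h (lt_irrefl _)
  have h2 : cycleMins (1 : Perm (Fin 1)) = {0} := by
    ext x
    simp [mem_cycleMins, Subsingleton.elim x 0]
  have h3 : block (1 : Perm (Fin 1)) 0 = {0} := by
    ext k
    simp [mem_block, eq_comm]
  rw [ncSumTo, h1, sum_singleton, blockWeight, h2, prod_singleton, h3]

end Contract

section Series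
open PowerSeries

/-! ### Generating series of sums over non-crossing partitions -/

theorem insert_card {B : Finset ℕ} {n : ℕ} (hB : B ⊆ range n) : #(insert n B) = #B + 1 :=
  card_insert_of_notMem fun h => by simpa using hB h

theorem zero_notMem_shift {t : ℕ} (ht : 0 < t) (B : Finset ℕ) : 0 ∉ shift t B := by
  rw [mem_shift]
  rintro ⟨b, -, h⟩
  omega

theorem coeff_mul_eq_sum_range {R : Type*} [CommRing R] (f g : PowerSeries R) (hg : coeff 0 g = 0)
    (n : ℕ) : coeff (n + 1) (f * g) = ∑ t ∈ range (n + 1), coeff t f * coeff (n + 1 - t) g := by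
  rw [coeff_mul, Nat.sum_antidiagonal_eq_sum_range_succ fun i j => coeff i f * coeff j g,
    Nat.succ_eq_add_one, sum_range_succ, Nat.sub_self, hg, mul_zero, add_zero]

variable (g b : ℕ → ℂ)

/-- The moment series with free cumulants `g`. -/
noncomputable def momentSeries : PowerSeries ℂ := mk fun n => ncSum (fun B => g #B) n

/-- The series of the non-crossing partitions whose last and first point are in the same block. -/
noncomputable def closedSeries : PowerSeries ℂ :=
  mk fun n => if n = 0 then 0 else ncSumTo (fun B => g #B) n 0

/-- The compositional series `z M(z)`. -/
noncomputable def zMoment : PowerSeries ℂ := X * momentSeries g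

/-- The weight in which the block of the first point is weighted by `b` and all others by `g`. -/
noncomputable def firstWeight (B : Finset ℕ) : ℂ := if 0 ∈ B then b #B else g #B

/-- The generating series of `firstWeight`. -/
noncomputable def firstSeries : PowerSeries ℂ :=
  mk fun n => if n = 0 then b 0 else ncSum (firstWeight g b) n

theorem momentSeries_eq : momentSeries g = 1 + momentSeries g * closedSeries g := by
  ext n
  obtain _ | n := n
  · simp [momentSeries, ncSum_zero, closedSeries]
  · rw [map_add, coeff_mul_eq_sum_range _ _ (by simp [closedSeries]), coeff_one, if_neg (by omega),
      zero_add, momentSeries, coeff_mk, ncSum_succ]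
    refine sum_congr rfl fun t ht => ?_
    rw [mem_range] at ht
    rw [coeff_mk, closedSeries, coeff_mk, if_neg (by omega)]
    simp only [card_shift]

theorem momentSeries_mul : momentSeries g * (1 - closedSeries g) = 1 := by
  rw [mul_sub, mul_one, sub_eq_iff_eq_add]
  exact momentSeries_eq g

theorem ncSumTo_firstWeight (n : ℕ) : ncSumTo (firstWeight g b) (n + 1) 0 =
    coeff n (firstSeries g fun r => b (r + 1)) := by
  rw [firstSeries, coeff_mk]
  obtain _ | n := n
  · simp [ncSumTo_one, firstWeight]
  · rw [if_neg (by omega), ncSumTo_zero]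
    refine ncSum_congr fun B hB _ => ?_
    by_cases h : 0 ∈ B
    · simp only [firstWeight, h, if_true, mem_insert, or_true, insert_card hB]
    · simp only [firstWeight, h, if_false]

@[simp] theorem coeff_zero_firstSeries : coeff 0 (firstSeries g b) = b 0 := by simp [firstSeries]

theorem coeff_succ_firstSeries (n : ℕ) :
    coeff (n + 1) (firstSeries g b) = ncSum (firstWeight g b) (n + 1) := by
  rw [firstSeries, coeff_mk, if_neg (by omega)]

theorem firstSeries_eq :
    firstSeries g b = C (b 0) + zMoment g * firstSeries g fun r => b (r + 1) := by
  have key : firstSeries g b - C (b 0) = X * (firstSeries g fun r => b (r + 1)) +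
      (firstSeries g b - C (b 0)) * closedSeries g := by
    ext n
    obtain _ | n := n
    · simp [firstSeries, closedSeries]
    · rw [map_add, coeff_mul_eq_sum_range _ (closedSeries g) (by simp [closedSeries]), map_sub, coeff_C,
        if_neg (by omega), sub_zero, coeff_succ_X_mul, coeff_succ_firstSeries,
        ncSum_succ, sum_range_succ', sum_range_succ']
      simp only [ncSum_zero, one_mul, Nat.sub_zero, map_sub]
      rw [coeff_zero_C, coeff_zero_firstSeries, sub_self, zero_mul, add_zero, add_comm]
      congr 1
      · rw [← ncSumTo_firstWeight]
        refine ncSumTo_congr fun B _ _ => ?_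
        rw [show shift 0 B = B by ext k; simp [mem_shift]]
      · refine sum_congr rfl fun t ht => ?_
        rw [mem_range] at ht
        rw [coeff_succ_firstSeries, coeff_C, if_neg (by omega), sub_zero, closedSeries,
          coeff_mk, if_neg (by omega)]
        congr 1
        refine ncSumTo_congr fun B _ _ => ?_
        rw [firstWeight, if_neg (zero_notMem_shift (by omega) B), card_shift]
  have h := momentSeries_mul g
  have : firstSeries g b - C (b 0) = zMoment g * firstSeries g fun r => b (r + 1) := by
    calc firstSeries g b - C (b 0)
        = (firstSeries g b - C (b 0)) * (momentSeries g * (1 - closedSeries g)) := by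
          rw [h, mul_one]
      _ = momentSeries g * ((firstSeries g b - C (b 0)) -
            (firstSeries g b - C (b 0)) * closedSeries g) := by ring
      _ = _ := by rw [sub_eq_iff_eq_add.2 key, zMoment]; ring
  rw [← this]
  ring

theorem constantCoeff_zMoment : constantCoeff (zMoment g) = 0 := by simp [zMoment]

theorem X_pow_dvd_pow {R : Type*} [CommRing R] {P : PowerSeries R} (hP : constantCoeff P = 0)
    (k : ℕ) : X ^ k ∣ P ^ k := pow_dvd_pow_of_dvd (X_dvd_iff.2 hP) k

theorem coeff_pow_eq_zero {R : Type*} [CommRing R] {P : PowerSeries R} (hP : constantCoeff P = 0)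
    {n k : ℕ} (h : n < k) : coeff n (P ^ k) = 0 := X_pow_dvd_iff.1 (X_pow_dvd_pow hP k) n h

theorem coeff_subst_eq_sum {R : Type*} [CommRing R] {P : PowerSeries R}
    (hP : constantCoeff P = 0) (f : PowerSeries R) {n K : ℕ} (hK : n < K) :
    coeff n (subst P f) = ∑ d ∈ range K, coeff d f * coeff n (P ^ d) := by
  rw [coeff_subst' (HasSubst.of_constantCoeff_zero' hP)]
  rw [finsum_eq_sum_of_support_subset (s := range K)]
  · simp
  · intro d hd
    rw [Function.mem_support] at hd
    by_contra hd'
    simp only [coe_range, Set.mem_Iio, not_lt] at hd'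
    exact hd (by rw [coeff_pow_eq_zero hP (by omega), smul_zero])

theorem firstSeries_eq_sum (K : ℕ) : firstSeries g b =
    ∑ r ∈ range K, C (b r) * zMoment g ^ r +
      zMoment g ^ K * firstSeries g fun r => b (r + K) := by
  induction K with
  | zero => simp
  | succ K ih =>
    rw [sum_range_succ, ih, firstSeries_eq g fun r => b (r + K), zero_add]
    simp only [add_assoc, add_comm 1 K, pow_succ]
    ring

theorem firstSeries_eq_subst : firstSeries g b = subst (zMoment g) (mk b) := by
  ext n
  rw [coeff_subst_eq_sum (constantCoeff_zMoment g) _ (Nat.lt_succ_self n),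
    firstSeries_eq_sum g b (n + 1), map_add, map_sum,
    X_pow_dvd_iff.1 ((X_pow_dvd_pow (constantCoeff_zMoment g) (n + 1)).mul_right _) n (by omega),
    add_zero]
  refine sum_congr rfl fun r _ => ?_
  rw [coeff_C_mul, coeff_mk]

theorem momentSeries_eq_firstSeries :
    momentSeries g = firstSeries g fun r => if r = 0 then 1 else g r := by
  ext n
  rw [momentSeries, firstSeries, coeff_mk, coeff_mk]
  obtain _ | n := n
  · simp [ncSum_zero]
  · rw [if_neg (by omega)]
    refine ncSum_congr fun B _ hB => ?_
    have : #B ≠ 0 := (card_pos.2 hB).ne'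
    simp [firstWeight, this]

end Series

section ThroughSeries
open PowerSeries

/-- The set `B` has points below `m` as well as points that are at least `m`. -/
def Through (m : ℕ) (B : Finset ℕ) : Prop := (∃ x ∈ B, x < m) ∧ ∃ x ∈ B, m ≤ x

variable (g κ : ℕ → ℂ) (t : ℂ)

open Classical in
/-- The weight in which the blocks that have points on both sides of `m` are weighted by `t κ`
and the others by `g`. -/
noncomputable def throughWeight (m : ℕ) (B : Finset ℕ) : ℂ :=
  if Through m B then t * κ #B else g #B

/-- `throughWeight`, except that the block of the first point is weighted by `t b`. -/
noncomputable def anchoredWeight (b : ℕ → ℂ) (m : ℕ) (B : Finset ℕ) : ℂ :=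
  if 0 ∈ B then t * b #B else throughWeight g κ t m B

/-- The generating series of `throughWeight` over the non-crossing partitions of `m + n` points
whose last and first point are in the same block. -/
noncomputable def closedThroughSeries : PowerSeries (PowerSeries ℂ) :=
  mk fun n => mk fun m => if m = 0 ∨ n = 0 then 0 else
    ncSumTo (throughWeight g κ t m) (m + n) 0

/-- The generating series of `anchoredWeight`. -/
noncomputable def anchoredSeries (b : ℕ → ℂ) : PowerSeries (PowerSeries ℂ) :=
  mk fun n => mk fun m => if m = 0 then 0 else ncSum (anchoredWeight g κ t b m) (m + n)

variable {g κ t}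

theorem Through.insert_iff {m n : ℕ} {B : Finset ℕ} (h0 : 0 ∈ B) :
    Through (m + 1) (insert (m + 1 + n) B) :=
  ⟨⟨0, mem_insert_of_mem h0, by omega⟩, ⟨m + 1 + n, mem_insert_self _ _, by omega⟩⟩

theorem ncSumTo_anchoredWeight (b : ℕ → ℂ) (m n : ℕ) :
    ncSumTo (anchoredWeight g κ t b (m + 1)) (m + 1 + (n + 1)) 0 =
      ncSum (anchoredWeight g κ t (fun r => b (r + 1)) (m + 1)) (m + 1 + n) := by
  have h := ncSumTo_zero (anchoredWeight g κ t b (m + 1)) (m + n)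
  rw [show m + n + 2 = m + 1 + (n + 1) by omega, show m + n + 1 = m + 1 + n by omega] at h
  rw [h]
  refine ncSum_congr fun B hB _ => ?_
  by_cases h0 : 0 ∈ B
  · simp only [anchoredWeight, h0, if_true, mem_insert, or_true, insert_card hB]
  · simp only [anchoredWeight, h0, if_false]

theorem ncSumTo_throughWeight (m n : ℕ) :
    ncSumTo (throughWeight g κ t (m + 1)) (m + 1 + (n + 1)) 0 =
      ncSum (anchoredWeight g κ t (fun r => κ (r + 1)) (m + 1)) (m + 1 + n) := by
  have h := ncSumTo_zero (throughWeight g κ t (m + 1)) (m + n)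
  rw [show m + n + 2 = m + 1 + (n + 1) by omega, show m + n + 1 = m + 1 + n by omega] at h
  rw [h]
  refine ncSum_congr fun B hB _ => ?_
  by_cases h0 : 0 ∈ B
  · simp only [anchoredWeight, h0, if_true]
    rw [throughWeight, if_pos (Through.insert_iff h0), insert_card hB]
  · simp only [anchoredWeight, h0, if_false]

theorem closedThroughSeries_eq : closedThroughSeries g κ t =
    X * anchoredSeries g κ t fun r => κ (r + 1) := by
  ext n m
  obtain _ | n := n
  · simp [closedThroughSeries]
  · rw [coeff_succ_X_mul, closedThroughSeries, anchoredSeries, coeff_mk, coeff_mk, coeff_mk,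
      coeff_mk]
    obtain _ | m := m
    · simp
    · rw [if_neg (by omega), if_neg (by omega), ncSumTo_throughWeight]

theorem coeff_zero_coeff_closedThroughSeries (n : ℕ) :
    coeff 0 (coeff n (closedThroughSeries g κ t)) = 0 := by simp [closedThroughSeries]

theorem coeff_zero_coeff_anchoredSeries (b : ℕ → ℂ) (n : ℕ) :
    coeff 0 (coeff n (anchoredSeries g κ t b)) = 0 := by simp [anchoredSeries]

theorem coeff_succ_coeff_anchoredSeries (b : ℕ → ℂ) (m n : ℕ) :
    coeff (m + 1) (coeff n (anchoredSeries g κ t b)) =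
      ncSum (anchoredWeight g κ t b (m + 1)) (m + 1 + n) := by
  rw [anchoredSeries, coeff_mk, coeff_mk, if_neg (by omega)]

theorem not_through_of_subset {m : ℕ} {B : Finset ℕ} (hB : B ⊆ range m) : ¬ Through m B := by
  rintro ⟨-, x, hx, hm⟩
  have := mem_range.1 (hB hx)
  omega

theorem through_shift_iff {m s : ℕ} (hs : s ≤ m) (B : Finset ℕ) :
    Through m (shift s B) ↔ Through (m - s) B := by
  simp only [Through, mem_shift]
  constructor
  · rintro ⟨⟨_, ⟨b, hb, rfl⟩, h⟩, ⟨_, ⟨c, hc, rfl⟩, h'⟩⟩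
    exact ⟨⟨b, hb, by omega⟩, ⟨c, hc, by omega⟩⟩
  · rintro ⟨⟨b, hb, h⟩, ⟨c, hc, h'⟩⟩
    exact ⟨⟨_, ⟨b, hb, rfl⟩, by omega⟩, ⟨_, ⟨c, hc, rfl⟩, by omega⟩⟩

theorem not_through_shift {m s : ℕ} (hs : m ≤ s) (B : Finset ℕ) : ¬ Through m (shift s B) := by
  rintro ⟨⟨x, hx, hm⟩, -⟩
  obtain ⟨b, -, rfl⟩ := mem_shift.1 hx
  omega

theorem ncSum_anchoredWeight_of_le (b : ℕ → ℂ) {m s : ℕ} (hs : s ≤ m) :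
    ncSum (anchoredWeight g κ t b m) s = ncSum (firstWeight g fun r => t * b r) s := by
  refine ncSum_congr fun B hB _ => ?_
  rw [anchoredWeight, firstWeight, throughWeight, if_neg (not_through_of_subset fun x hx => ?_)]
  exact mem_range.2 ((mem_range.1 (hB hx)).trans_le hs)

theorem anchoredSeries_eq (b : ℕ → ℂ) : anchoredSeries g κ t b =
    C (firstSeries g (fun r => t * b r) - C (t * b 0)) + X * (anchoredSeries g κ t fun r => b (r + 1))
      + C (firstSeries g (fun r => t * b r) - C (t * b 0)) * closedThroughSeries g κ t
      + anchoredSeries g κ t b * PowerSeries.map C (closedSeries g) := by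
  ext n m
  rw [map_add, map_add, map_add, map_add, map_add, map_add]
  obtain _ | m := m
  · have h1 : coeff 0 (coeff n (X * anchoredSeries g κ t fun r => b (r + 1))) = 0 := by
      obtain _ | n := n
      · simp
      · rw [coeff_succ_X_mul, coeff_zero_coeff_anchoredSeries]
    have h2 : coeff 0 (coeff n (anchoredSeries g κ t b * PowerSeries.map C (closedSeries g))) = 0 := by
      rw [coeff_mul, map_sum]
      refine sum_eq_zero fun p _ => ?_
      rw [coeff_mul, Nat.antidiagonal_zero, sum_singleton, coeff_zero_coeff_anchoredSeries, zero_mul]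
    have h3 : coeff 0 (coeff n (C (firstSeries g (fun r => t * b r) - C (t * b 0)))) = 0 := by
      rw [coeff_C]
      split_ifs
      · simp [-coeff_zero_eq_constantCoeff, coeff_zero_C]
      · simp
    have h4 : coeff 0 (coeff n (C (firstSeries g (fun r => t * b r) - C (t * b 0)) *
        closedThroughSeries g κ t)) = 0 := by
      rw [coeff_C_mul, coeff_mul, Nat.antidiagonal_zero, sum_singleton,
        coeff_zero_coeff_closedThroughSeries, mul_zero]
    rw [h1, h2, h3, h4, coeff_zero_coeff_anchoredSeries]
    simp
  · rw [coeff_succ_coeff_anchoredSeries]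
    obtain _ | n := n
    · have h2 : coeff 0 (anchoredSeries g κ t b * PowerSeries.map C (closedSeries g)) = 0 := by
        rw [coeff_mul, Nat.antidiagonal_zero, sum_singleton, coeff_map]
        simp [closedSeries, -coeff_zero_eq_constantCoeff]
      have h3 : coeff 0 (X * anchoredSeries g κ t fun r => b (r + 1)) = 0 := by simp
      have h4 : coeff 0 (closedThroughSeries g κ t) = 0 := by
        ext m
        simp [closedThroughSeries, -coeff_zero_eq_constantCoeff]
      rw [h2, h3, coeff_C_mul, h4, mul_zero, coeff_zero_C]
      simp only [map_zero, add_zero, map_sub, coeff_succ_C, sub_zero, coeff_succ_firstSeries]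
      exact ncSum_anchoredWeight_of_le b le_rfl
    · rw [coeff_succ_C, coeff_succ_X_mul, coeff_succ_coeff_anchoredSeries, coeff_C_mul,
        coeff_mul_eq_sum_range _ _ (coeff_zero_coeff_closedThroughSeries _),
        coeff_mul_eq_sum_range _ (PowerSeries.map C (closedSeries g)) (by simp [closedSeries]),
        show m + 1 + (n + 1) = (m + 1 + n) + 1 from rfl, ncSum_succ,
        show m + 1 + n + 1 = m + 1 + (n + 1) from rfl, sum_range_add, sum_range_succ',
        sum_range_succ' _ m, map_sum, ncSum_zero, one_mul]
      have h0 : coeff 0 (firstSeries g (fun r => t * b r) - C (t * b 0)) = 0 := by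
        rw [map_sub, coeff_zero_firstSeries, coeff_zero_C, sub_self]
      rw [h0, zero_mul, add_zero, map_zero, zero_add]
      congr 1
      · rw [add_comm]
        congr 1
        · rw [← ncSumTo_anchoredWeight]
          refine ncSumTo_congr fun B _ _ => ?_
          rw [show shift 0 B = B by ext k; simp [mem_shift]]
        · refine sum_congr rfl fun s hs => ?_
          rw [mem_range] at hs
          rw [map_sub, coeff_succ_C, sub_zero, coeff_succ_firstSeries,
            ncSum_anchoredWeight_of_le b (by omega), closedThroughSeries, coeff_mk, coeff_mk,
            if_neg (by omega)]
          congr 1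
          rw [show m + 1 + (n + 1) - (s + 1) = m + 1 - (s + 1) + (n + 1) by omega]
          refine ncSumTo_congr fun B _ _ => ?_
          rw [anchoredWeight, if_neg (zero_notMem_shift (by omega) B), throughWeight,
            throughWeight, card_shift]
          have hT := through_shift_iff (show s + 1 ≤ m + 1 by omega) B
          by_cases h : Through (m + 1 - (s + 1)) B
          · rw [if_pos h, if_pos (hT.2 h)]
          · rw [if_neg h, if_neg (mt hT.1 h)]
      · refine sum_congr rfl fun s hs => ?_
        rw [mem_range] at hs
        rw [coeff_map, coeff_mul_C, coeff_succ_coeff_anchoredSeries, closedSeries, coeff_mk,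
          if_neg (by omega)]
        congr 1
        rw [show m + 1 + (n + 1) - (m + 1 + s) = n + 1 - s by omega]
        refine ncSumTo_congr fun B _ _ => ?_
        rw [anchoredWeight, if_neg (zero_notMem_shift (by omega) B), throughWeight,
          if_neg (not_through_shift (by omega) B), card_shift]

theorem firstSeries_const_mul (b : ℕ → ℂ) :
    firstSeries g (fun r => t * b r) = C t * firstSeries g b := by
  rw [firstSeries_eq_subst, firstSeries_eq_subst]
  ext n
  rw [coeff_C_mul, coeff_subst_eq_sum (constantCoeff_zMoment g) _ (Nat.lt_succ_self n),
    coeff_subst_eq_sum (constantCoeff_zMoment g) _ (Nat.lt_succ_self n), mul_sum]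
  simp only [coeff_mk, mul_assoc]

theorem X_mul_anchoredSeries (b : ℕ → ℂ) : X * anchoredSeries g κ t b =
    PowerSeries.map C (zMoment g) * (C (C t * (firstSeries g b - C (b 0))) *
      (1 + closedThroughSeries g κ t) + X * anchoredSeries g κ t fun r => b (r + 1)) := by
  have h := anchoredSeries_eq (g := g) (κ := κ) (t := t) b
  have hN : firstSeries g (fun r => t * b r) - C (t * b 0) =
      C t * (firstSeries g b - C (b 0)) := by
    rw [firstSeries_const_mul, map_mul]; ring
  rw [hN] at h
  have hM : PowerSeries.map (C : ℂ →+* PowerSeries ℂ) (momentSeries g) *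
      (1 - PowerSeries.map C (closedSeries g)) = 1 := by
    rw [← map_one (PowerSeries.map (C : ℂ →+* PowerSeries ℂ)), ← map_sub, ← map_mul,
      momentSeries_mul]
  have h' : anchoredSeries g κ t b * (1 - PowerSeries.map C (closedSeries g)) =
      C (C t * (firstSeries g b - C (b 0))) * (1 + closedThroughSeries g κ t) +
        X * anchoredSeries g κ t fun r => b (r + 1) := by
    rw [mul_sub, mul_one, sub_eq_iff_eq_add]
    conv_lhs => rw [h]
    ring
  rw [← h', zMoment, map_mul, PowerSeries.map_X]
  calc _ = X * anchoredSeries g κ t b * (PowerSeries.map C (momentSeries g) *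
        (1 - PowerSeries.map C (closedSeries g))) := by rw [hM, mul_one]
    _ = _ := by ring

theorem X_mul_anchoredSeries_eq_sum (b : ℕ → ℂ) (K : ℕ) : X * anchoredSeries g κ t b =
    C (C t) * (1 + closedThroughSeries g κ t) * ∑ j ∈ range K,
        C (firstSeries g (fun r => b (r + j)) - C (b j)) * PowerSeries.map C (zMoment g) ^ (j + 1) +
      PowerSeries.map C (zMoment g) ^ K * (X * anchoredSeries g κ t fun r => b (r + K)) := by
  induction K with
  | zero => simp
  | succ K ih =>
    rw [sum_range_succ, ih, X_mul_anchoredSeries fun r => b (r + K), zero_add]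
    simp only [add_assoc, add_comm 1 K, pow_succ, map_mul]
    ring

end ThroughSeries

section DoubleSubst
open PowerSeries

/-- The kernel `∑_{i,j ≥ 1} κ_{i+j} X^i Y^j`. -/
noncomputable def kernelSeries (κ : ℕ → ℂ) : PowerSeries (PowerSeries ℂ) :=
  mk fun j => mk fun i => if i = 0 ∨ j = 0 then 0 else κ (i + j)

theorem constantCoeff_map_C {Q : PowerSeries ℂ} (hQ : constantCoeff Q = 0) :
    constantCoeff (PowerSeries.map (C : ℂ →+* PowerSeries ℂ) Q) = 0 := by
  rw [← coeff_zero_eq_constantCoeff_apply, coeff_map, coeff_zero_eq_constantCoeff_apply, hQ,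
    map_zero]

theorem subst_C_eq {R : Type*} [CommRing R] {P : PowerSeries R} (hP : constantCoeff P = 0) (r : R) :
    subst P (C r : PowerSeries R) = C r := by
  ext n
  rw [coeff_subst_eq_sum hP _ (Nat.lt_succ_self n), sum_range_succ']
  simp [coeff_C, coeff_one]

/-- Substitution of a series without constant term, as a ring homomorphism. -/
noncomputable def substHom {R : Type*} [CommRing R] {P : PowerSeries R}
    (hP : constantCoeff P = 0) : PowerSeries R →+* PowerSeries R where
  toFun := subst P
  map_one' := by rw [← map_one (C (R := R)), subst_C_eq hP]
  map_zero' := by rw [← map_zero (C (R := R)), subst_C_eq hP]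
  map_mul' := subst_mul (HasSubst.of_constantCoeff_zero' hP)
  map_add' := subst_add (HasSubst.of_constantCoeff_zero' hP)

theorem substHom_apply {R : Type*} [CommRing R] {P : PowerSeries R}
    (hP : constantCoeff P = 0) (f : PowerSeries R) : substHom hP f = subst P f := rfl

/-- Substitution of `P` for the inner and `Q` for the outer variable. -/
noncomputable def subst₂ {P Q : PowerSeries ℂ} (hP : constantCoeff P = 0)
    (hQ : constantCoeff Q = 0) : PowerSeries (PowerSeries ℂ) →+* PowerSeries (PowerSeries ℂ) :=
  (substHom (constantCoeff_map_C hQ)).comp (PowerSeries.map (substHom hP))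

theorem subst₂_apply {P Q : PowerSeries ℂ} (hP : constantCoeff P = 0)
    (hQ : constantCoeff Q = 0) (f : PowerSeries (PowerSeries ℂ)) : subst₂ hP hQ f =
      subst (PowerSeries.map (C : ℂ →+* PowerSeries ℂ) Q) (PowerSeries.map (substHom hP) f) := rfl

theorem coeff_subst₂' {P Q : PowerSeries ℂ} (hP : constantCoeff P = 0)
    (hQ : constantCoeff Q = 0) (f : PowerSeries (PowerSeries ℂ)) {n K : ℕ} (h : n < K) :
    coeff n (subst₂ hP hQ f) =
      ∑ j ∈ range K, subst P (coeff j f) * C (coeff n (Q ^ j)) := by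
  rw [subst₂_apply, coeff_subst_eq_sum (constantCoeff_map_C hQ) _ h]
  refine sum_congr rfl fun j _ => ?_
  rw [coeff_map, ← map_pow, coeff_map, substHom_apply]

theorem coeff_subst₂ {P Q : PowerSeries ℂ} (hP : constantCoeff P = 0)
    (hQ : constantCoeff Q = 0) (f : PowerSeries (PowerSeries ℂ)) {m n I J : ℕ} (hI : m < I)
    (hJ : n < J) : coeff m (coeff n (subst₂ hP hQ f)) =
      ∑ j ∈ range J, ∑ i ∈ range I, coeff i (coeff j f) * coeff m (P ^ i) * coeff n (Q ^ j) := by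
  rw [coeff_subst₂' hP hQ f hJ, map_sum]
  refine sum_congr rfl fun j _ => ?_
  rw [coeff_mul_C, coeff_subst_eq_sum hP _ hI, sum_mul]

theorem subst₂_C {P Q : PowerSeries ℂ} (hP : constantCoeff P = 0)
    (hQ : constantCoeff Q = 0) (f : PowerSeries ℂ) : subst₂ hP hQ (C f) = C (subst P f) := by
  rw [subst₂_apply, PowerSeries.map_C, subst_C_eq (constantCoeff_map_C hQ), substHom_apply]

theorem subst₂_map_C {P Q : PowerSeries ℂ} (hP : constantCoeff P = 0)
    (hQ : constantCoeff Q = 0) (f : PowerSeries ℂ) :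
    subst₂ hP hQ (PowerSeries.map C f) = PowerSeries.map C (subst Q f) := by
  ext n m
  rw [coeff_subst₂ hP hQ _ (Nat.lt_succ_self m) (Nat.lt_succ_self n), coeff_map,
    coeff_subst_eq_sum hQ _ (Nat.lt_succ_self n), coeff_C]
  simp only [coeff_map]
  obtain _ | m := m
  · simp [coeff_zero_C, -coeff_zero_eq_constantCoeff]
  · rw [if_neg (by omega)]
    refine sum_eq_zero fun j _ => sum_eq_zero fun i _ => ?_
    obtain _ | i := i
    · simp [coeff_one]
    · simp

theorem X_pow_dvd_subst_sub {R : Type*} [CommRing R] {P : PowerSeries R}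
    (hP : constantCoeff P = 0) (f : PowerSeries R) (K : ℕ) :
    X ^ K ∣ subst P f - ∑ d ∈ range K, C (coeff d f) * P ^ d := by
  rw [X_pow_dvd_iff]
  intro n hn
  rw [map_sub, coeff_subst_eq_sum hP f hn, map_sum]
  simp [coeff_C_mul]

theorem eq_of_forall_X_pow_dvd_sub {R : Type*} [CommRing R] {f g : PowerSeries R}
    (h : ∀ K, X ^ K ∣ f - g) : f = g := by
  ext n
  have := X_pow_dvd_iff.1 (h (n + 1)) n (by omega)
  rwa [map_sub, sub_eq_zero] at this

variable (g κ : ℕ → ℂ) (t : ℂ)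

/-- The kernel in the compositional series of the moments. -/
noncomputable def momentKernel : PowerSeries (PowerSeries ℂ) :=
  subst₂ (constantCoeff_zMoment g) (constantCoeff_zMoment g) (kernelSeries κ)

theorem X_dvd_momentKernel : X ∣ momentKernel g κ := by
  rw [X_dvd_iff, ← coeff_zero_eq_constantCoeff_apply, momentKernel,
    coeff_subst₂' _ _ _ (Nat.lt_succ_self 0)]
  have h0 : coeff 0 (kernelSeries κ) = 0 := by
    ext i
    simp [kernelSeries, -coeff_zero_eq_constantCoeff]
  rw [sum_range_one, h0, ← substHom_apply (constantCoeff_zMoment g), map_zero, zero_mul]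

theorem closedThroughSeries_eq_momentKernel : closedThroughSeries g κ t =
    C (C t) * (1 + closedThroughSeries g κ t) * momentKernel g κ := by
  have hu := constantCoeff_zMoment g
  have hv := constantCoeff_map_C hu
  refine eq_of_forall_X_pow_dvd_sub fun K => ?_
  have h1 := X_mul_anchoredSeries_eq_sum (g := g) (κ := κ) (t := t) (fun r => κ (r + 1)) K
  rw [← closedThroughSeries_eq] at h1
  have h2 := X_pow_dvd_subst_sub hv (PowerSeries.map
    (substHom hu) (kernelSeries κ)) (K + 1)
  rw [← subst₂_apply hu hu, ← momentKernel, sum_range_succ'] at h2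
  have h3 : ∀ j, coeff (j + 1) (PowerSeries.map
      (substHom hu) (kernelSeries κ)) =
      firstSeries g (fun r => κ (r + j + 1)) - C (κ (j + 1)) := by
    intro j
    rw [firstSeries_eq_subst, coeff_map]
    have : mk (fun r => κ (r + j + 1)) = coeff (j + 1) (kernelSeries κ) + C (κ (j + 1)) := by
      ext i
      obtain _ | i := i
      · simp [kernelSeries]
      · simp [kernelSeries, add_assoc]
    rw [this, ← substHom_apply hu, map_add, substHom_apply hu (C _), subst_C_eq hu,
      add_sub_cancel_right]
  have h4 : coeff 0 (PowerSeries.map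
      (substHom hu) (kernelSeries κ)) =
      0 := by
    have : coeff 0 (kernelSeries κ) = 0 := by
      ext i
      simp [kernelSeries, -coeff_zero_eq_constantCoeff]
    rw [coeff_map, this, map_zero]
  simp only [h3, h4, map_zero, zero_mul, add_zero] at h2
  set E := closedThroughSeries g κ t
  obtain ⟨r, hr⟩ := (pow_dvd_pow X (Nat.le_succ K)).trans h2
  obtain ⟨s, hs⟩ := X_pow_dvd_pow hv K
  refine ⟨s * (X * anchoredSeries g κ t fun r => κ (r + K + 1)) - C (C t) * (1 + E) * r, ?_⟩
  rw [sub_eq_iff_eq_add] at hr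
  rw [hr]
  rw [hs] at h1
  generalize ∑ j ∈ range K, C ((firstSeries g fun r => κ (r + j + 1)) - C (κ (j + 1))) *
    PowerSeries.map C (zMoment g) ^ (j + 1) = σ at *
  generalize anchoredSeries g κ t (fun r => κ (r + K + 1)) = τ at *
  linear_combination h1

theorem closedThroughSeries_eq_sum (K : ℕ) : closedThroughSeries g κ t =
    ∑ k ∈ range K, C (C t) ^ (k + 1) * momentKernel g κ ^ (k + 1) +
      C (C t) ^ K * momentKernel g κ ^ K * closedThroughSeries g κ t := by
  induction K with
  | zero => simp
  | succ K ih =>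
    conv_lhs => rw [ih, closedThroughSeries_eq_momentKernel g κ t]
    rw [sum_range_succ]
    ring

theorem coeff_closedThroughSeries {n K : ℕ} (m : ℕ) (hK : n < K) :
    coeff m (coeff n (closedThroughSeries g κ t)) =
      ∑ k ∈ range K, t ^ (k + 1) * coeff m (coeff n (momentKernel g κ ^ (k + 1))) := by
  rw [closedThroughSeries_eq_sum g κ t K, map_add,
    X_pow_dvd_iff.1 ((pow_dvd_pow_of_dvd (X_dvd_momentKernel g κ) K).mul_left (C (C t) ^ K)
      |>.mul_right _) n hK, add_zero, map_sum, map_sum]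
  refine sum_congr rfl fun k _ => ?_
  rw [← map_pow, ← map_pow, coeff_C_mul, coeff_C_mul]

open Classical in
/-- The number of cycles of `π` with points on both sides of `m`. -/
noncomputable def throughCount (m : ℕ) {n : ℕ} (π : Perm (Fin n)) : ℕ :=
  #((cycleMins π).filter fun x => Through m (block π x))

theorem blockWeight_throughWeight (m : ℕ) {n : ℕ} (π : Perm (Fin n)) :
    blockWeight (throughWeight g κ t m) π =
      t ^ throughCount m π * blockWeight (throughWeight g κ 1 m) π := by
  classical
  rw [blockWeight, blockWeight, throughCount, ← prod_const, prod_filter, ← prod_mul_distrib]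
  refine prod_congr rfl fun x _ => ?_
  by_cases h : Through m (block π x) <;> simp [throughWeight, h]

/-- The truncated series `∑_{1 ≤ k ≤ K} h^k / k` of `- log (1 - h)`. -/
noncomputable def logTrunc (K : ℕ) (h : PowerSeries (PowerSeries ℂ)) :
    PowerSeries (PowerSeries ℂ) :=
  ∑ k ∈ range K, C (C (1 / ((k : ℂ) + 1))) * h ^ (k + 1)

open Classical in
theorem sum_NC_div_throughCount {m n K : ℕ} (hm : 1 ≤ m) (hn : 1 ≤ n) (hK : n < K) :
    ∑ π ∈ (NC (m + n)).filter (LastTo 0),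
        blockWeight (throughWeight g κ 1 m) π / (throughCount m π : ℂ) =
      coeff m (coeff n (logTrunc K (momentKernel g κ))) := by
  set s := (NC (m + n)).filter (LastTo 0)
  set p : Polynomial ℂ := ∑ π ∈ s, Polynomial.monomial (throughCount m π)
    (blockWeight (throughWeight g κ 1 m) π) with hp
  set q : Polynomial ℂ := ∑ k ∈ range K, Polynomial.monomial (k + 1)
    (coeff m (coeff n (momentKernel g κ ^ (k + 1)))) with hq
  have hpq : p = q := by
    refine Polynomial.funext fun t => ?_
    have h := coeff_closedThroughSeries g κ t m hK
    rw [closedThroughSeries, coeff_mk, coeff_mk, if_neg (by omega), ncSumTo] at h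
    rw [hp, hq, Polynomial.eval_finsetSum, Polynomial.eval_finsetSum]
    simp only [Polynomial.eval_monomial]
    calc _ = _ := sum_congr rfl fun π _ => by
          rw [blockWeight_throughWeight g κ t m π, mul_comm]
      _ = _ := h
      _ = _ := sum_congr rfl fun k _ => mul_comm _ _
  set D := K + 1 + s.sup (throughCount m) with hD
  have hL : ∑ d ∈ range D, p.coeff d / (d : ℂ) = ∑ d ∈ range D, q.coeff d / (d : ℂ) := by rw [hpq]
  have h1 : ∀ (j : ℕ) (a : ℂ), j < D →
      ∑ d ∈ range D, (Polynomial.monomial j a).coeff d / (d : ℂ) = a / (j : ℂ) := by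
    intro j a hj
    rw [sum_eq_single j]
    · simp
    · intro d _ hd
      rw [Polynomial.coeff_monomial, if_neg hd.symm, zero_div]
    · intro h
      exact absurd (mem_range.2 hj) h
  simp only [hp, hq, Polynomial.finsetSum_coeff, sum_div] at hL
  rw [sum_comm, sum_comm (s := range D)] at hL
  rw [logTrunc, map_sum, map_sum]
  convert hL using 1
  · refine sum_congr rfl fun π hπ => (h1 _ _ ?_).symm
    have := le_sup (f := throughCount m) hπ
    omega
  · refine sum_congr rfl fun k hk => ?_
    rw [h1 _ _ (by have := mem_range.1 hk; omega), coeff_C_mul, coeff_C_mul]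
    push_cast
    ring

end DoubleSubst

/-! ### Annular non-crossing permutations and non-crossing partitions -/

section Annular

theorem numCycles_gamma (m n : ℕ) : numCycles (gammaPerm (m + 1) (n + 1)) = 2 := by
  rw [numCycles, cycleMins_gamma, card_pair]
  intro h
  have := congrArg Fin.val h
  simp at this

theorem swap_mul_gammaPerm (m n : ℕ) :
    swap (Fin.castAdd (n + 1) 0) (Fin.natAdd (m + 1) 0) * gammaPerm (m + 1) (n + 1) =
      finRotate (m + 1 + n + 1) := by
  have key : ∀ x : Fin (m + 1 + (n + 1)), ((swap (Fin.castAdd (n + 1) 0) (Fin.natAdd (m + 1) 0) *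
      gammaPerm (m + 1) (n + 1)) x : ℕ) = if (x : ℕ) = m + 1 + n then 0 else (x : ℕ) + 1 := by
    intro x
    rw [Perm.mul_apply, gammaPerm]
    induction x using Fin.addCases with
    | left i =>
      have hi := i.2
      rw [prodPerm_castAdd, if_neg (by simp; omega)]
      by_cases h : i = Fin.last m
      · subst h
        rw [finRotate_last, swap_apply_left]
        simp
      · have h1 := finRotate_apply_of_ne_last h
        rw [swap_apply_of_ne_of_ne]
        · simpa using h1
        · rw [Ne, Fin.castAdd_inj]
          intro h2
          rw [h2] at h1
          simp at h1
        · intro h2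
          have := congrArg Fin.val h2
          rw [Fin.val_castAdd, Fin.val_natAdd] at this
          have := (finRotate (m + 1) i).2
          simp at *
          omega
    | right i =>
      rw [prodPerm_natAdd]
      by_cases h : i = Fin.last n
      · subst h
        rw [finRotate_last, swap_apply_right, if_pos (by simp)]
        simp
      · have h1 := finRotate_apply_of_ne_last h
        have h3 : (i : ℕ) ≠ n := fun e => h (Fin.ext e)
        rw [swap_apply_of_ne_of_ne, if_neg (by simp; omega)]
        · rw [Fin.val_natAdd, Fin.val_natAdd, h1]
          omega
        · intro h2
          have := congrArg Fin.val h2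
          simp at this
        · rw [Ne, Fin.natAdd_inj]
          intro h2
          rw [h2] at h1
          simp at h1
  ext x
  rw [key]
  by_cases hx : x = Fin.last (m + 1 + n)
  · subst hx
    rw [finRotate_last]
    simp
  · have h := finRotate_apply_of_ne_last hx
    have hx' : (x : ℕ) ≠ m + 1 + n := fun e => hx (Fin.ext e)
    rw [if_neg hx']
    exact h.symm

theorem mem_SNC {m n : ℕ} {π : Perm (Fin (m + n))} : π ∈ SNC m n ↔
    (∃ x y, OnFirst m x ∧ ¬ OnFirst m y ∧ π.SameCycle x y) ∧
      permLength (gammaPerm m n) + 2 = permLength π + permLength (π⁻¹ * gammaPerm m n) := by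
  simp [SNC]

theorem mem_SNC_iff {m n : ℕ} {π : Perm (Fin (m + 1 + (n + 1)))} : π ∈ SNC (m + 1) (n + 1) ↔
    (∃ x y, OnFirst (m + 1) x ∧ ¬ OnFirst (m + 1) y ∧ π.SameCycle x y) ∧
      numCycles π + numCycles (π⁻¹ * gammaPerm (m + 1) (n + 1)) = m + n + 2 := by
  rw [mem_SNC, permLength, permLength, permLength, numCycles_gamma, Fintype.card_fin]
  refine and_congr_right fun _ => ?_
  have h1 := numCycles_le π
  have h2 := numCycles_le (π⁻¹ * gammaPerm (m + 1) (n + 1))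
  rw [Fintype.card_fin] at h1 h2
  omega

theorem mem_SNC_iff_mem_NC {m n : ℕ} {π : Perm (Fin (m + 1 + (n + 1)))}
    (h : π (Fin.natAdd (m + 1) (Fin.last n)) = Fin.castAdd (n + 1) 0) :
    π ∈ SNC (m + 1) (n + 1) ↔ π ∈ NC (m + 1 + (n + 1)) := by
  set l : Fin (m + 1 + (n + 1)) := Fin.natAdd (m + 1) (Fin.last n) with hl
  set c : Fin (m + 1 + (n + 1)) := Fin.castAdd (n + 1) 0 with hc
  set d : Fin (m + 1 + (n + 1)) := Fin.natAdd (m + 1) 0 with hd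
  have hcd : c ≠ d := fun h => by
    have := congrArg Fin.val h
    simp [hc, hd] at this
  have hσl : (π⁻¹ * finRotate (m + 1 + n + 1)) l = l := by
    have : finRotate (m + 1 + n + 1) l = c := by
      have : l = Fin.last (m + 1 + n) := Fin.ext (by simp [hl])
      rw [this]; exact finRotate_last
    rw [Perm.mul_apply, this, ← h, Perm.inv_def, symm_apply_apply]
  have hσ : π⁻¹ * gammaPerm (m + 1) (n + 1) =
      swap (π⁻¹ d) l * (π⁻¹ * finRotate (m + 1 + n + 1)) := by
    have hc' : π⁻¹ c = l := by rw [← h, Perm.inv_def, symm_apply_apply]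
    rw [← swap_mul_gammaPerm m n, ← hc', swap_comm, ← mul_assoc π⁻¹, mul_swap_eq_swap_mul,
      mul_assoc, swap_mul_self_mul]
  have hb : π⁻¹ d ≠ l := fun e => hcd (by rw [← h, ← e, Perm.inv_def, apply_symm_apply])
  have h1 := numCycles_swap_mul hσl hb fun x => by
    rw [Fin.le_def]; simp [hl]; omega
  rw [← hσ] at h1
  rw [mem_SNC_iff]
  refine Iff.trans ?_ (mem_NC_iff_numCycles (N := m + 1 + n) (π := π)).symm
  constructor
  · rintro ⟨-, h2⟩
    omega
  · intro h2
    refine ⟨⟨c, l, by simp [OnFirst, hc], by simp [OnFirst, hl]; omega, ?_⟩, ?_⟩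
    · rw [← h]; simp
    · omega

variable {m n : ℕ}

/-- The rotation of the two circles. -/
def rot (m n a b : ℕ) : Perm (Fin (m + n)) := prodPerm (finRotate m ^ a) (finRotate n ^ b)

theorem onFirst_castAdd (i : Fin m) : OnFirst m (Fin.castAdd n i) := i.2

theorem not_onFirst_natAdd (i : Fin n) : ¬ OnFirst m (Fin.natAdd m i) := by
  simp [OnFirst]

theorem onFirst_rot (a b : ℕ) (x : Fin (m + n)) : OnFirst m (rot m n a b x) ↔ OnFirst m x := by
  induction x using Fin.addCases with
  | left i =>
    rw [rot, prodPerm_castAdd]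
    exact iff_of_true (onFirst_castAdd _) (onFirst_castAdd _)
  | right i =>
    rw [rot, prodPerm_natAdd]
    exact iff_of_false (not_onFirst_natAdd _) (not_onFirst_natAdd _)

/-- The conjugate of `π` by a rotation of the two circles. -/
def conjRot (a b : ℕ) (π : Perm (Fin (m + n))) : Perm (Fin (m + n)) :=
  rot m n a b * π * (rot m n a b)⁻¹

theorem conjRot_injective (a b : ℕ) : Function.Injective (conjRot (m := m) (n := n) a b) :=
  fun _ _ h => mul_left_cancel (mul_right_cancel h)

theorem conjRot_apply (a b : ℕ) (π : Perm (Fin (m + n))) (x : Fin (m + n)) :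
    conjRot a b π (rot m n a b x) = rot m n a b (π x) := by
  simp [conjRot]

theorem sameCycle_conjRot (a b : ℕ) (π : Perm (Fin (m + n))) (x y : Fin (m + n)) :
    π.SameCycle x y ↔ (conjRot a b π).SameCycle (rot m n a b x) (rot m n a b y) := by
  simp [conjRot, Perm.sameCycle_conj]

theorem conjRot_mem_SNC (a b : ℕ) {π : Perm (Fin (m + 1 + (n + 1)))} :
    conjRot a b π ∈ SNC (m + 1) (n + 1) ↔ π ∈ SNC (m + 1) (n + 1) := by
  have hc : (rot (m + 1) (n + 1) a b)⁻¹ * gammaPerm (m + 1) (n + 1) =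
      gammaPerm (m + 1) (n + 1) * (rot (m + 1) (n + 1) a b)⁻¹ := by
    have : Commute (rot (m + 1) (n + 1) a b) (gammaPerm (m + 1) (n + 1)) := by
      rw [Commute, SemiconjBy, rot, gammaPerm, prodPerm_mul, prodPerm_mul, ← pow_succ, ← pow_succ',
        ← pow_succ, ← pow_succ']
    exact this.inv_left.eq
  rw [mem_SNC_iff, mem_SNC_iff]
  have h1 : numCycles (conjRot a b π) = numCycles π := numCycles_conj _ _
  have h2 : (conjRot a b π)⁻¹ * gammaPerm (m + 1) (n + 1) =
      rot (m + 1) (n + 1) a b * (π⁻¹ * gammaPerm (m + 1) (n + 1)) *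
        (rot (m + 1) (n + 1) a b)⁻¹ := by
    rw [conjRot, mul_inv_rev, mul_inv_rev, inv_inv]
    simp only [mul_assoc]
    rw [hc]
  rw [h1, h2, numCycles_conj]
  refine and_congr_left fun _ => ?_
  constructor
  · rintro ⟨x, y, hx, hy, h⟩
    obtain ⟨x, rfl⟩ := (rot (m + 1) (n + 1) a b).surjective x
    obtain ⟨y, rfl⟩ := (rot (m + 1) (n + 1) a b).surjective y
    exact ⟨x, y, (onFirst_rot a b x).1 hx, fun h' => hy ((onFirst_rot a b y).2 h'),
      (sameCycle_conjRot a b π x y).2 h⟩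
  · rintro ⟨x, y, hx, hy, h⟩
    exact ⟨_, _, (onFirst_rot a b x).2 hx, fun h' => hy ((onFirst_rot a b y).1 h'),
      (sameCycle_conjRot a b π x y).1 h⟩

theorem exists_conjRot_eq (a b : ℕ) (π : Perm (Fin (m + n))) : ∃ π', conjRot a b π' = π :=
  ⟨(rot m n a b)⁻¹ * π * rot m n a b, by simp [conjRot, mul_assoc]⟩

theorem rot_base (i : Fin (m + 1)) (j : Fin (n + 1)) :
    rot (m + 1) (n + 1) i (j + 1) (Fin.natAdd (m + 1) (Fin.last n)) = Fin.natAdd (m + 1) j ∧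
    rot (m + 1) (n + 1) i (j + 1) (Fin.castAdd (n + 1) 0) = Fin.castAdd (n + 1) i := by
  rw [rot, prodPerm_natAdd, prodPerm_castAdd, finRotate_pow_zero _ i.2, pow_succ, Perm.mul_apply,
    finRotate_last, finRotate_pow_zero _ j.2]
  exact ⟨rfl, rfl⟩

theorem conjRot_base (i : Fin (m + 1)) (j : Fin (n + 1)) (π : Perm (Fin (m + 1 + (n + 1)))) :
    conjRot i (j + 1) π (Fin.natAdd (m + 1) j) = Fin.castAdd (n + 1) i ↔
      π (Fin.natAdd (m + 1) (Fin.last n)) = Fin.castAdd (n + 1) 0 := by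
  have h := rot_base i j
  rw [← h.1, ← h.2, conjRot_apply, (rot _ _ _ _).injective.eq_iff]

theorem through_block_iff {π : Perm (Fin (m + n))} {x : Fin (m + n)} : Through m (block π x) ↔
    (∃ y, OnFirst m y ∧ π.SameCycle x y) ∧ ∃ y, ¬ OnFirst m y ∧ π.SameCycle x y := by
  simp only [Through, mem_block, OnFirst, not_lt]
  constructor
  · rintro ⟨⟨_, ⟨y, h, rfl⟩, h1⟩, ⟨_, ⟨z, h', rfl⟩, h2⟩⟩
    exact ⟨⟨y, h1, h⟩, ⟨z, h2, h'⟩⟩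
  · rintro ⟨⟨y, h1, h⟩, ⟨z, h2, h'⟩⟩
    exact ⟨⟨_, ⟨y, h, rfl⟩, h1⟩, ⟨_, ⟨z, h', rfl⟩, h2⟩⟩

theorem through_conjRot (a b : ℕ) (π : Perm (Fin (m + n))) (x : Fin (m + n)) :
    Through m (block (conjRot a b π) (rot m n a b x)) ↔ Through m (block π x) := by
  rw [through_block_iff, through_block_iff]
  have h : ∀ p : Fin (m + n) → Prop, (∃ y, p y) ↔ ∃ y, p (rot m n a b y) := fun p =>
    ((rot m n a b).surjective.exists)
  rw [h fun y => OnFirst m y ∧ (conjRot a b π).SameCycle (rot m n a b x) y,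
    h fun y => ¬ OnFirst m y ∧ (conjRot a b π).SameCycle (rot m n a b x) y]
  simp only [onFirst_rot, ← sameCycle_conjRot]

theorem throughCount_conjRot (a b : ℕ) (π : Perm (Fin (m + n))) :
    throughCount m (conjRot a b π) = throughCount m π := by
  classical
  rw [throughCount, throughCount, card_filter, card_filter]
  refine (sum_cycleMins_congr (rot m n a b) (rot m n a b).surjective (sameCycle_conjRot a b π)
    fun x y h => ?_).symm
  rw [← block_eq_of_sameCycle h]
  simp only [through_conjRot]

theorem blockWeight_throughWeight_conjRot (g κ : ℕ → ℂ) (t : ℂ) (a b : ℕ)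
    (π : Perm (Fin (m + n))) : blockWeight (throughWeight g κ t m) (conjRot a b π) =
      blockWeight (throughWeight g κ t m) π := by
  refine (prod_cycleMins_congr (rot m n a b) (rot m n a b).surjective (sameCycle_conjRot a b π)
    fun x y h => ?_).symm
  rw [← block_eq_of_sameCycle h, throughWeight, throughWeight, card_block, card_block,
    ← cycleLen_congr (rot m n a b) (sameCycle_conjRot a b π)]
  by_cases hT : Through m (block π x)
  · rw [if_pos hT, if_pos ((through_conjRot a b π x).2 hT)]
  · rw [if_neg hT, if_neg (mt (through_conjRot a b π x).1 hT)]

open Classical in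
/-- The number of points of the second circle mapped to the first circle. -/
noncomputable def crossCount (π : Perm (Fin (m + n))) : ℕ :=
  #(univ.filter fun k => ¬ OnFirst m k ∧ OnFirst m (π k))

theorem crossCount_conjRot (a b : ℕ) (π : Perm (Fin (m + n))) :
    crossCount (conjRot a b π) = crossCount π := by
  refine (card_bij (fun x _ => rot m n a b x) ?_ (fun _ _ _ _ h => (rot m n a b).injective h)
    ?_).symm
  · intro x hx
    simpa [conjRot_apply, onFirst_rot] using hx
  · intro y hy
    obtain ⟨x, rfl⟩ := (rot m n a b).surjective y
    exact ⟨x, by simpa [conjRot_apply, onFirst_rot] using hy, rfl⟩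

theorem crossCount_eq_throughCount_of_mem_NC {π : Perm (Fin (m + n))} (h : IncreasingCycles π) :
    crossCount π = throughCount m π := by
  refine card_bij (fun k _ => π k) ?_ (fun _ _ _ _ h => π.injective h) ?_
  · intro k hk
    simp only [mem_filter, mem_univ, true_and] at hk ⊢
    refine ⟨h _ ?_, through_block_iff.2 ⟨⟨π k, hk.2, by simp⟩, ⟨k, hk.1, by simp⟩⟩⟩
    have h1 := hk.1
    have h2 := hk.2
    simp only [OnFirst] at h1 h2
    rw [Perm.inv_def, symm_apply_apply, Fin.le_def]
    omega
  · intro x hx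
    simp only [mem_filter, mem_univ, true_and, through_block_iff] at hx ⊢
    obtain ⟨hx, ⟨y, hy, hxy⟩, ⟨z, hz, hxz⟩⟩ := hx
    have hle : π (π⁻¹ x) ≤ π⁻¹ x := by simpa using mem_cycleMins.1 hx (π⁻¹ x) (by simp)
    have h1 := h.max_of_le hle (y := z) (by simpa using hxz)
    have h2 := mem_cycleMins.1 hx y hxy
    simp only [OnFirst] at hy hz
    rw [Fin.le_def] at h1 h2
    refine ⟨π⁻¹ x, ⟨?_, ?_⟩, by simp⟩
    · simp only [OnFirst]; omega
    · simp only [Perm.inv_def, apply_symm_apply, OnFirst]; omega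

theorem exists_cross {π : Perm (Fin (m + n))}
    (h : ∃ x y, OnFirst m x ∧ ¬ OnFirst m y ∧ π.SameCycle x y) :
    ∃ k, ¬ OnFirst m k ∧ OnFirst m (π k) := by
  by_contra! hne
  obtain ⟨x, y, hx, hy, h⟩ := h
  obtain ⟨k, rfl⟩ := h.symm.exists_nat_pow_eq
  have : ∀ k : ℕ, ¬ OnFirst m ((π ^ k) y) := by
    intro k
    induction k with
    | zero => exact hy
    | succ k ih => rw [pow_succ', Perm.mul_apply]; exact hne _ ih
  exact this k hx

/-- Every annular non-crossing permutation is a rotation of one that maps the last point to the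
first one. -/
theorem exists_conjRot_base {π : Perm (Fin (m + 1 + (n + 1)))} (h : π ∈ SNC (m + 1) (n + 1)) :
    ∃ a b π', π = conjRot a b π' ∧ π' ∈ NC (m + 1 + (n + 1)) ∧ π' ∈ SNC (m + 1) (n + 1) ∧
      π' (Fin.natAdd (m + 1) (Fin.last n)) = Fin.castAdd (n + 1) 0 := by
  obtain ⟨k, hk, hk'⟩ := exists_cross (mem_SNC_iff.1 h).1
  induction k using Fin.addCases with
  | left i => exact absurd (onFirst_castAdd i) hk
  | right j =>
    obtain ⟨i, hi⟩ : ∃ i, π (Fin.natAdd (m + 1) j) = Fin.castAdd (n + 1) i := ⟨⟨_, hk'⟩, rfl⟩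
    obtain ⟨π', rfl⟩ := exists_conjRot_eq i (j + 1) π
    rw [conjRot_base] at hi
    rw [conjRot_mem_SNC] at h
    exact ⟨_, _, π', rfl, (mem_SNC_iff_mem_NC hi).1 h, h, hi⟩

theorem crossCount_eq_throughCount {π : Perm (Fin (m + 1 + (n + 1)))}
    (h : π ∈ SNC (m + 1) (n + 1)) : crossCount π = throughCount (m + 1) π := by
  obtain ⟨a, b, π', rfl, hNC, -, -⟩ := exists_conjRot_base h
  rw [crossCount_conjRot, throughCount_conjRot,
    crossCount_eq_throughCount_of_mem_NC (mem_NC.1 hNC).1]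

theorem crossCount_pos {π : Perm (Fin (m + 1 + (n + 1)))}
    (h : π ∈ SNC (m + 1) (n + 1)) : 0 < crossCount π := by
  obtain ⟨k, hk⟩ := exists_cross (mem_SNC_iff.1 h).1
  exact card_pos.2 ⟨k, by simpa using hk⟩

theorem crossCount_eq_sum (π : Perm (Fin (m + n))) : (crossCount π : ℂ) =
    ∑ i : Fin m, ∑ j : Fin n, if π (Fin.natAdd m j) = Fin.castAdd n i then 1 else 0 := by
  classical
  rw [sum_comm, crossCount, card_filter, Nat.cast_sum, Fin.sum_univ_add, sum_eq_zero, zero_add]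
  · refine sum_congr rfl fun j _ => ?_
    by_cases h : OnFirst m (π (Fin.natAdd m j))
    · obtain ⟨i, hi⟩ : ∃ i, π (Fin.natAdd m j) = Fin.castAdd n i := ⟨⟨_, h⟩, rfl⟩
      rw [if_pos ⟨not_onFirst_natAdd j, h⟩, hi]
      simp
    · rw [if_neg (fun h' => h h'.2), sum_eq_zero, Nat.cast_zero]
      intro i _
      rw [if_neg]
      intro e
      exact h (e ▸ onFirst_castAdd i)
  · intro i _
    rw [if_neg (fun h => h.1 (onFirst_castAdd i)), Nat.cast_zero]

/-- The sum over the annular non-crossing permutations in terms of the kernel. -/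
theorem sum_SNC_throughWeight (g κ : ℕ → ℂ) {m n K : ℕ} (hm : 1 ≤ m) (hn : 1 ≤ n) (hK : n < K) :
    ∑ π ∈ SNC m n, blockWeight (throughWeight g κ 1 m) π =
      m * n * PowerSeries.coeff m (PowerSeries.coeff n (logTrunc K (momentKernel g κ))) := by
  classical
  rw [← sum_NC_div_throughCount g κ hm hn hK]
  obtain ⟨m, rfl⟩ := Nat.exists_eq_add_of_le' hm
  obtain ⟨n, rfl⟩ := Nat.exists_eq_add_of_le' hn
  set W : Perm (Fin (m + 1 + (n + 1))) → ℂ := fun π =>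
    blockWeight (throughWeight g κ 1 (m + 1)) π / (throughCount (m + 1) π : ℂ) with hW
  have h1 : ∀ π ∈ SNC (m + 1) (n + 1), blockWeight (throughWeight g κ 1 (m + 1)) π =
      ∑ i : Fin (m + 1), ∑ j : Fin (n + 1),
        if π (Fin.natAdd (m + 1) j) = Fin.castAdd (n + 1) i then W π else 0 := by
    intro π hπ
    have h2 : (crossCount π : ℂ) ≠ 0 := Nat.cast_ne_zero.2 (crossCount_pos hπ).ne'
    have h3 : blockWeight (throughWeight g κ 1 (m + 1)) π = crossCount π * W π := by
      rw [hW]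
      simp only [← crossCount_eq_throughCount hπ]
      field_simp
    rw [h3, crossCount_eq_sum, sum_mul]
    refine sum_congr rfl fun i _ => ?_
    rw [sum_mul]
    refine sum_congr rfl fun j _ => ?_
    rw [ite_mul, one_mul, zero_mul]
  rw [sum_congr rfl h1, sum_comm]
  have h4 : ∀ i : Fin (m + 1), ∀ j : Fin (n + 1), (∑ π ∈ SNC (m + 1) (n + 1),
      if π (Fin.natAdd (m + 1) j) = Fin.castAdd (n + 1) i then W π else 0) =
      ∑ π ∈ (NC (m + 1 + (n + 1))).filter (LastTo 0), W π := by
    intro i j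
    rw [← sum_filter]
    refine (sum_bij (fun π _ => conjRot i (j + 1) π) ?_
      (fun _ _ _ _ h => conjRot_injective _ _ h) ?_ ?_).symm
    · intro π hπ
      rw [mem_filter] at hπ ⊢
      have h5 : π (Fin.natAdd (m + 1) (Fin.last n)) = Fin.castAdd (n + 1) 0 :=
        Fin.ext (hπ.2 _ (by simp; omega))
      exact ⟨(conjRot_mem_SNC _ _).2 ((mem_SNC_iff_mem_NC h5).2 hπ.1), (conjRot_base i j π).2 h5⟩
    · intro π hπ
      obtain ⟨π', rfl⟩ := exists_conjRot_eq i (j + 1) π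
      rw [mem_filter, conjRot_mem_SNC, conjRot_base] at hπ
      refine ⟨π', mem_filter.2 ⟨(mem_SNC_iff_mem_NC hπ.2).1 hπ.1, fun l hl => ?_⟩, rfl⟩
      rw [show l = Fin.natAdd (m + 1) (Fin.last n) from Fin.ext (by simp; omega), hπ.2]
      rfl
    · intro π _
      simp only [hW]
      rw [throughCount_conjRot, blockWeight_throughWeight_conjRot]
  have h5 : ∀ i : Fin (m + 1), (∑ π ∈ SNC (m + 1) (n + 1), ∑ j : Fin (n + 1),
      if π (Fin.natAdd (m + 1) j) = Fin.castAdd (n + 1) i then W π else 0) =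
      ((n + 1 : ℕ) : ℂ) * ∑ π ∈ (NC (m + 1 + (n + 1))).filter (LastTo 0), W π := by
    intro i
    rw [sum_comm, sum_congr rfl fun j _ => h4 i j]
    simp
  rw [sum_congr rfl fun i _ => h5 i]
  simp [mul_assoc]

end Annular

/-! ### Even annular non-crossing permutations -/

section Parity

theorem even_card_of_closed {N : ℕ} {π : Perm (Fin N)} (he : IsEvenPerm π) (S : Finset (Fin N))
    (hS : ∀ x ∈ S, ∀ y, π.SameCycle x y → y ∈ S) : Even #S := by
  classical
  induction S using Finset.strongInduction with
  | _ S ih =>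
  obtain rfl | ⟨x, hx⟩ := S.eq_empty_or_nonempty
  · simp
  have hsub : cycleSet π x ⊆ S := fun y hy => hS x hx y (mem_cycleSet.1 hy)
  have hss : S \ cycleSet π x ⊂ S := sdiff_ssubset hsub ⟨x, mem_cycleSet.2 (by simp)⟩
  have h := ih _ hss fun y hy z hyz => by
    rw [mem_sdiff, mem_cycleSet] at hy ⊢
    exact ⟨hS y hy.1 z hyz, fun h => hy.2 (h.trans hyz.symm)⟩
  rw [← card_sdiff_add_card_eq_card hsub, card_cycleSet]
  exact h.add (he x)

theorem parity_of_mem_NC {N : ℕ} {π : Perm (Fin N)} (h : π ∈ NC N) (he : IsEvenPerm π)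
    (k : Fin N) : ((k : ℕ) + π k) % 2 = 1 := by
  obtain ⟨hi, hn⟩ := mem_NC.1 h
  rcases lt_or_ge k (π k) with hk | hk
  · have := even_card_of_closed he (Ioo k (π k)) fun x hx y hxy => by
      rw [mem_Ioo] at hx ⊢
      exact sameCycle_mem_Ioo (fun a y => hi.mapsTo_Ioo hn) hx.1 hx.2 hxy
    rw [Fin.card_Ioo, Nat.even_iff] at this
    rw [Fin.lt_def] at hk
    omega
  · have := even_card_of_closed he (Icc (π k) k) fun x hx y hxy => by
      rw [mem_Icc] at hx ⊢
      by_cases hkx : π.SameCycle k x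
      · exact ⟨hi.min_of_le hk (hkx.trans hxy), hi.max_of_le hk (hkx.trans hxy)⟩
      have h1 : π k < x := lt_of_le_of_ne hx.1 fun e => hkx (by rw [← e]; simp)
      have h2 : x < k := lt_of_le_of_ne hx.2 fun e => hkx (by rw [e])
      have hkk : π.SameCycle (π k) k := by simp
      refine ⟨?_, ?_⟩
      · by_contra hlt
        push Not at hlt
        exact hkx ((hkk.symm.trans (hn _ _ _ _ hlt h1 h2 hxy.symm hkk).symm).trans hxy.symm)
      · by_contra hlt
        push Not at hlt
        exact hkx (hkk.symm.trans (hn _ _ _ _ h1 h2 hlt hkk hxy))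
    rw [Fin.card_Icc, Nat.even_iff] at this
    rw [Fin.le_def] at hk
    omega

theorem val_finRotate_pow {n : ℕ} (a : ℕ) (i : Fin (n + 1)) :
    ((finRotate (n + 1) ^ a) i : ℕ) = (i + a) % (n + 1) := by
  induction a with
  | zero => simp [Nat.mod_eq_of_lt i.2]
  | succ a ih =>
    rw [pow_succ', Perm.mul_apply, finRotate_apply, Fin.val_add, ih, Fin.val_one', ← add_assoc,
      ← Nat.add_mod]

variable {m n : ℕ}

open Classical in
theorem val_rot_mod_two (hm : Even (m + 1)) (hn : Even (n + 1)) (a b : ℕ)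
    (x : Fin (m + 1 + (n + 1))) : (rot (m + 1) (n + 1) a b x : ℕ) % 2 =
      (x + if OnFirst (m + 1) x then a else b) % 2 := by
  induction x using Fin.addCases with
  | left i =>
    rw [rot, prodPerm_castAdd, Fin.val_castAdd, val_finRotate_pow, if_pos (onFirst_castAdd i),
      Nat.mod_mod_of_dvd _ hm.two_dvd, Fin.val_castAdd]
  | right i =>
    rw [rot, prodPerm_natAdd, Fin.val_natAdd, val_finRotate_pow, if_neg (not_onFirst_natAdd i),
      Nat.add_mod, Nat.mod_mod_of_dvd _ hn.two_dvd, ← Nat.add_mod, Fin.val_natAdd]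
    congr 1
    omega

/-- In passing to the other circle the parity is preserved. -/
def ParityPreserving (π : Perm (Fin (m + n))) : Prop :=
  ∀ k, ¬ (OnFirst m k ↔ OnFirst m (π k)) → (k : ℕ) % 2 = (π k : ℕ) % 2

theorem isEvenPerm_conjRot (a b : ℕ) {π : Perm (Fin (m + n))} :
    IsEvenPerm (conjRot a b π) ↔ IsEvenPerm π := by
  have h := cycleLen_congr (rot m n a b) (sameCycle_conjRot a b π)
  constructor
  · intro he x
    rw [h]
    exact he _
  · intro he x
    obtain ⟨x, rfl⟩ := (rot m n a b).surjective x
    rw [← h]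
    exact he _

theorem val_add_conjRot (hm : Even (m + 1)) (hn : Even (n + 1)) (a b : ℕ)
    (π : Perm (Fin (m + 1 + (n + 1)))) (k : Fin (m + 1 + (n + 1)))
    (hk : ¬ (OnFirst (m + 1) k ↔ OnFirst (m + 1) (π k))) :
    ((rot (m + 1) (n + 1) a b k : ℕ) + conjRot a b π (rot (m + 1) (n + 1) a b k)) % 2 =
      (k + π k + a + b) % 2 := by
  rw [conjRot_apply]
  have h1 := val_rot_mod_two hm hn a b k
  have h2 := val_rot_mod_two hm hn a b (π k)
  by_cases h3 : OnFirst (m + 1) k <;> by_cases h4 : OnFirst (m + 1) (π k)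
  · exact absurd (iff_of_true h3 h4) hk
  · rw [if_pos h3] at h1; rw [if_neg h4] at h2; omega
  · rw [if_neg h3] at h1; rw [if_pos h4] at h2; omega
  · exact absurd (iff_of_false h3 h4) hk

theorem exists_parity (hm : Even (m + 1)) (hn : Even (n + 1)) {π : Perm (Fin (m + 1 + (n + 1)))}
    (h : π ∈ SNC (m + 1) (n + 1)) (he : IsEvenPerm π) :
    ∃ c : ℕ, ∀ k, ¬ (OnFirst (m + 1) k ↔ OnFirst (m + 1) (π k)) →
      ((k : ℕ) + π k) % 2 = c % 2 := by
  obtain ⟨a, b, π, rfl, hNC, -, -⟩ := exists_conjRot_base h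
  rw [isEvenPerm_conjRot] at he
  refine ⟨1 + a + b, fun k hk => ?_⟩
  obtain ⟨k, rfl⟩ := (rot (m + 1) (n + 1) a b).surjective k
  rw [conjRot_apply, onFirst_rot, onFirst_rot] at hk
  rw [val_add_conjRot hm hn a b π k hk]
  have := parity_of_mem_NC hNC he k
  omega

theorem parityPreserving_conjRot (hm : Even (m + 1)) (hn : Even (n + 1))
    {π : Perm (Fin (m + 1 + (n + 1)))} (h : π ∈ SNC (m + 1) (n + 1)) (he : IsEvenPerm π) :
    ParityPreserving (conjRot 0 1 π) ↔ ¬ ParityPreserving π := by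
  obtain ⟨c, hc⟩ := exists_parity hm hn h he
  obtain ⟨k₀, hk₀, hk₀'⟩ := exists_cross (mem_SNC_iff.1 h).1
  have hk₀ : ¬ (OnFirst (m + 1) k₀ ↔ OnFirst (m + 1) (π k₀)) := fun h => hk₀ (h.2 hk₀')
  have h1 := hc k₀ hk₀
  have h2 := val_add_conjRot hm hn 0 1 π k₀ hk₀
  constructor
  · intro h3 h4
    have h5 := h4 k₀ hk₀
    have h6 := h3 (rot (m + 1) (n + 1) 0 1 k₀) (by rwa [conjRot_apply, onFirst_rot, onFirst_rot])
    omega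
  · intro h3 k hk
    obtain ⟨k, rfl⟩ := (rot (m + 1) (n + 1) 0 1).surjective k
    rw [conjRot_apply, onFirst_rot, onFirst_rot] at hk
    have h5 := val_add_conjRot hm hn 0 1 π k hk
    have h6 : c % 2 = 1 := by
      by_contra hc0
      exact h3 fun k hk => by
        have := hc k hk
        omega
    have := hc k hk
    omega

theorem sum_SNCPlusAll (κ : ℕ → ℂ) (hκ : ∀ l, Odd l → κ l = 0) (hm : Even (m + 1))
    (hn : Even (n + 1)) :
    2 * ∑ π ∈ SNCPlusAll (m + 1) (n + 1), ∏ x ∈ cycleMins π, κ (cycleLen π x) =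
      ∑ π ∈ SNC (m + 1) (n + 1), blockWeight (throughWeight (fun _ => 0) κ 1 (m + 1)) π := by
  classical
  set A : Finset (Perm (Fin (m + 1 + (n + 1)))) := (SNC (m + 1) (n + 1)).filter fun π =>
    IsEvenPerm π ∧ ∀ k, Through (m + 1) (block π k) with hA
  set W : Perm (Fin (m + 1 + (n + 1))) → ℂ :=
    blockWeight (throughWeight (fun _ => 0) κ 1 (m + 1)) with hW
  have h1 : ∑ π ∈ SNC (m + 1) (n + 1), W π = ∑ π ∈ A, W π := by
    refine (sum_subset (filter_subset _ _) fun π hπ hπA => ?_).symm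
    have : ∃ x, Odd (cycleLen π x) ∨ ¬ Through (m + 1) (block π x) := by
      by_contra! hne
      exact hπA (mem_filter.2 ⟨hπ, fun x => by simpa using (hne x).1, fun x => (hne x).2⟩)
    obtain ⟨x, hx⟩ := this
    obtain ⟨y, hy, hxy⟩ := exists_cycleMin π x
    rw [cycleLen_eq_of_sameCycle hxy, block_eq_of_sameCycle hxy] at hx
    refine prod_eq_zero hy ?_
    rw [throughWeight, card_block]
    by_cases hT : Through (m + 1) (block π y)
    · rw [if_pos hT, hκ _ (hx.resolve_right (not_not.2 hT)), mul_zero]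
    · rw [if_neg hT]
  have h2 : A.filter ParityPreserving = SNCPlusAll (m + 1) (n + 1) := by
    ext π
    simp only [hA, SNCPlusAll, mem_filter, ParityPreserving, through_block_iff, and_assoc]
  have h3 : ∀ π ∈ A, W π = ∏ x ∈ cycleMins π, κ (cycleLen π x) := by
    intro π hπ
    refine prod_congr rfl fun x _ => ?_
    rw [throughWeight, if_pos ((mem_filter.1 hπ).2.2 x), card_block, one_mul]
  have h4 : ∑ π ∈ A.filter (fun π => ¬ ParityPreserving π), W π =
      ∑ π ∈ A.filter ParityPreserving, W π := by
    have hAc : ∀ π, conjRot 0 1 π ∈ A ↔ π ∈ A := by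
      intro π
      rw [hA, mem_filter, mem_filter, conjRot_mem_SNC, isEvenPerm_conjRot,
        (rot (m + 1) (n + 1) 0 1).surjective.forall]
      simp only [through_conjRot]
    refine sum_bij (fun π _ => conjRot 0 1 π) ?_ (fun _ _ _ _ h => conjRot_injective 0 1 h) ?_ ?_
    · intro π hπ
      rw [mem_filter] at hπ ⊢
      have := mem_filter.1 hπ.1
      exact ⟨(hAc π).2 hπ.1, (parityPreserving_conjRot hm hn this.1 this.2.1).2 hπ.2⟩
    · intro π hπ
      obtain ⟨π', rfl⟩ := exists_conjRot_eq 0 1 π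
      rw [mem_filter, hAc] at hπ
      have := mem_filter.1 hπ.1
      exact ⟨π', mem_filter.2 ⟨hπ.1, (parityPreserving_conjRot hm hn this.1 this.2.1).1 hπ.2⟩, rfl⟩
    · intro π _
      exact (blockWeight_throughWeight_conjRot _ _ _ _ _ _).symm
  rw [h1, ← sum_filter_add_sum_filter_not A ParityPreserving, h4, h2, two_mul,
    sum_congr rfl fun π hπ => (h3 π (filter_subset ParityPreserving A (by rwa [h2]))).symm]

end Parity

/-! ### Sums over partitioned permutations -/

section Marked

/-- The product of the weights `g` of the cycles other than that of `x`, if that of `x` has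
length `r`. -/
noncomputable def markWeight {ι : Type*} [Fintype ι] [LinearOrder ι] (g : ℕ → ℂ) (r : ℕ)
    (π : Perm ι) (x : ι) : ℂ :=
  (if cycleLen π x = r then 1 else 0) * ∏ y ∈ (cycleMins π).erase x, g (cycleLen π y)

/-- The sum of the weights of the non-crossing partitions with a marked block of size `r`. -/
noncomputable def markedSum (g : ℕ → ℂ) (n r : ℕ) : ℂ :=
  ∑ π ∈ NC n, ∑ x ∈ cycleMins π, markWeight g r π x

open Classical in
/-- The weight of a permutation with a marked point `z`. -/
noncomputable def pointWeight {ι : Type*} [Fintype ι] [LinearOrder ι] (g : ℕ → ℂ) (r : ℕ)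
    (π : Perm ι) (z : ι) : ℂ :=
  ∏ y ∈ cycleMins π, if π.SameCycle z y then (if cycleLen π y = r then 1 else 0)
    else g (cycleLen π y)

variable {ι : Type*} [Fintype ι] [LinearOrder ι]

theorem pointWeight_of_mem_cycleMins (g : ℕ → ℂ) (r : ℕ) {π : Perm ι} {x : ι}
    (hx : x ∈ cycleMins π) : pointWeight g r π x = markWeight g r π x := by
  classical
  rw [pointWeight, markWeight, ← mul_prod_erase _ _ hx, if_pos (Perm.SameCycle.refl _ _)]
  congr 1
  refine prod_congr rfl fun y hy => if_neg fun h => ?_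
  rw [mem_erase] at hy
  exact hy.1 (eq_of_mem_cycleMins hx hy.2 h).symm

theorem pointWeight_of_sameCycle (g : ℕ → ℂ) (r : ℕ) {π : Perm ι} {x z : ι}
    (h : π.SameCycle x z) : pointWeight g r π x = pointWeight g r π z := by
  refine prod_congr rfl fun y _ => ?_
  by_cases h1 : π.SameCycle z y
  · rw [if_pos h1, if_pos (h.trans h1)]
  · rw [if_neg h1, if_neg (fun h' => h1 (h.symm.trans h'))]

theorem sum_eq_sum_cycleMins {f : ι → ℂ} {π : Perm ι}
    (hf : ∀ x y, π.SameCycle x y → f x = f y) :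
    ∑ z, f z = ∑ x ∈ cycleMins π, cycleLen π x * f x := by
  classical
  choose m hm hm' using exists_cycleMin π
  rw [← sum_fiberwise_of_maps_to (g := m) (t := cycleMins π) fun x _ => hm x]
  refine sum_congr rfl fun x hx => ?_
  have : (univ.filter fun z => m z = x) = cycleSet π x := by
    ext z
    simp only [mem_filter, mem_univ, true_and, mem_cycleSet]
    constructor
    · rintro rfl
      exact (hm' z).symm
    · intro h
      exact eq_of_mem_cycleMins (hm z) hx ((hm' z).symm.trans h.symm)
  rw [this, sum_congr rfl fun z hz => (hf x z (mem_cycleSet.1 hz)).symm, sum_const, card_cycleSet,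
    nsmul_eq_mul]

theorem sum_pointWeight (g : ℕ → ℂ) (r : ℕ) (π : Perm ι) :
    ∑ z, pointWeight g r π z = r * ∑ x ∈ cycleMins π, markWeight g r π x := by
  rw [sum_eq_sum_cycleMins fun x y => pointWeight_of_sameCycle g r, mul_sum]
  refine sum_congr rfl fun x hx => ?_
  rw [pointWeight_of_mem_cycleMins g r hx, markWeight]
  split_ifs with h
  · rw [h]
  · simp

theorem mul_markedSum (g : ℕ → ℂ) (n r : ℕ) : (r : ℂ) * markedSum g (n + 1) r =
    (n + 1 : ℕ) * PowerSeries.coeff (n + 1) (zMoment g ^ r) := by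
  classical
  rw [markedSum, mul_sum, sum_congr rfl fun π _ => (sum_pointWeight g r π).symm, sum_comm]
  have h1 : ∀ z : Fin (n + 1), ∑ π ∈ NC (n + 1), pointWeight g r π z =
      ∑ π ∈ NC (n + 1), pointWeight g r π 0 := by
    intro z
    set ρ := finRotate (n + 1) ^ (z : ℕ) with hρ
    have hz : ρ 0 = z := finRotate_pow_zero _ z.2
    refine (sum_bij (fun π _ => ρ * π * ρ⁻¹) (fun π hπ => (conj_finRotate_mem_NC _).2 hπ)
      (fun _ _ _ _ h => mul_left_cancel (mul_right_cancel h)) ?_ ?_).symm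
    · intro π hπ
      refine ⟨ρ⁻¹ * π * ρ, (conj_finRotate_mem_NC (z : ℕ)).1 ?_, by simp [mul_assoc]⟩
      convert hπ using 1
      simp [← hρ, mul_assoc]
    · intro π _
      have h2 : ∀ x y, π.SameCycle x y ↔ (ρ * π * ρ⁻¹).SameCycle (ρ x) (ρ y) := fun x y => by
        simp [Perm.sameCycle_conj]
      refine prod_cycleMins_congr ρ ρ.surjective h2 fun x y h => ?_
      rw [← cycleLen_eq_of_sameCycle h, ← cycleLen_congr ρ h2]
      have h3 : π.SameCycle 0 x ↔ (ρ * π * ρ⁻¹).SameCycle z y := by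
        rw [h2, hz]
        exact ⟨fun h' => h'.trans h, fun h' => h'.trans h.symm⟩
      by_cases h4 : π.SameCycle 0 x
      · rw [if_pos h4, if_pos (h3.1 h4)]
      · rw [if_neg h4, if_neg (mt h3.2 h4)]
  rw [sum_congr rfl fun z _ => h1 z, sum_const, card_univ, Fintype.card_fin, nsmul_eq_mul]
  congr 1
  have h5 : ∑ π ∈ NC (n + 1), pointWeight g r π 0 =
      ncSum (firstWeight g fun l => if l = r then 1 else 0) (n + 1) := by
    refine sum_congr rfl fun π _ => prod_congr rfl fun x _ => ?_
    have h0 : 0 ∈ block π x ↔ π.SameCycle 0 x := by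
      rw [mem_block]
      constructor
      · rintro ⟨y, h, hy⟩
        rw [show y = 0 from Fin.ext hy] at h
        exact h.symm
      · intro h
        exact ⟨0, h.symm, rfl⟩
    rw [firstWeight, card_block]
    by_cases h : π.SameCycle 0 x
    · rw [if_pos h, if_pos (h0.2 h)]
    · rw [if_neg h, if_neg (mt h0.1 h)]
  rw [h5, ← coeff_succ_firstSeries, firstSeries_eq_subst,
    coeff_subst_eq_sum (constantCoeff_zMoment g) _ (lt_max_of_lt_left (Nat.lt_succ_self (n + 1)) :
      n + 1 < max (n + 2) (r + 1)),
    sum_eq_single r]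
  · simp
  · intro l _ hl
    simp [hl]
  · intro h
    exact absurd (mem_range.2 (lt_max_of_lt_right (Nat.lt_succ_self r))) h

end Marked

section Partitioned
variable {ι : Type*} [Fintype ι] [LinearOrder ι]

theorem mem_parts_cyclePartition {π : Perm ι} {B : Finset ι} :
    B ∈ (cyclePartition π).parts ↔ ∃ x ∈ cycleMins π, B = cycleSet π x := by
  classical
  constructor
  · intro hB
    obtain ⟨x, hx⟩ := (cyclePartition π).nonempty_of_mem_parts hB
    obtain ⟨y, hy, hxy⟩ := exists_cycleMin π x
    refine ⟨y, hy, ?_⟩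
    ext z
    rw [cyclePartition_part π hB hx, mem_cycleSet]
    exact ⟨fun h => hxy.symm.trans h, fun h => hxy.trans h⟩
  · rintro ⟨x, -, rfl⟩
    have h1 := (cyclePartition π).part_mem.2 (mem_univ x)
    convert h1
    ext z
    rw [cyclePartition_part π h1 ((cyclePartition π).mem_part (mem_univ x)), mem_cycleSet]

theorem cycleMins_inter_cycleSet {π : Perm ι} {x : ι} (hx : x ∈ cycleMins π) :
    cycleMins π ∩ cycleSet π x = {x} := by
  ext y
  simp only [mem_inter, mem_cycleSet, mem_singleton]
  constructor
  · rintro ⟨h, h'⟩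
    exact (eq_of_mem_cycleMins hx h h').symm
  · rintro rfl
    exact ⟨hx, Perm.SameCycle.refl _ _⟩

theorem cycleSet_injOn (π : Perm ι) : Set.InjOn (cycleSet π) (cycleMins π : Set ι) := by
  intro x hx y hy h
  refine eq_of_mem_cycleMins hx hy (mem_cycleSet.1 ?_)
  rw [h]
  exact mem_cycleSet.2 (Perm.SameCycle.refl _ _)

theorem parts_cyclePartition (π : Perm ι) :
    (cyclePartition π).parts = (cycleMins π).image (cycleSet π) := by
  ext B
  simp only [mem_parts_cyclePartition, mem_image, eq_comm]

variable (κ : ℕ → ℂ) (κ₂ : ℕ → ℕ → ℂ)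

/-- The multiplicative extension of sequences of numbers. -/
noncomputable def seqExt (V : Finpartition (univ : Finset ι)) (π : Perm ι) : ℂ :=
  partitionedExt (fun r _ => κ r) (fun r s _ _ => κ₂ r s) V π fun _ => ()

theorem blockFactor_cycleSet {M : Type*} (a : ι → M) {π : Perm ι} {x : ι}
    (hx : x ∈ cycleMins π) : blockFactor (fun r _ => κ r) (fun r s _ _ => κ₂ r s) π a
      (cycleSet π x) = κ (cycleLen π x) := by
  rw [blockFactor, cycleMins_inter_cycleSet hx, sort_singleton]

theorem seqExt_cyclePartition (π : Perm ι) :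
    seqExt κ κ₂ (cyclePartition π) π = ∏ x ∈ cycleMins π, κ (cycleLen π x) := by
  rw [seqExt, partitionedExt, parts_cyclePartition, prod_image (cycleSet_injOn π)]
  exact prod_congr rfl fun x hx => blockFactor_cycleSet κ κ₂ _ hx

theorem exists_join (P : Finpartition (univ : Finset ι)) {C D : Finset ι} (hC : C ∈ P.parts)
    (hD : D ∈ P.parts) : ∃ V : Finpartition (univ : Finset ι),
      V.parts = insert (C ∪ D) (P.parts \ {C, D}) := by
  refine ⟨Finpartition.ofExistsUnique (insert (C ∪ D) (P.parts \ {C, D}))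
    (fun _ _ => subset_univ _) (fun x _ => ?_) ?_, rfl⟩
  · obtain ⟨B, hB, hx⟩ := P.exists_mem (mem_univ x)
    have huniq : ∀ B' ∈ P.parts, x ∈ B' → B' = B := fun B' hB' hx' =>
      P.eq_of_mem_parts hB' hB hx' hx
    by_cases h : B = C ∨ B = D
    · refine ⟨C ∪ D, ⟨mem_insert_self _ _, ?_⟩, ?_⟩
      · rcases h with rfl | rfl <;> simp [hx]
      · rintro B' ⟨hB', hx'⟩
        rw [mem_insert, mem_sdiff] at hB'
        rcases hB' with rfl | hB'
        · rfl
        · rw [huniq B' hB'.1 hx'] at hB'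
          exact absurd (by simpa using h) hB'.2
    · refine ⟨B, ⟨mem_insert_of_mem (mem_sdiff.2 ⟨hB, by simpa using h⟩), hx⟩, ?_⟩
      rintro B' ⟨hB', hx'⟩
      rw [mem_insert, mem_sdiff] at hB'
      rcases hB' with rfl | hB'
      · rcases mem_union.1 hx' with h' | h'
        · exact absurd (Or.inl (huniq C hC h').symm) h
        · exact absurd (Or.inr (huniq D hD h').symm) h
      · exact huniq B' hB'.1 hx'
  · intro h
    rw [mem_insert, mem_sdiff] at h
    rcases h with h | h
    · obtain ⟨x, hx⟩ := P.nonempty_of_mem_parts hC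
      have : x ∈ C ∪ D := mem_union_left _ hx
      rw [← h] at this
      simp at this
    · obtain ⟨x, hx⟩ := P.nonempty_of_mem_parts h.1
      simp at hx

theorem seqExt_of_parts {π : Perm ι} {V : Finpartition (univ : Finset ι)} {x y : ι}
    (hx : x ∈ cycleMins π) (hy : y ∈ cycleMins π) (hxy : x < y)
    (hV : V.parts = insert (cycleSet π x ∪ cycleSet π y)
      ((cyclePartition π).parts \ {cycleSet π x, cycleSet π y})) :
    seqExt κ κ₂ V π = κ₂ (cycleLen π x) (cycleLen π y) *
      ∏ z ∈ cycleMins π \ {x, y}, κ (cycleLen π z) := by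
  classical
  have hnot : cycleSet π x ∪ cycleSet π y ∉
      (cyclePartition π).parts \ {cycleSet π x, cycleSet π y} := by
    rw [mem_sdiff]
    rintro ⟨h1, -⟩
    have hx' : x ∈ cycleSet π x ∪ cycleSet π y := mem_union_left _ (by simp [mem_cycleSet])
    have hy' : y ∈ cycleSet π x ∪ cycleSet π y := mem_union_right _ (by simp [mem_cycleSet])
    exact hxy.ne (eq_of_mem_cycleMins hx hy ((cyclePartition_part π h1 hx').1 hy'))
  have hparts : (cyclePartition π).parts \ {cycleSet π x, cycleSet π y} =
      (cycleMins π \ {x, y}).image (cycleSet π) := by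
    rw [parts_cyclePartition]
    ext B
    simp only [mem_sdiff, mem_image, mem_insert, mem_singleton, not_or]
    constructor
    · rintro ⟨⟨z, hz, rfl⟩, h1, h2⟩
      exact ⟨z, ⟨hz, fun h => h1 (by rw [h]), fun h => h2 (by rw [h])⟩, rfl⟩
    · rintro ⟨z, ⟨hz, h1, h2⟩, rfl⟩
      exact ⟨⟨z, hz, rfl⟩, fun h => h1 (cycleSet_injOn π hz hx h),
        fun h => h2 (cycleSet_injOn π hz hy h)⟩
  rw [seqExt, partitionedExt, hV, prod_insert hnot, hparts,
    prod_image ((cycleSet_injOn π).mono (by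
      intro z hz
      exact (mem_sdiff.1 hz).1))]
  congr 1
  · have : cycleMins π ∩ (cycleSet π x ∪ cycleSet π y) = {x, y} := by
      rw [inter_union_distrib_left, cycleMins_inter_cycleSet hx, cycleMins_inter_cycleSet hy]
      rfl
    rw [blockFactor, this, sort_insert, sort_singleton]
    · intro z hz
      rw [mem_singleton] at hz
      rw [hz]
      exact hxy.le
    · rw [mem_singleton]
      exact hxy.ne
  · exact prod_congr rfl fun z hz => blockFactor_cycleSet κ κ₂ _ (mem_sdiff.1 hz).1

variable {m n : ℕ}

theorem mem_PSNC' {Q : Finpartition (univ : Finset (Fin (m + n))) × Perm (Fin (m + n))} :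
    Q ∈ PSNC' m n ↔ ∃ π₁ ∈ NC m, ∃ π₂ ∈ NC n, ∃ i ∈ cycleMins π₁, ∃ j ∈ cycleMins π₂,
      Q.2 = prodPerm π₁ π₂ ∧
      Q.1.parts = insert (cycleSet (prodPerm π₁ π₂) (Fin.castAdd n i) ∪
          cycleSet (prodPerm π₁ π₂) (Fin.natAdd m j))
        ((cyclePartition (prodPerm π₁ π₂)).parts \
          {cycleSet (prodPerm π₁ π₂) (Fin.castAdd n i),
            cycleSet (prodPerm π₁ π₂) (Fin.natAdd m j)}) := by
  obtain ⟨V, π⟩ := Q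
  have hdef : (V, π) ∈ PSNC' m n ↔ (∃ π₁ ∈ NC m, ∃ π₂ ∈ NC n, π = prodPerm π₁ π₂) ∧
      ∃ C ∈ (cyclePartition π).parts, ∃ D ∈ (cyclePartition π).parts,
        (∀ k ∈ C, OnFirst m k) ∧ (∀ k ∈ D, ¬ OnFirst m k) ∧
        V.parts = insert (C ∪ D) ((cyclePartition π).parts \ {C, D}) := by
    simp only [PSNC', mem_filter, mem_univ, true_and]
  rw [hdef]
  constructor
  · rintro ⟨⟨π₁, h₁, π₂, h₂, rfl⟩, C, hC, D, hD, hC', hD', hV⟩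
    obtain ⟨x, hx, rfl⟩ := mem_parts_cyclePartition.1 hC
    obtain ⟨y, hy, rfl⟩ := mem_parts_cyclePartition.1 hD
    have hx' := hC' x (by simp [mem_cycleSet])
    have hy' := hD' y (by simp [mem_cycleSet])
    induction x using Fin.addCases with
    | right i => exact absurd hx' (not_onFirst_natAdd i)
    | left i =>
      induction y using Fin.addCases with
      | left j => exact absurd (onFirst_castAdd j) hy'
      | right j =>
        exact ⟨π₁, h₁, π₂, h₂, i, (castAdd_mem_cycleMins _ _).1 hx, j,
          (natAdd_mem_cycleMins _ _).1 hy, rfl, hV⟩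
  · rintro ⟨π₁, h₁, π₂, h₂, i, hi, j, hj, hπ, hV⟩
    simp only at hπ hV
    subst hπ
    refine ⟨⟨π₁, h₁, π₂, h₂, rfl⟩, _, mem_parts_cyclePartition.2
      ⟨_, (castAdd_mem_cycleMins _ _).2 hi, rfl⟩, _, mem_parts_cyclePartition.2
      ⟨_, (natAdd_mem_cycleMins _ _).2 hj, rfl⟩, ?_, ?_, hV⟩
    · intro k hk
      obtain ⟨l, -, rfl⟩ := (sameCycle_castAdd _ _).1 (mem_cycleSet.1 hk)
      exact onFirst_castAdd l
    · intro k hk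
      obtain ⟨l, -, rfl⟩ := (sameCycle_natAdd _ _).1 (mem_cycleSet.1 hk)
      exact not_onFirst_natAdd l

theorem seqExt_prodPerm {π₁ : Perm (Fin m)} {π₂ : Perm (Fin n)}
    {V : Finpartition (univ : Finset (Fin (m + n)))} {i : Fin m} {j : Fin n}
    (hi : i ∈ cycleMins π₁) (hj : j ∈ cycleMins π₂)
    (hV : V.parts = insert (cycleSet (prodPerm π₁ π₂) (Fin.castAdd n i) ∪
          cycleSet (prodPerm π₁ π₂) (Fin.natAdd m j))
        ((cyclePartition (prodPerm π₁ π₂)).parts \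
          {cycleSet (prodPerm π₁ π₂) (Fin.castAdd n i),
            cycleSet (prodPerm π₁ π₂) (Fin.natAdd m j)})) :
    seqExt κ κ₂ V (prodPerm π₁ π₂) = κ₂ (cycleLen π₁ i) (cycleLen π₂ j) *
      ((∏ y ∈ (cycleMins π₁).erase i, κ (cycleLen π₁ y)) *
        ∏ y ∈ (cycleMins π₂).erase j, κ (cycleLen π₂ y)) := by
  classical
  rw [seqExt_of_parts κ κ₂ ((castAdd_mem_cycleMins _ _).2 hi) ((natAdd_mem_cycleMins _ _).2 hj)
    (by rw [Fin.lt_def]; simp; omega) hV, cycleLen_castAdd, cycleLen_natAdd]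
  congr 1
  have hne : ∀ (a : Fin m) (b : Fin n), Fin.castAdd n a ≠ Fin.natAdd m b := fun a b h =>
    not_onFirst_natAdd b (h ▸ onFirst_castAdd a)
  have h1 : cycleMins (prodPerm π₁ π₂) \ {Fin.castAdd n i, Fin.natAdd m j} =
      (cycleMins (prodPerm π₁ π₂)).filter
        fun z => z ≠ Fin.castAdd n i ∧ z ≠ Fin.natAdd m j := by
    ext z
    simp
  rw [h1, prod_filter, prod_cycleMins_prodPerm]
  simp only [ne_eq, Fin.castAdd_inj, Fin.natAdd_inj, hne, (hne _ _).symm, not_false_eq_true,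
    and_true, true_and, cycleLen_castAdd, cycleLen_natAdd]
  rw [← prod_filter, ← prod_filter, filter_ne', filter_ne']

theorem sum_PSNC'_eq :
    ∑ Q ∈ PSNC' m n, seqExt κ κ₂ Q.1 Q.2 = ∑ r ∈ range (m + 1), ∑ s ∈ range (n + 1),
      markedSum κ m r * markedSum κ n s * κ₂ r s := by
  classical
  have hex : ∀ (π : Perm (Fin (m + n))) (x y : Fin (m + n)),
      ∃ V : Finpartition (univ : Finset (Fin (m + n))), x ∈ cycleMins π → y ∈ cycleMins π →
        V.parts = insert (cycleSet π x ∪ cycleSet π y)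
          ((cyclePartition π).parts \ {cycleSet π x, cycleSet π y}) := by
    intro π x y
    by_cases h : x ∈ cycleMins π ∧ y ∈ cycleMins π
    · obtain ⟨V, hV⟩ := exists_join (cyclePartition π)
        (mem_parts_cyclePartition.2 ⟨x, h.1, rfl⟩) (mem_parts_cyclePartition.2 ⟨y, h.2, rfl⟩)
      exact ⟨V, fun _ _ => hV⟩
    · exact ⟨cyclePartition π, fun h1 h2 => absurd ⟨h1, h2⟩ h⟩
  choose J hJ using hex
  have hJ' : ∀ {π₁ : Perm (Fin m)} {π₂ : Perm (Fin n)} {i : Fin m} {j : Fin n},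
      i ∈ cycleMins π₁ → j ∈ cycleMins π₂ → _ := fun {π₁ π₂ i j} hi hj =>
    hJ (prodPerm π₁ π₂) (Fin.castAdd n i) (Fin.natAdd m j) ((castAdd_mem_cycleMins _ _).2 hi)
      ((natAdd_mem_cycleMins _ _).2 hj)
  set S := (NC m).sigma fun π₁ => cycleMins π₁
  set T := (NC n).sigma fun π₂ => cycleMins π₂
  have h1 : ∑ Q ∈ PSNC' m n, seqExt κ κ₂ Q.1 Q.2 = ∑ p ∈ S ×ˢ T,
      κ₂ (cycleLen p.1.1 p.1.2) (cycleLen p.2.1 p.2.2) *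
        ((∏ y ∈ (cycleMins p.1.1).erase p.1.2, κ (cycleLen p.1.1 y)) *
          ∏ y ∈ (cycleMins p.2.1).erase p.2.2, κ (cycleLen p.2.1 y)) := by
    refine (sum_bij (fun p _ => (J (prodPerm p.1.1 p.2.1) (Fin.castAdd n p.1.2)
      (Fin.natAdd m p.2.2), prodPerm p.1.1 p.2.1)) ?_ ?_ ?_ ?_).symm
    · rintro ⟨⟨π₁, i⟩, ⟨π₂, j⟩⟩ hp
      simp only [mem_product, mem_sigma, S, T] at hp
      exact mem_PSNC'.2 ⟨π₁, hp.1.1, π₂, hp.2.1, i, hp.1.2, j, hp.2.2, rfl, hJ' hp.1.2 hp.2.2⟩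
    · rintro ⟨⟨π₁, i⟩, ⟨π₂, j⟩⟩ hp ⟨⟨σ₁, i'⟩, ⟨σ₂, j'⟩⟩ hp' h
      simp only [mem_product, mem_sigma, S, T] at hp hp'
      obtain ⟨h1, h2⟩ := Prod.mk.inj h
      obtain ⟨e1, e2⟩ := prodPerm_injective h2
      simp only at e1 e2 h1
      subst e1 e2
      have hV := hJ' hp.1.2 hp.2.2
      have hV' := hJ' hp'.1.2 hp'.2.2
      rw [h1, hV'] at hV
      have hmem : cycleSet (prodPerm π₁ π₂) (Fin.castAdd n i') ∪
          cycleSet (prodPerm π₁ π₂) (Fin.natAdd m j') ∈ insert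
            (cycleSet (prodPerm π₁ π₂) (Fin.castAdd n i) ∪
              cycleSet (prodPerm π₁ π₂) (Fin.natAdd m j))
            ((cyclePartition (prodPerm π₁ π₂)).parts \
              {cycleSet (prodPerm π₁ π₂) (Fin.castAdd n i),
                cycleSet (prodPerm π₁ π₂) (Fin.natAdd m j)}) := by
        rw [← hV]; exact mem_insert_self _ _
      have hi' : Fin.castAdd n i' ∈ cycleSet (prodPerm π₁ π₂) (Fin.castAdd n i') ∪
          cycleSet (prodPerm π₁ π₂) (Fin.natAdd m j') :=
        mem_union_left _ (by simp [mem_cycleSet])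
      have hj' : Fin.natAdd m j' ∈ cycleSet (prodPerm π₁ π₂) (Fin.castAdd n i') ∪
          cycleSet (prodPerm π₁ π₂) (Fin.natAdd m j') :=
        mem_union_right _ (by simp [mem_cycleSet])
      rw [mem_insert, mem_sdiff] at hmem
      rcases hmem with hmem | hmem
      · rw [hmem, mem_union, mem_cycleSet, mem_cycleSet] at hi' hj'
        have hi := (sameCycle_castAdd_castAdd _ _).1
          (hi'.resolve_right fun h => not_sameCycle_prodPerm _ _ _ _ h.symm)
        have hj := (sameCycle_natAdd_natAdd _ _).1
          (hj'.resolve_left (not_sameCycle_prodPerm _ _ _ _))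
        rw [eq_of_mem_cycleMins hp.1.2 hp'.1.2 hi, eq_of_mem_cycleMins hp.2.2 hp'.2.2 hj]
      · exact absurd ((cyclePartition_part _ hmem.1 hi').1 hj') (not_sameCycle_prodPerm _ _ _ _)
    · rintro ⟨V, π⟩ hQ
      obtain ⟨π₁, h₁, π₂, h₂, i, hi, j, hj, hπ, hV⟩ := mem_PSNC'.1 hQ
      simp only at hπ hV
      refine ⟨⟨⟨π₁, i⟩, ⟨π₂, j⟩⟩, by simp only [mem_product, mem_sigma, S, T]; tauto, ?_⟩
      refine Prod.ext (Finpartition.ext ?_) hπ.symm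
      rw [hV]
      exact hJ' hi hj
    · rintro ⟨⟨π₁, i⟩, ⟨π₂, j⟩⟩ hp
      simp only [mem_product, mem_sigma, S, T] at hp
      exact (seqExt_prodPerm κ κ₂ hp.1.2 hp.2.2 (hJ' hp.1.2 hp.2.2)).symm
  have h2 : ∀ (N r : ℕ), markedSum κ N r =
      ∑ p ∈ (NC N).sigma fun π => cycleMins π, markWeight κ r p.1 p.2 := fun N r => by
    rw [markedSum, sum_sigma]
  rw [h1]
  simp only [h2]
  have h3 : ∀ p ∈ S ×ˢ T, κ₂ (cycleLen p.1.1 p.1.2) (cycleLen p.2.1 p.2.2) *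
        ((∏ y ∈ (cycleMins p.1.1).erase p.1.2, κ (cycleLen p.1.1 y)) *
          ∏ y ∈ (cycleMins p.2.1).erase p.2.2, κ (cycleLen p.2.1 y)) =
      ∑ r ∈ range (m + 1), ∑ s ∈ range (n + 1),
        markWeight κ r p.1.1 p.1.2 * markWeight κ s p.2.1 p.2.2 * κ₂ r s := by
    intro p _
    have hr := Nat.lt_succ_of_le (cycleLen_le p.1.1 p.1.2)
    have hs := Nat.lt_succ_of_le (cycleLen_le p.2.1 p.2.2)
    rw [sum_eq_single (cycleLen p.1.1 p.1.2), sum_eq_single (cycleLen p.2.1 p.2.2)]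
    · simp only [markWeight, if_true, one_mul]
      ring
    · intro s _ hs
      simp [markWeight, hs.symm]
    · intro h
      exact absurd (mem_range.2 hs) h
    · intro r _ hr
      exact sum_eq_zero fun s _ => by simp [markWeight, hr.symm]
    · intro h
      exact absurd (mem_range.2 hr) h
  rw [sum_congr rfl h3, sum_comm]
  refine sum_congr rfl fun r _ => ?_
  rw [sum_comm]
  refine sum_congr rfl fun s _ => ?_
  rw [sum_mul_sum, ← sum_product', sum_mul]

theorem sum_PSNC_eq : ∑ Q ∈ PSNC m n, seqExt κ κ₂ Q.1 Q.2 =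
    ∑ π ∈ SNC m n, ∏ x ∈ cycleMins π, κ (cycleLen π x) +
      ∑ Q ∈ PSNC' m n, seqExt κ κ₂ Q.1 Q.2 := by
  classical
  have hd : Disjoint ((SNC m n).image fun π => (cyclePartition π, π)) (PSNC' m n) := by
    rw [disjoint_left]
    intro Q hQ hQ'
    obtain ⟨π, hπ, rfl⟩ := mem_image.1 hQ
    obtain ⟨π₁, -, π₂, -, i, -, j, -, hπ', -⟩ := mem_PSNC'.1 hQ'
    obtain ⟨⟨x, y, hx, hy, h⟩, -⟩ := mem_SNC.1 hπ
    simp only at hπ'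
    subst hπ'
    induction x using Fin.addCases with
    | right k => exact not_onFirst_natAdd k hx
    | left k =>
      obtain ⟨l, -, rfl⟩ := (sameCycle_castAdd _ _).1 h
      exact hy (onFirst_castAdd l)
  have : PSNC m n = (SNC m n).image (fun π => (cyclePartition π, π)) ∪ PSNC' m n := by
    ext Q
    simp [PSNC]
  rw [this, sum_union hd, sum_image fun _ _ _ _ h => (Prod.mk.inj h).2]
  simp only [seqExt_cyclePartition]

end Partitioned

section Logarithm
open PowerSeries

/-! ### The factorization of the kernels -/

section General
variable {R : Type*} [CommRing R] {c : ℕ → R}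

theorem derivative_sum_mul (hc : ∀ k : ℕ, c k * (k + 1) = 1) (K : ℕ) (h : PowerSeries R) :
    derivative R (∑ k ∈ range K, C (c k) * h ^ (k + 1)) * (1 - h) =
      (1 - h ^ K) * derivative R h := by
  have h1 : derivative R (∑ k ∈ range K, C (c k) * h ^ (k + 1)) =
      (∑ k ∈ range K, h ^ k) * derivative R h := by
    rw [map_sum, sum_mul]
    refine sum_congr rfl fun k _ => ?_
    have h2 : (C (c k) : PowerSeries R) * (k + 1 : ℕ) = 1 := by
      rw [← map_natCast (C (R := R)), ← map_mul, Nat.cast_succ, hc, map_one]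
    rw [Derivation.leibniz, derivative_C, smul_zero, add_zero, derivative_pow, smul_eq_mul,
      Nat.add_sub_cancel]
    linear_combination h ^ k * derivative R h * h2
  rw [h1, mul_right_comm, geom_sum_mul_neg]

theorem coeff_succ_sum_of_mul_eq (hc : ∀ k : ℕ, c k * (k + 1) = 1) {K n : ℕ} (hn : n < K)
    {h₁ h₂ h₃ h₄ : PowerSeries R}
    (hd₁ : X ∣ h₁) (hd₂ : X ∣ h₂) (hd₃ : X ∣ h₃) (hd₄ : X ∣ h₄)
    (h : (1 - h₁) * (1 - h₂) = (1 - h₃) * (1 - h₄)) :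
    coeff (n + 1) (∑ k ∈ range K, C (c k) * h₁ ^ (k + 1)) +
        coeff (n + 1) (∑ k ∈ range K, C (c k) * h₂ ^ (k + 1)) =
      coeff (n + 1) (∑ k ∈ range K, C (c k) * h₃ ^ (k + 1)) +
        coeff (n + 1) (∑ k ∈ range K, C (c k) * h₄ ^ (k + 1)) := by
  set D := derivative R with hD
  have e₁ := derivative_sum_mul hc K h₁
  have e₂ := derivative_sum_mul hc K h₂
  have e₃ := derivative_sum_mul hc K h₃
  have e₄ := derivative_sum_mul hc K h₄
  rw [← hD] at e₁ e₂ e₃ e₄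
  generalize ∑ k ∈ range K, C (c k) * h₁ ^ (k + 1) = L₁ at *
  generalize ∑ k ∈ range K, C (c k) * h₂ ^ (k + 1) = L₂ at *
  generalize ∑ k ∈ range K, C (c k) * h₃ ^ (k + 1) = L₃ at *
  generalize ∑ k ∈ range K, C (c k) * h₄ ^ (k + 1) = L₄ at *
  set L := L₁ + L₂ - L₃ - L₄ with hL
  have h' := congrArg D h
  simp only [Derivation.leibniz, map_sub, smul_eq_mul] at h'
  rw [Derivation.map_one_eq_zero] at h'
  have hu : IsUnit ((1 - h₁) * (1 - h₂) * ((1 - h₃) * (1 - h₄))) := by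
    rw [isUnit_iff_constantCoeff]
    rw [X_dvd_iff] at hd₁ hd₂ hd₃ hd₄
    simp [hd₁, hd₂, hd₃, hd₄]
  have hdvd : X ^ K ∣ D L := by
    rw [← hu.dvd_mul_right]
    obtain ⟨a₁, b₁⟩ := pow_dvd_pow_of_dvd hd₁ K
    obtain ⟨a₂, b₂⟩ := pow_dvd_pow_of_dvd hd₂ K
    obtain ⟨a₃, b₃⟩ := pow_dvd_pow_of_dvd hd₃ K
    obtain ⟨a₄, b₄⟩ := pow_dvd_pow_of_dvd hd₄ K
    rw [b₁] at e₁
    rw [b₂] at e₂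
    rw [b₃] at e₃
    rw [b₄] at e₄
    refine ⟨-(a₁ * D h₁ * (1 - h₂) * ((1 - h₃) * (1 - h₄)))
      - a₂ * D h₂ * (1 - h₁) * ((1 - h₃) * (1 - h₄))
      + a₃ * D h₃ * (1 - h₄) * ((1 - h₁) * (1 - h₂))
      + a₄ * D h₄ * (1 - h₃) * ((1 - h₁) * (1 - h₂)), ?_⟩
    rw [hL, map_sub, map_sub, map_add]
    linear_combination (1 - h₂) * ((1 - h₃) * (1 - h₄)) * e₁
      + (1 - h₁) * ((1 - h₃) * (1 - h₄)) * e₂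
      - (1 - h₄) * ((1 - h₁) * (1 - h₂)) * e₃
      - (1 - h₃) * ((1 - h₁) * (1 - h₂)) * e₄
      - ((1 - h₃) * (1 - h₄)) * h'
      + ((1 - h₃) * (0 - D h₄) + (1 - h₄) * (0 - D h₃)) * h
  have h0 := X_pow_dvd_iff.1 hdvd n hn
  rw [hD, coeff_derivative, hL, map_sub, map_sub, map_add] at h0
  linear_combination c n * h0 - (coeff (n + 1) L₁ + coeff (n + 1) L₂ - coeff (n + 1) L₃ -
    coeff (n + 1) L₄) * hc n

end General

theorem coeff_succ_logTrunc_of_mul_eq {K n : ℕ} (hn : n < K)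
    {h₁ h₂ h₃ h₄ : PowerSeries (PowerSeries ℂ)}
    (hd₁ : X ∣ h₁) (hd₂ : X ∣ h₂) (hd₃ : X ∣ h₃) (hd₄ : X ∣ h₄)
    (h : (1 - h₁) * (1 - h₂) = (1 - h₃) * (1 - h₄)) :
    coeff (n + 1) (logTrunc K h₁) + coeff (n + 1) (logTrunc K h₂) =
      coeff (n + 1) (logTrunc K h₃) + coeff (n + 1) (logTrunc K h₄) := by
  refine coeff_succ_sum_of_mul_eq (fun k => ?_) hn hd₁ hd₂ hd₃ hd₄ h
  rw [← map_natCast (C (R := ℂ)), ← map_one C, ← map_add, ← map_mul,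
    one_div_mul_cancel (Nat.cast_add_one_ne_zero k)]

theorem subst₂_logTrunc {P Q : PowerSeries ℂ} (hP : constantCoeff P = 0)
    (hQ : constantCoeff Q = 0) (K : ℕ) (f : PowerSeries (PowerSeries ℂ)) :
    subst₂ hP hQ (logTrunc K f) = logTrunc K (subst₂ hP hQ f) := by
  rw [logTrunc, logTrunc, map_sum]
  refine sum_congr rfl fun k _ => ?_
  rw [map_mul, map_pow, subst₂_C, subst_C_eq hP]

/-- The series `1 + ∑_{n ≥ 1} κ_n X^n`. -/
noncomputable def cumulantSeries (κ : ℕ → ℂ) : PowerSeries ℂ :=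
  mk fun n => if n = 0 then 1 else κ n

theorem momentSeries_eq_subst (κ : ℕ → ℂ) :
    momentSeries κ = subst (zMoment κ) (cumulantSeries κ) := by
  rw [momentSeries_eq_firstSeries, firstSeries_eq_subst]
  rfl

theorem sub_mul_one_sub_kernelSeries (κ : ℕ → ℂ) :
    (C X - X) * (1 - kernelSeries κ) =
      C X * PowerSeries.map C (cumulantSeries κ) - X * C (cumulantSeries κ) := by
  have key : ∀ i j : ℕ, coeff i (coeff j (kernelSeries κ)) =
    if i = 0 ∨ j = 0 then 0 else κ (i + j) := fun i j => by rw [kernelSeries, coeff_mk, coeff_mk]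
  have hS : ∀ i, coeff i (cumulantSeries κ) = if i = 0 then 1 else κ i := fun i => by
    rw [cumulantSeries, coeff_mk]
  have hC : ∀ i (a : ℂ), coeff i (C a) = if i = 0 then a else 0 := fun i a => coeff_C i a
  have hC₂ : ∀ i (a : PowerSeries ℂ), coeff i (C a) = if i = 0 then a else 0 :=
    fun i a => coeff_C i a
  rw [mul_sub, mul_one, sub_mul]
  ext j i
  simp only [map_sub, coeff_C_mul]
  obtain _ | j := j <;> obtain _ | i := i
  · simp only [coeff_zero_X_mul, hC₂, coeff_X, coeff_map]
    simp [-coeff_zero_eq_constantCoeff]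
  · simp only [coeff_zero_X_mul, coeff_succ_X_mul, key, coeff_map, hS, hC, hC₂, coeff_X]
    obtain _ | i := i <;> simp [coeff_X, -coeff_zero_eq_constantCoeff]
  · simp only [coeff_zero_X_mul, coeff_succ_X_mul, key, coeff_map, hC₂, coeff_X]
    obtain _ | j := j <;> simp [-coeff_zero_eq_constantCoeff, hS]
  · simp only [coeff_succ_X_mul, key, coeff_map, hS, hC, hC₂, coeff_X]
    obtain _ | j := j <;> obtain _ | i := i <;> simp [hS, -coeff_zero_eq_constantCoeff] <;> ring_nf

theorem sub_mul_one_sub_subst₂ (κ : ℕ → ℂ) {P Q : PowerSeries ℂ} (hP : constantCoeff P = 0)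
    (hQ : constantCoeff Q = 0) :
    (C P - PowerSeries.map C Q) * (1 - subst₂ hP hQ (kernelSeries κ)) =
      C P * PowerSeries.map C (subst Q (cumulantSeries κ)) -
        PowerSeries.map C Q * C (subst P (cumulantSeries κ)) := by
  have h := congrArg (subst₂ hP hQ) (sub_mul_one_sub_kernelSeries κ)
  have hX : subst₂ hP hQ X = PowerSeries.map C Q := by
    rw [← PowerSeries.map_X (C : ℂ →+* PowerSeries ℂ), subst₂_map_C,
      subst_X (HasSubst.of_constantCoeff_zero' hQ)]
  simpa only [map_mul, map_sub, map_one, subst₂_C, subst₂_map_C, hX,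
    subst_X (HasSubst.of_constantCoeff_zero' hP)] using h

theorem X_dvd_subst₂_kernelSeries (κ : ℕ → ℂ) {P Q : PowerSeries ℂ} (hP : constantCoeff P = 0)
    (hQ : constantCoeff Q = 0) : X ∣ subst₂ hP hQ (kernelSeries κ) := by
  rw [X_dvd_iff, ← coeff_zero_eq_constantCoeff_apply, coeff_subst₂' _ _ _ (Nat.lt_succ_self 0)]
  have h0 : coeff 0 (kernelSeries κ) = 0 := by
    ext i
    simp [kernelSeries, -coeff_zero_eq_constantCoeff]
  rw [sum_range_one, h0, ← substHom_apply hP, map_zero, zero_mul]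

end Logarithm

section Even
open PowerSeries

/-! ### Series of an even sequence of cumulants and of its square -/

theorem subst_eq_of_X_pow_dvd_sub {P Q : PowerSeries ℂ} (hP : constantCoeff P = 0)
    (hQ : constantCoeff Q = 0) {k : ℕ} (h : X ^ k ∣ P - Q) (f : PowerSeries ℂ) :
    X ^ k ∣ subst P f - subst Q f := by
  rw [X_pow_dvd_iff]
  intro n hn
  rw [map_sub, coeff_subst_eq_sum hP _ (Nat.lt_succ_self n),
    coeff_subst_eq_sum hQ _ (Nat.lt_succ_self n), ← sum_sub_distrib]
  refine sum_eq_zero fun d _ => ?_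
  rw [← mul_sub, ← map_sub, X_pow_dvd_iff.1 (h.trans (sub_dvd_pow_sub_pow P Q d)) n hn, mul_zero]

theorem eq_of_eq_subst_mul {U f Y Z : PowerSeries ℂ} (hU : constantCoeff U = 0)
    (hY : Y = subst (U * Y) f) (hZ : Z = subst (U * Z) f) : Y = Z := by
  refine eq_of_forall_X_pow_dvd_sub fun K => ?_
  induction K with
  | zero => simp
  | succ K ih =>
    have h1 : X ^ (K + 1) ∣ U * Y - U * Z := by
      rw [← mul_sub, pow_succ']
      exact mul_dvd_mul (X_dvd_iff.2 hU) ih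
    have h2 := subst_eq_of_X_pow_dvd_sub (by simp [hU]) (by simp [hU]) h1 f
    rwa [← hY, ← hZ] at h2

theorem expand_two_injective : Function.Injective (expand 2 two_ne_zero : PowerSeries ℂ →ₐ[ℂ] _) := by
  intro f g h
  ext n
  rw [← coeff_expand_mul 2 two_ne_zero f n, h, coeff_expand_mul]

/-- An even sequence `κ` and the sequence `κ'` such that the moments of `κ'` are the even moments
of `κ`. -/
structure EvenPair (κ κ' : ℕ → ℂ) : Prop where
  odd : ∀ n, Odd n → κ n = 0
  expand_momentSeries : expand 2 two_ne_zero (momentSeries κ') = momentSeries κ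

variable {κ κ' : ℕ → ℂ} (h : EvenPair κ κ')
include h

theorem EvenPair.cumulantSeries_eq :
    expand 2 two_ne_zero (cumulantSeries fun n => κ (2 * n)) = cumulantSeries κ := by
  ext n
  rw [coeff_expand, cumulantSeries, cumulantSeries, coeff_mk, coeff_mk]
  by_cases hn : 2 ∣ n
  · obtain ⟨m, rfl⟩ := hn
    rw [if_pos (dvd_mul_right _ _), Nat.mul_div_cancel_left _ two_pos]
    simp
  · rw [if_neg hn, if_neg (by rintro rfl; simp at hn),
      h.odd n (Nat.not_even_iff_odd.1 (mt even_iff_two_dvd.1 hn))]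

theorem EvenPair.zMoment_sq :
    zMoment κ ^ 2 = expand 2 two_ne_zero (zMoment κ' * momentSeries κ') := by
  rw [zMoment, zMoment, map_mul, map_mul, expand_X, h.expand_momentSeries]
  ring

theorem EvenPair.subst_of_sq_eq {P : PowerSeries ℂ} (hP : constantCoeff P = 0)
    (hsq : P ^ 2 = zMoment κ ^ 2) : subst P (cumulantSeries κ) = momentSeries κ := by
  have h1 : ∀ {P : PowerSeries ℂ}, constantCoeff P = 0 → subst P (cumulantSeries κ) =
      subst (P ^ 2) (cumulantSeries fun n => κ (2 * n)) := by
    intro P hP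
    rw [← h.cumulantSeries_eq, expand_apply,
      subst_comp_subst_apply (HasSubst.X_pow two_ne_zero) (HasSubst.of_constantCoeff_zero' hP),
      subst_pow (HasSubst.of_constantCoeff_zero' hP),
      subst_X (HasSubst.of_constantCoeff_zero' hP)]
  rw [h1 hP, hsq, ← h1 (constantCoeff_zMoment κ), ← momentSeries_eq_subst]

theorem EvenPair.momentSeries_eq_subst_sq : momentSeries κ =
    subst (zMoment κ ^ 2) (cumulantSeries fun n => κ (2 * n)) := by
  conv_lhs => rw [momentSeries_eq_subst, ← h.cumulantSeries_eq, expand_apply,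
      subst_comp_subst_apply (HasSubst.X_pow two_ne_zero)
        (HasSubst.of_constantCoeff_zero' (constantCoeff_zMoment κ)),
      subst_pow (HasSubst.of_constantCoeff_zero' (constantCoeff_zMoment κ)),
      subst_X (HasSubst.of_constantCoeff_zero' (constantCoeff_zMoment κ))]

theorem EvenPair.subst_expand_zMoment :
    subst (expand 2 two_ne_zero (zMoment κ')) (cumulantSeries κ') = momentSeries κ := by
  rw [← h.expand_momentSeries, momentSeries_eq_subst κ', expand_apply, expand_apply,
    subst_comp_subst_apply (HasSubst.of_constantCoeff_zero' (constantCoeff_zMoment κ'))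
      (HasSubst.X_pow two_ne_zero)]

theorem EvenPair.subst_zMoment :
    subst (zMoment κ') (zMoment fun n => κ (2 * n)) = zMoment κ' * momentSeries κ' := by
  have hU := HasSubst.of_constantCoeff_zero' (constantCoeff_zMoment κ')
  rw [zMoment.eq_def fun n => κ (2 * n), subst_mul hU, subst_X hU]
  congr 1
  refine eq_of_eq_subst_mul (constantCoeff_zMoment κ')
    (f := cumulantSeries fun n => κ (2 * n)) ?_ ?_
  · conv_lhs => rw [momentSeries_eq_subst (fun n => κ (2 * n)),
      subst_comp_subst_apply (HasSubst.of_constantCoeff_zero'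
        (constantCoeff_zMoment fun n => κ (2 * n))) hU,
      zMoment.eq_def fun n => κ (2 * n), subst_mul hU, subst_X hU]
  · refine expand_two_injective ?_
    rw [h.expand_momentSeries, h.momentSeries_eq_subst_sq, h.zMoment_sq, expand_apply, expand_apply,
      subst_comp_subst_apply (HasSubst.of_constantCoeff_zero'
        (by simp [constantCoeff_zMoment])) (HasSubst.X_pow two_ne_zero)]

theorem EvenPair.coeff_zMoment_pow (p i : ℕ) : coeff (2 * p) (zMoment κ ^ (2 * i)) =
    ∑ r ∈ range (p + 1), coeff r ((zMoment fun n => κ (2 * n)) ^ i) * coeff p (zMoment κ' ^ r) := by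
  have hU := HasSubst.of_constantCoeff_zero' (constantCoeff_zMoment κ')
  rw [pow_mul, h.zMoment_sq, ← map_pow, coeff_expand_mul, ← h.subst_zMoment, ← subst_pow hU,
    coeff_subst_eq_sum (constantCoeff_zMoment κ') _ (Nat.lt_succ_self p)]

theorem EvenPair.coeff_zMoment_pow_odd (p : ℕ) {i : ℕ} (hi : Odd i) :
    coeff (2 * p) (zMoment κ ^ i) = 0 := by
  obtain ⟨j, rfl⟩ := hi
  rw [pow_succ, pow_mul, h.zMoment_sq, zMoment.eq_def κ, ← h.expand_momentSeries, mul_left_comm, ← map_pow,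
    ← map_mul]
  obtain _ | p := p
  · simp
  · rw [show 2 * (p + 1) = 2 * p + 1 + 1 by ring, coeff_succ_X_mul,
      coeff_expand_of_not_dvd _ _ _ (by omega)]

theorem EvenPair.one_sub_mul_one_sub (hP : constantCoeff (-zMoment κ) = 0)
    (hU : constantCoeff (expand 2 two_ne_zero (zMoment κ')) = 0)
    (hS : constantCoeff (zMoment κ ^ 2) = 0) :
    (1 - momentKernel κ κ) *
        (1 - subst₂ (constantCoeff_zMoment κ) hP (kernelSeries κ)) =
      (1 - subst₂ hU hU (kernelSeries κ')) *
        (1 - subst₂ hS hS (kernelSeries fun n => κ (2 * n))) := by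
  have hu := constantCoeff_zMoment κ
  have e₁ := sub_mul_one_sub_subst₂ κ hu hu
  have e₂ := sub_mul_one_sub_subst₂ κ hu hP
  have e₃ := sub_mul_one_sub_subst₂ κ' hU hU
  have e₄ := sub_mul_one_sub_subst₂ (fun n => κ (2 * n)) hS hS
  rw [h.subst_of_sq_eq hu rfl] at e₁ e₂
  rw [h.subst_of_sq_eq hP (neg_sq _)] at e₂
  rw [h.subst_expand_zMoment] at e₃
  rw [← h.momentSeries_eq_subst_sq] at e₄
  have hexp : expand 2 two_ne_zero (zMoment κ') = X ^ 2 * momentSeries κ := by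
    rw [zMoment, map_mul, expand_X, h.expand_momentSeries]
  have hM : momentSeries κ ≠ 0 := fun h0 => by
    have h1 := congrArg (coeff 0) h0
    rw [momentSeries, coeff_mk, ncSum_zero, map_zero] at h1
    exact one_ne_zero h1
  have hn₁ : (C (X ^ 2 * momentSeries κ) - PowerSeries.map C (X ^ 2 * momentSeries κ) :
      PowerSeries (PowerSeries ℂ)) ≠ 0 := fun h0 => by
    have h1 := congrArg constantCoeff h0
    simp [hM] at h1
  have hn₂ : (C (zMoment κ ^ 2) - PowerSeries.map C (zMoment κ ^ 2) :
      PowerSeries (PowerSeries ℂ)) ≠ 0 := fun h0 => by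
    have h1 := congrArg constantCoeff h0
    simp [zMoment, hM] at h1
  refine mul_left_cancel₀ (mul_ne_zero hn₁ hn₂) ?_
  rw [← momentKernel] at e₁
  generalize (1 - subst₂ hU hU (kernelSeries κ')) = F₃ at *
  generalize 1 - subst₂ hS hS (kernelSeries fun n => κ (2 * n)) = F₄ at *
  generalize 1 - subst₂ hu hP (kernelSeries κ) = F₂ at *
  rw [hexp] at e₃
  simp only [zMoment, map_neg, map_pow, map_mul, PowerSeries.map_X] at e₁ e₂ e₃ e₄ ⊢
  generalize (C (momentSeries κ) : PowerSeries (PowerSeries ℂ)) = A at *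
  generalize (PowerSeries.map C (momentSeries κ) : PowerSeries (PowerSeries ℂ)) = B at *
  generalize (C X : PowerSeries (PowerSeries ℂ)) = x at *
  generalize (X : PowerSeries (PowerSeries ℂ)) = y at *
  linear_combination (x ^ 2 * A - y ^ 2 * B) * ((x * A + y * B) * F₂ * e₁ +
    (x * A * B - y * B * A) * e₂) - (x ^ 2 * A ^ 2 - y ^ 2 * B ^ 2) * F₄ * e₃ -
    (x ^ 2 * A * B - y ^ 2 * B * A) * e₄

end Even

section Logs
open PowerSeries

theorem coeff_logTrunc_subst₂ {P Q : PowerSeries ℂ} (hP : constantCoeff P = 0)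
    (hQ : constantCoeff Q = 0) (K : ℕ) (f : PowerSeries (PowerSeries ℂ)) {m n I J : ℕ} (hI : m < I)
    (hJ : n < J) : coeff m (coeff n (logTrunc K (subst₂ hP hQ f))) =
      ∑ j ∈ range J, ∑ i ∈ range I,
        coeff i (coeff j (logTrunc K f)) * coeff m (P ^ i) * coeff n (Q ^ j) := by
  rw [← subst₂_logTrunc, coeff_subst₂ hP hQ _ hI hJ]

theorem sum_range_two_mul_add_one {f : ℕ → ℂ} (hf : ∀ i, Odd i → f i = 0) (p : ℕ) :
    ∑ i ∈ range (2 * p + 1), f i = ∑ i ∈ range (p + 1), f (2 * i) := by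
  induction p with
  | zero => simp
  | succ p ih =>
    rw [sum_range_succ _ (p + 1), ← ih, show 2 * (p + 1) + 1 = 2 * p + 1 + 1 + 1 by ring,
      sum_range_succ, sum_range_succ, hf (2 * p + 1) (odd_two_mul_add_one p), add_zero]
    rfl

theorem sum_comm_pair {s t u v : Finset ℕ} (F : ℕ → ℕ → ℕ → ℕ → ℂ) :
    ∑ i ∈ s, ∑ j ∈ t, ∑ k ∈ u, ∑ l ∈ v, F i j k l =
      ∑ k ∈ u, ∑ l ∈ v, ∑ i ∈ s, ∑ j ∈ t, F i j k l := by
  calc _ = ∑ i ∈ s, ∑ k ∈ u, ∑ j ∈ t, ∑ l ∈ v, F i j k l := sum_congr rfl fun i _ => sum_comm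
    _ = ∑ k ∈ u, ∑ i ∈ s, ∑ j ∈ t, ∑ l ∈ v, F i j k l := sum_comm
    _ = ∑ k ∈ u, ∑ i ∈ s, ∑ l ∈ v, ∑ j ∈ t, F i j k l :=
      sum_congr rfl fun k _ => sum_congr rfl fun i _ => sum_comm
    _ = _ := sum_congr rfl fun k _ => sum_comm

variable {κ κ' : ℕ → ℂ} (h : EvenPair κ κ')
include h

theorem EvenPair.coeff_logTrunc_momentKernel (K p q : ℕ) :
    coeff (2 * p) (coeff (2 * q) (logTrunc K (momentKernel κ κ))) =
      ∑ j ∈ range (q + 1), ∑ i ∈ range (p + 1),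
        coeff (2 * i) (coeff (2 * j) (logTrunc K (kernelSeries κ))) *
          coeff (2 * p) (zMoment κ ^ (2 * i)) * coeff (2 * q) (zMoment κ ^ (2 * j)) := by
  rw [momentKernel, coeff_logTrunc_subst₂ _ _ _ _ (Nat.lt_succ_self _) (Nat.lt_succ_self _),
    sum_range_two_mul_add_one]
  · refine sum_congr rfl fun j _ => ?_
    rw [sum_range_two_mul_add_one]
    intro i hi
    rw [h.coeff_zMoment_pow_odd p hi, mul_zero, zero_mul]
  · intro j hj
    refine sum_eq_zero fun i _ => ?_
    rw [h.coeff_zMoment_pow_odd q hj, mul_zero]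

theorem EvenPair.two_mul_coeff_logTrunc {K p q : ℕ} (hq : 1 ≤ q) (hK : 2 * q ≤ K) :
    2 * coeff (2 * p) (coeff (2 * q) (logTrunc K (momentKernel κ κ))) =
      coeff p (coeff q (logTrunc K (momentKernel κ' κ'))) +
        ∑ s ∈ range (q + 1), ∑ r ∈ range (p + 1), coeff r (coeff s (logTrunc K
          (momentKernel (fun n => κ (2 * n)) fun n => κ (2 * n)))) *
            coeff p (zMoment κ' ^ r) * coeff q (zMoment κ' ^ s) := by
  have hu := constantCoeff_zMoment κ
  have hP : constantCoeff (-zMoment κ) = 0 := by rw [map_neg, hu, neg_zero]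
  have hU : constantCoeff (expand 2 two_ne_zero (zMoment κ')) = 0 := by
    rw [constantCoeff_expand, constantCoeff_zMoment]
  have hS : constantCoeff (zMoment κ ^ 2) = 0 := by rw [map_pow, hu, zero_pow two_ne_zero]
  have hmain := coeff_succ_logTrunc_of_mul_eq (show 2 * q - 1 < K by omega)
    (X_dvd_momentKernel κ κ) (X_dvd_subst₂_kernelSeries κ hu hP)
    (X_dvd_subst₂_kernelSeries κ' hU hU) (X_dvd_subst₂_kernelSeries (fun n => κ (2 * n)) hS hS)
    (h.one_sub_mul_one_sub hP hU hS)
  rw [Nat.sub_add_cancel (by omega)] at hmain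
  have hmain' := congrArg (coeff (2 * p)) hmain
  rw [map_add, map_add] at hmain'
  have h₂ : coeff (2 * p) (coeff (2 * q) (logTrunc K (subst₂ hu hP (kernelSeries κ)))) =
      coeff (2 * p) (coeff (2 * q) (logTrunc K (momentKernel κ κ))) := by
    rw [momentKernel, coeff_logTrunc_subst₂ _ _ _ _ (Nat.lt_succ_self _) (Nat.lt_succ_self _),
      coeff_logTrunc_subst₂ _ _ _ _ (Nat.lt_succ_self _) (Nat.lt_succ_self _)]
    refine sum_congr rfl fun j _ => sum_congr rfl fun i _ => ?_
    rcases Nat.even_or_odd j with hj | hj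
    · rw [hj.neg_pow]
    · rw [hj.neg_pow, map_neg, h.coeff_zMoment_pow_odd q hj, neg_zero]
  have h₃ : coeff (2 * p) (coeff (2 * q) (logTrunc K (subst₂ hU hU (kernelSeries κ')))) =
      coeff p (coeff q (logTrunc K (momentKernel κ' κ'))) := by
    rw [momentKernel, coeff_logTrunc_subst₂ _ _ _ _ (Nat.lt_succ_self _) (Nat.lt_succ_self _),
      coeff_logTrunc_subst₂ _ _ _ _ (show p < 2 * p + 1 by omega) (show q < 2 * q + 1 by omega)]
    refine sum_congr rfl fun j _ => sum_congr rfl fun i _ => ?_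
    rw [← map_pow, ← map_pow, coeff_expand_mul, coeff_expand_mul]
  have h₄ : coeff (2 * p) (coeff (2 * q)
      (logTrunc K (subst₂ hS hS (kernelSeries fun n => κ (2 * n))))) =
      ∑ s ∈ range (q + 1), ∑ r ∈ range (p + 1), coeff r (coeff s (logTrunc K
          (momentKernel (fun n => κ (2 * n)) fun n => κ (2 * n)))) *
            coeff p (zMoment κ' ^ r) * coeff q (zMoment κ' ^ s) := by
    rw [coeff_logTrunc_subst₂ _ _ _ _ (Nat.lt_succ_self _) (Nat.lt_succ_self _)]
    simp only [← pow_mul, h.coeff_zMoment_pow]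
    have h5 : ∀ s ∈ range (q + 1), ∀ r ∈ range (p + 1), coeff r (coeff s (logTrunc K
          (momentKernel (fun n => κ (2 * n)) fun n => κ (2 * n)))) = _ :=
      fun s hs r hr => coeff_logTrunc_subst₂ _ _ K _
        (show r < 2 * p + 1 by rw [mem_range] at hr; omega)
        (show s < 2 * q + 1 by rw [mem_range] at hs; omega)
    refine Eq.trans ?_ (sum_congr rfl fun s hs => sum_congr rfl fun r hr => congrArg
      (fun z => z * coeff p (zMoment κ' ^ r) * coeff q (zMoment κ' ^ s)) (h5 s hs r hr)).symm
    simp only [sum_mul, mul_sum]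
    rw [sum_comm_pair]
    refine sum_congr rfl fun s _ => sum_congr rfl fun r _ => sum_congr rfl fun j _ =>
      sum_congr rfl fun i _ => ?_
    ring
  rw [h₂, h₃, h₄] at hmain'
  rw [two_mul]
  exact hmain'

end Logs

section Numbers
open PowerSeries

/-! ### Second order cumulants of the square -/

theorem markedSum_zero_right (g : ℕ → ℂ) (n : ℕ) : markedSum g n 0 = 0 :=
  sum_eq_zero fun π _ => sum_eq_zero fun x _ => by
    rw [markWeight, if_neg (cycleLen_pos π x).ne', zero_mul]

theorem markedSum_eq_zero_of_lt (g : ℕ → ℂ) {n r : ℕ} (h : n < r) : markedSum g n r = 0 :=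
  sum_eq_zero fun π _ => sum_eq_zero fun x _ => by
    rw [markWeight, if_neg ((cycleLen_le π x).trans_lt h).ne, zero_mul]

theorem mul_markedSum' (g : ℕ → ℂ) {n : ℕ} (hn : 1 ≤ n) (r : ℕ) :
    (r : ℂ) * markedSum g n r = n * coeff n (zMoment g ^ r) := by
  obtain ⟨n, rfl⟩ := Nat.exists_eq_add_of_le' hn
  exact mul_markedSum g n r

theorem markedSum_self (g : ℕ → ℂ) {n : ℕ} (hn : 1 ≤ n) : markedSum g n n = 1 := by
  have h := mul_markedSum' g hn n
  have hn' : (n : ℂ) ≠ 0 := Nat.cast_ne_zero.2 (by omega)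
  have h1 : coeff n (zMoment g ^ n) = 1 := by
    have h2 := coeff_X_pow_mul (momentSeries g ^ n) n 0
    rw [zero_add] at h2
    rw [zMoment, mul_pow, h2, coeff_zero_eq_constantCoeff_apply, map_pow,
      ← coeff_zero_eq_constantCoeff_apply, momentSeries, coeff_mk, ncSum_zero, one_pow]
  rw [h1] at h
  exact mul_left_cancel₀ hn' h

/-- The sum of the weights of the annular non-crossing permutations. -/
noncomputable def annularSum (κ : ℕ → ℂ) (m n : ℕ) : ℂ :=
  ∑ π ∈ SNC m n, ∏ x ∈ cycleMins π, κ (cycleLen π x)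

theorem annularSum_eq (κ : ℕ → ℂ) {m n K : ℕ} (hm : 1 ≤ m) (hn : 1 ≤ n) (hK : n < K) :
    annularSum κ m n = m * n * coeff m (coeff n (logTrunc K (momentKernel κ κ))) := by
  rw [← sum_SNC_throughWeight κ κ hm hn hK]
  refine sum_congr rfl fun π _ => prod_congr rfl fun x _ => ?_
  rw [throughWeight, one_mul, ite_self, card_block]

theorem zMoment_zero : zMoment (fun _ => 0) = X := by
  rw [zMoment]
  convert mul_one X
  rw [momentSeries_eq_subst]
  have : cumulantSeries (fun _ => 0) = C 1 := by
    ext n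
    rw [cumulantSeries, coeff_mk, coeff_C]
  rw [this, subst_C_eq (constantCoeff_zMoment _), map_one]

theorem momentKernel_zero (κ : ℕ → ℂ) : momentKernel (fun _ => 0) κ = kernelSeries κ := by
  ext n m
  rw [momentKernel, coeff_subst₂ _ _ _ (Nat.lt_succ_self m) (Nat.lt_succ_self n),
    sum_eq_single n, sum_eq_single m]
  · simp [zMoment_zero]
  · intro i _ hi
    simp [zMoment_zero, coeff_X_pow, hi.symm]
  · simp
  · intro j _ hj
    simp [zMoment_zero, coeff_X_pow, hj.symm]
  · simp

/-- The sum of the weights of the permutations in `SNCPlusAll m n`. -/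
noncomputable def plusSum (κ : ℕ → ℂ) (m n : ℕ) : ℂ :=
  ∑ π ∈ SNCPlusAll m n, ∏ x ∈ cycleMins π, κ (cycleLen π x)

theorem plusSum_eq {κ : ℕ → ℂ} (hκ : ∀ l, Odd l → κ l = 0) {r s K : ℕ} (hr : 1 ≤ r) (hs : 1 ≤ s)
    (hK : 2 * s < K) : plusSum κ (2 * r) (2 * s) =
      2 * r * s * coeff (2 * r) (coeff (2 * s) (logTrunc K (kernelSeries κ))) := by
  have h := sum_SNCPlusAll κ hκ (m := 2 * r - 1) (n := 2 * s - 1)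
    (by rw [Nat.sub_add_cancel (by omega)]; exact even_two_mul r)
    (by rw [Nat.sub_add_cancel (by omega)]; exact even_two_mul s)
  rw [Nat.sub_add_cancel (by omega), Nat.sub_add_cancel (by omega),
    sum_SNC_throughWeight _ κ (by omega) (by omega) hK, momentKernel_zero] at h
  rw [plusSum]
  push_cast at h
  linear_combination h / 2

variable {κ κ' : ℕ → ℂ} (h : EvenPair κ κ')
include h

theorem EvenPair.markedSum_odd {p i : ℕ} (hp : 1 ≤ p) (hi : Odd i) :
    markedSum κ (2 * p) i = 0 := by
  have h1 := mul_markedSum' κ (show 1 ≤ 2 * p by omega) i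
  rw [h.coeff_zMoment_pow_odd p hi, mul_zero] at h1
  exact (mul_eq_zero.1 h1).resolve_left (Nat.cast_ne_zero.2 (by rintro rfl; simp at hi))

theorem EvenPair.markedSum_two_mul {p : ℕ} (hp : 1 ≤ p) (i : ℕ) :
    markedSum κ (2 * p) (2 * i) =
      ∑ r ∈ range (p + 1), markedSum κ' p r * markedSum (fun n => κ (2 * n)) r i := by
  obtain rfl | hi := Nat.eq_zero_or_pos i
  · simp [markedSum_zero_right]
  have h1 := mul_markedSum' κ (show 1 ≤ 2 * p by omega) (2 * i)
  rw [h.coeff_zMoment_pow, mul_sum] at h1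
  have hi' : (i : ℂ) ≠ 0 := Nat.cast_ne_zero.2 hi.ne'
  refine mul_left_cancel₀ (mul_ne_zero two_ne_zero hi') ?_
  push_cast at h1
  rw [h1, mul_sum]
  refine sum_congr rfl fun r _ => ?_
  obtain rfl | hr := Nat.eq_zero_or_pos r
  · rw [markedSum_zero_right, coeff_pow_eq_zero (constantCoeff_zMoment _) hi]
    ring
  have h2 := mul_markedSum' κ' hp r
  have h3 := mul_markedSum' (fun n => κ (2 * n)) hr i
  linear_combination (-2 * coeff r (zMoment (fun n => κ (2 * n)) ^ i)) * h2 -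
    2 * markedSum κ' p r * h3

/-- The second order cumulants of the square are determined by the second order moments. -/
theorem EvenPair.second_order (κ₂ κ₂' : ℕ → ℕ → ℂ)
    (hmom : ∀ p q, 1 ≤ p → 1 ≤ q →
      annularSum κ (2 * p) (2 * q) + ∑ r ∈ range (2 * p + 1), ∑ s ∈ range (2 * q + 1),
          markedSum κ (2 * p) r * markedSum κ (2 * q) s * κ₂ r s =
        annularSum κ' p q + ∑ r ∈ range (p + 1), ∑ s ∈ range (q + 1),
          markedSum κ' p r * markedSum κ' q s * κ₂' r s) (p q : ℕ) (hp : 1 ≤ p) (hq : 1 ≤ q) :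
    κ₂' p q = annularSum (fun n => κ (2 * n)) p q + ∑ r ∈ range (p + 1), ∑ s ∈ range (q + 1),
      markedSum (fun n => κ (2 * n)) p r * markedSum (fun n => κ (2 * n)) q s *
        (κ₂ (2 * r) (2 * s) + plusSum κ (2 * r) (2 * s)) := by
  set β : ℕ → ℂ := fun n => κ (2 * n) with hβ
  set G : ℕ → ℕ → ℂ := fun r s => κ₂ (2 * r) (2 * s) + plusSum κ (2 * r) (2 * s) with hG
  set R : ℕ → ℕ → ℂ := fun p q => annularSum β p q + ∑ r ∈ range (p + 1), ∑ s ∈ range (q + 1),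
      markedSum β p r * markedSum β q s * G r s with hR
  have key : ∀ p q, 1 ≤ p → 1 ≤ q → ∑ r ∈ range (p + 1), ∑ s ∈ range (q + 1),
      markedSum κ' p r * markedSum κ' q s * κ₂' r s = ∑ r ∈ range (p + 1), ∑ s ∈ range (q + 1),
      markedSum κ' p r * markedSum κ' q s * R r s := by
    intro p q hp hq
    have hL := h.two_mul_coeff_logTrunc (p := p) hq (Nat.le_succ (2 * q))
    have h1 : ∑ r ∈ range (p + 1), ∑ s ∈ range (q + 1),
        markedSum κ' p r * markedSum κ' q s * annularSum β r s =
        p * q * ∑ s ∈ range (q + 1), ∑ r ∈ range (p + 1), coeff r (coeff s (logTrunc (2 * q + 1)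
          (momentKernel β β))) * coeff p (zMoment κ' ^ r) * coeff q (zMoment κ' ^ s) := by
      rw [sum_comm (s := range (q + 1)), mul_sum]
      refine sum_congr rfl fun r _ => ?_
      rw [mul_sum]
      refine sum_congr rfl fun s hs => ?_
      rw [mem_range] at hs
      have e₁ := mul_markedSum' κ' hp r
      have e₂ := mul_markedSum' κ' hq s
      obtain rfl | hr := Nat.eq_zero_or_pos r
      · rw [Nat.cast_zero, zero_mul] at e₁
        rw [markedSum_zero_right]
        linear_combination q * coeff 0 (coeff s (logTrunc (2 * q + 1)
          (momentKernel β β))) * coeff q (zMoment κ' ^ s) * e₁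
      obtain rfl | hs' := Nat.eq_zero_or_pos s
      · rw [Nat.cast_zero, zero_mul] at e₂
        rw [markedSum_zero_right]
        linear_combination p * coeff r (coeff 0 (logTrunc (2 * q + 1)
          (momentKernel β β))) * coeff p (zMoment κ' ^ r) * e₂
      rw [annularSum_eq β hr hs' (show s < 2 * q + 1 by omega)]
      generalize coeff r (coeff s (logTrunc (2 * q + 1) (momentKernel β β))) = c
      linear_combination c * s * markedSum κ' q s * e₁ + c * p * coeff p (zMoment κ' ^ r) * e₂
    have h2 : ∑ r ∈ range (p + 1), ∑ s ∈ range (q + 1), markedSum κ' p r * markedSum κ' q s *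
        ∑ i ∈ range (r + 1), ∑ j ∈ range (s + 1), markedSum β r i * markedSum β s j * G i j =
        ∑ i ∈ range (p + 1), ∑ j ∈ range (q + 1),
          markedSum κ (2 * p) (2 * i) * markedSum κ (2 * q) (2 * j) * G i j := by
      have hext : ∀ r ∈ range (p + 1), ∀ s ∈ range (q + 1),
          ∑ i ∈ range (r + 1), ∑ j ∈ range (s + 1), markedSum β r i * markedSum β s j * G i j =
          ∑ i ∈ range (p + 1), ∑ j ∈ range (q + 1), markedSum β r i * markedSum β s j * G i j := by
        intro r hr s hs
        rw [mem_range] at hr hs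
        rw [← sum_subset (range_subset_range.2 (show r + 1 ≤ p + 1 by omega))]
        · refine sum_congr rfl fun i _ => sum_subset (range_subset_range.2 (by omega)) ?_
          intro j _ hj
          rw [markedSum_eq_zero_of_lt β (n := s) (r := j) (by simpa using hj), mul_zero, zero_mul]
        · intro i _ hi
          rw [markedSum_eq_zero_of_lt β (by simpa using hi)]
          simp
      refine (sum_congr rfl fun r hr => sum_congr rfl fun s hs => congrArg
        (fun z => markedSum κ' p r * markedSum κ' q s * z) (hext r hr s hs)).trans ?_
      simp only [mul_sum]
      rw [sum_comm_pair]
      refine sum_congr rfl fun i _ => sum_congr rfl fun j _ => ?_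
      rw [h.markedSum_two_mul hp, h.markedSum_two_mul hq, sum_mul_sum, sum_mul]
      refine sum_congr rfl fun r _ => ?_
      rw [sum_mul]
      refine sum_congr rfl fun s _ => ?_
      ring
    have h3 : ∑ i ∈ range (p + 1), ∑ j ∈ range (q + 1),
          markedSum κ (2 * p) (2 * i) * markedSum κ (2 * q) (2 * j) * plusSum κ (2 * i) (2 * j) =
        2 * p * q * coeff (2 * p) (coeff (2 * q) (logTrunc (2 * q + 1) (momentKernel κ κ))) := by
      rw [h.coeff_logTrunc_momentKernel, sum_comm (s := range (q + 1)), mul_sum]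
      refine sum_congr rfl fun i _ => ?_
      rw [mul_sum]
      refine sum_congr rfl fun j hj => ?_
      rw [mem_range] at hj
      have e₁ := mul_markedSum' κ (show 1 ≤ 2 * p by omega) (2 * i)
      have e₂ := mul_markedSum' κ (show 1 ≤ 2 * q by omega) (2 * j)
      push_cast at e₁ e₂
      obtain rfl | hi := Nat.eq_zero_or_pos i
      · rw [mul_zero, markedSum_zero_right, pow_zero, coeff_one, if_neg (by omega)]
        ring
      obtain rfl | hj' := Nat.eq_zero_or_pos j
      · rw [mul_zero, markedSum_zero_right, pow_zero, coeff_one, if_neg (by omega)]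
        ring
      rw [plusSum_eq h.odd hi hj' (show 2 * j < 2 * q + 1 by omega)]
      generalize coeff (2 * i) (coeff (2 * j) (logTrunc (2 * q + 1) (kernelSeries κ))) = c
      linear_combination c * j * markedSum κ (2 * q) (2 * j) * e₁ +
        c * p * coeff (2 * p) (zMoment κ ^ (2 * i)) * e₂
    have h4 : ∑ r ∈ range (2 * p + 1), ∑ s ∈ range (2 * q + 1),
          markedSum κ (2 * p) r * markedSum κ (2 * q) s * κ₂ r s =
        ∑ i ∈ range (p + 1), ∑ j ∈ range (q + 1),
          markedSum κ (2 * p) (2 * i) * markedSum κ (2 * q) (2 * j) * κ₂ (2 * i) (2 * j) := by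
      rw [sum_range_two_mul_add_one]
      · refine sum_congr rfl fun i _ => ?_
        rw [sum_range_two_mul_add_one]
        intro j hj
        rw [h.markedSum_odd hq hj, mul_zero, zero_mul]
      · intro i hi
        refine sum_eq_zero fun j _ => ?_
        rw [h.markedSum_odd hp hi, zero_mul, zero_mul]
    have hm := hmom p q hp hq
    rw [h4, annularSum_eq κ (by omega) (by omega) (Nat.lt_succ_self _),
      annularSum_eq κ' hp hq (show q < 2 * q + 1 by omega)] at hm
    simp only [hR, mul_add, sum_add_distrib]
    rw [h1, h2]
    simp only [hG, mul_add, sum_add_distrib]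
    rw [h3]
    push_cast at hm
    linear_combination -hm + p * q * hL
  have hind : ∀ N p q, p + q = N → 1 ≤ p → 1 ≤ q → κ₂' p q = R p q := by
    intro N
    induction N using Nat.strong_induction_on with
    | _ N ih =>
      intro p q hN hp hq
      have hk := key p q hp hq
      rw [← sub_eq_zero, ← sum_sub_distrib, sum_eq_single p, ← sum_sub_distrib,
        sum_eq_single q] at hk
      · rw [markedSum_self κ' hp, markedSum_self κ' hq] at hk
        linear_combination hk
      · intro s hs hsq
        rw [mem_range] at hs
        obtain rfl | hs' := Nat.eq_zero_or_pos s
        · rw [markedSum_zero_right]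
          ring
        · rw [ih (p + s) (by omega) p s rfl hp hs', sub_self]
      · simp
      · intro r hr hrp
        rw [mem_range] at hr
        rw [← sum_sub_distrib]
        refine sum_eq_zero fun s hs => ?_
        rw [mem_range] at hs
        obtain rfl | hr' := Nat.eq_zero_or_pos r
        · rw [markedSum_zero_right]
          ring
        obtain rfl | hs' := Nat.eq_zero_or_pos s
        · rw [markedSum_zero_right]
          ring
        · rw [ih (r + s) (by omega) r s rfl hr' hs', sub_self]
      · simp
  exact hind _ p q rfl hp hq

end Numbers

section Probability
open PowerSeries

/-! ### Application to second order even elements -/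

variable {A : Type*} [Ring A] [StarRing A] [Algebra ℂ A] [StarModule ℂ A]
  (P : ProbabilitySpace A) (x : A)

/-- The free cumulants of a single element. -/
noncomputable def cumulantsOf (n : ℕ) : ℂ := cumulant P n fun _ => x

/-- The second order free cumulants of a single element. -/
noncomputable def cumulantsOf₂ (m n : ℕ) : ℂ := cumulant₂ P m n (fun _ => x) fun _ => x

theorem ncSum_card (κ : ℕ → ℂ) (n : ℕ) : ncSum (fun B => κ #B) n =
    ∑ π ∈ NC n, ∏ x ∈ cycleMins π, κ (cycleLen π x) := by
  refine sum_congr rfl fun π _ => prod_congr rfl fun x _ => ?_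
  exact congrArg κ (card_block π x)

theorem coeff_momentSeries_cumulantsOf (n : ℕ) :
    coeff n (momentSeries (cumulantsOf P x)) = P.φ (x ^ n) := by
  rw [momentSeries, coeff_mk]
  obtain rfl | hn := Nat.eq_zero_or_pos n
  · rw [ncSum_zero, pow_zero, P.map_one]
  · rw [ncSum_card]
    have h := moment_cumulant P n hn fun _ => x
    rw [List.ofFn_const, List.prod_replicate] at h
    exact h.symm

theorem sum_cycleLen {n : ℕ} (π : Perm (Fin n)) : ∑ x ∈ cycleMins π, cycleLen π x = n := by
  have h := sum_eq_sum_cycleMins (π := π) (f := fun _ => 1) fun _ _ _ => rfl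
  simp only [sum_const, card_univ, Fintype.card_fin, nsmul_eq_mul, mul_one] at h
  exact_mod_cast h.symm

theorem eq_zero_of_odd {κ : ℕ → ℂ} (h : ∀ n, coeff (2 * n + 1) (momentSeries κ) = 0) (n : ℕ)
    (hn : Odd n) : κ n = 0 := by
  induction n using Nat.strong_induction_on with
  | _ n ih =>
    obtain ⟨m, rfl⟩ := hn
    have hm := h m
    rw [momentSeries, coeff_mk, ncSum_card, sum_eq_single (finRotate (2 * m + 1))] at hm
    · rwa [cycleMins_finRotate, prod_singleton, cycleLen_finRotate] at hm
    · intro π hπ hne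
      obtain ⟨x, hx, hodd⟩ : ∃ x ∈ cycleMins π, Odd (cycleLen π x) := by
        by_contra! hall
        have h1 := even_sum (s := cycleMins π) (f := cycleLen π) fun x hx => Nat.not_odd_iff_even.1 (hall x hx)
        rw [sum_cycleLen] at h1
        exact Nat.not_even_two_mul_add_one m h1
      refine prod_eq_zero hx (ih _ (lt_of_le_of_ne (cycleLen_le π x) fun hl => ?_) hodd)
      exact hne (eq_finRotate_of_full hπ hx hl)
    · intro hnot
      exact absurd (finRotate_mem_NC (2 * m)) hnot

theorem evenPair_cumulantsOf (h : ∀ n : ℕ, P.φ (x ^ (2 * n + 1)) = 0) :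
    EvenPair (cumulantsOf P x) (cumulantsOf P (x ^ 2)) where
  odd := eq_zero_of_odd fun n => by rw [coeff_momentSeries_cumulantsOf, h]
  expand_momentSeries := by
    ext n
    rw [coeff_expand, coeff_momentSeries_cumulantsOf, coeff_momentSeries_cumulantsOf]
    split_ifs with hn
    · rw [← pow_mul, Nat.mul_div_cancel' hn]
    · obtain ⟨k, rfl⟩ := Nat.not_even_iff_odd.1 (mt even_iff_two_dvd.1 hn)
      rw [h]

theorem append_const {M : Type*} (a : M) (m n : ℕ) :
    Fin.append (fun _ : Fin m => a) (fun _ : Fin n => a) = fun _ => a := by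
  funext i
  induction i using Fin.addCases <;> simp

theorem second_moment_eq {m n : ℕ} (hm : 1 ≤ m) (hn : 1 ≤ n) : P.φ₂ (x ^ m) (x ^ n) =
    annularSum (cumulantsOf P x) m n + ∑ r ∈ range (m + 1), ∑ s ∈ range (n + 1),
      markedSum (cumulantsOf P x) m r * markedSum (cumulantsOf P x) n s *
        cumulantsOf₂ P x r s := by
  have h := moment_cumulant₂ P m n hm hn (fun _ => x) fun _ => x
  rw [List.ofFn_const, List.ofFn_const, List.prod_replicate, List.prod_replicate,
    append_const] at h
  rw [h, ← sum_PSNC'_eq]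
  rfl

theorem betaExt_eq {n : ℕ} (V : Finpartition (univ : Finset (Fin n))) (π : Perm (Fin n)) :
    betaExt P x V π = seqExt (fun n => cumulantsOf P x (2 * n)) (fun r s =>
      cumulantsOf₂ P x (2 * r) (2 * s) + plusSum (cumulantsOf P x) (2 * r) (2 * s)) V π := rfl

theorem cumulant₂_sq (h : ∀ n : ℕ, P.φ (x ^ (2 * n + 1)) = 0) {p q : ℕ} (hp : 1 ≤ p)
    (hq : 1 ≤ q) : cumulant₂ P p q (fun _ => x ^ 2) (fun _ => x ^ 2) =
      ∑ Q ∈ PSNC p q, betaExt P x Q.1 Q.2 := by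
  have h1 := (evenPair_cumulantsOf P x h).second_order (cumulantsOf₂ P x)
    (cumulantsOf₂ P (x ^ 2)) (fun p q hp hq => by
      rw [← second_moment_eq P x (by omega) (by omega), ← second_moment_eq P (x ^ 2) hp hq,
        pow_mul, pow_mul]) p q hp hq
  simp only [betaExt_eq]
  rw [sum_PSNC_eq, sum_PSNC'_eq]
  exact h1

end Probability

end SecondOrder

theorem theorem3p5 {A : Type*} [Ring A] [StarRing A] [Algebra ℂ A] [StarModule ℂ A]
    (P : SecondOrder.ProbabilitySpace A) (x : A) (hx : SecondOrder.IsEven P x)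
    (p q : ℕ) (hp : 1 ≤ p) (hq : 1 ≤ q) :
    SecondOrder.cumulant₂ P p q (fun _ => x ^ 2) (fun _ => x ^ 2) =
      ∑ Q ∈ SecondOrder.PSNC p q, SecondOrder.betaExt P x Q.1 Q.2 :=
  SecondOrder.cumulant₂_sq P x hx.2.2 hp hq
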